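/- All Lie algebras are finite dimensional and complex. For a Lie algebra $\mathfrak g$ let $C^0\mathfrak g=\mathfrak g$ and $C^{k+1}\mathfrak g=[C^{k}\mathfrak g,\mathfrak g]$; if $\mathfrak g$ is nilpotent, its nilindex $n(\mathfrak g)$ is the least $k$ with $C^k\mathfrak g=0$. Let $\mathrm{gr}(\mathfrak g)=\bigoplus_{i\ge 1}\mathfrak g_i$, $\mathfrak g_i=C^{i-1}\mathfrak g/C^{i}\mathfrak g$, with the bracket induced by that of $\mathfrak g$; $\mathfrak g$ is *naturally graded* if $\mathfrak g\simeq\mathrm{gr}(\mathfrak g)$. The *characteristic sequence* of a nilpotent $\mathfrak g$ is the lexicographic maximum, over $X\in\mathfrak g\setminus C^1\mathfrak g$, of the nonincreasing sequence of sizes of the Jordan blocks of $\mathrm{ad}(X)$. $\mathfrak g$ is *nonsplit* if it is not the direct sum of two nonzero ideals. A naturally graded nilpotent Lie algebra $\mathfrak g$ is a *(P2)-algebra* if the centralizer $C_{\mathfrak g}(C^p\mathfrak g)$ contains $C^p\mathfrak g$ for every $p\ge\lfloor n(\mathfrak g)/2\rfloor$ and does not contain it for $p<\lfloor n(\mathfrak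 g)/2\rfloor$, and if moreover any two homogeneous elements of $\mathrm{gr}(\mathfrak g)$ of degree $\lfloor n(\mathfrak g)/2\rfloor$ commute. An extension $0\to\mathbb C\to\mathfrak e\to\mathfrak g\to 0$ is central if $\mathbb C$ is mapped into the centre of $\mathfrak e$. A Lie algebra with basis $X_1,\dots,X_n$ is described by structural equations over the dual basis $\omega_1,\dots,\omega_n$: if $d\omega_k=\sum_{i<j}c_{ij}^k\,\omega_i\wedge\omega_j$, then $[X_i,X_j]=\sum_k c_{ij}^kX_k$ for $i<j$. For $n\ge3$ let $L_n$ be the Lie algebra with basis $X_1,\dots,X_{n+1}$ and nonzero brackets $[X_1,X_i]=X_{i+1}$ $(2\le i\le n)$; for $m\ge 3$ let $Q_{2m-1}$ be the Lie algebra with basis $X_1,\dots,X_{2m}$ and nonzero brackets $[X_1,X_i]=X_{i+1}$ $(2\le i\le 2m-1)$, $[X_j,X_{2m+1-j}]=(-1)^jX_{2m}$ $(2\le j\le m)$. **Theorem (Classification of (P2)-algebras with characteristic sequence $(2m-1,1,1)$).** Let $m\ge 4$. A nonsplit naturally graded nilpotent complex Lie algebra with characteristic sequence $(2m-1,1,1)$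 is a (P2)-algebra if and only if it is isomorphic to one of the following models of dimension $2m+1$: 1. $\mathfrak g^1_{(4,2)}$ (only for $m=4$): $$\begin{aligned} d\omega_1&=d\omega_2=0,\qquad d\omega_j=\omega_1\wedge\omega_{j-1}\ (j=3,4,5),\\ d\omega_6&=\omega_1\wedge\omega_5+\omega_2\wedge\omega_5-\omega_3\wedge\omega_4,\\ d\omega_7&=\omega_1\wedge\omega_6+2\omega_2\wedge\omega_6-\omega_3\wedge\omega_5-2\omega_2\wedge\omega_9,\\ d\omega_8&=\omega_1\wedge\omega_7+\omega_2\wedge\omega_7+\omega_3\wedge\omega_6-2\omega_4\wedge\omega_5-2\omega_3\wedge\omega_9,\\ d\omega_9&=\omega_2\wedge\omega_5-\omega_3\wedge\omega_4;\end{aligned}$$ 2. $\mathfrak g^2_{(m,t)}$, $1\le t\le m-2$: $$\begin{aligned} d\omega_1&=d\omega_2=0,\qquad d\omega_j=\omega_1\wedge\omega_{j-1}\ (3\le j\le 2m-1),\\ d\omega_{2m}&=\omega_1\wedge\omega_{2m-1}+\sum_{j=2}^{m}(-1)^j\omega_j\wedge\omega_{2m+1-j},\\ d\omega_{2m+1}&=\sum_{j=2}^{t+1}(-1)^j\omega_j\wedge\omega_{2t+3-j};\end{aligned}$$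 3. $\mathfrak g^3_{(m,m-2)}$: $$\begin{aligned} d\omega_1&=d\omega_2=0,\qquad d\omega_j=\omega_1\wedge\omega_{j-1}\ (3\le j\le 2m-3),\\ d\omega_{2m-2}&=\omega_1\wedge\omega_{2m-3}+\sum_{j=2}^{m-1}(-1)^j\omega_j\wedge\omega_{2m-1-j},\\ d\omega_{2m-1}&=\omega_1\wedge\omega_{2m-2}-(m-2)\,\omega_2\wedge\omega_{2m+1}+\sum_{j=2}^{m-1}(-1)^j(m-j)\,\omega_j\wedge\omega_{2m-j},\\ d\omega_{2m}&=\omega_1\wedge\omega_{2m-1}-(m-2)\,\omega_3\wedge\omega_{2m+1}+\sum_{j=3}^{m}(-1)^{j+1}\frac{(j-2)(2m-1-j)}{2}\,\omega_j\wedge\omega_{2m+1-j},\\ d\omega_{2m+1}&=\sum_{j=2}^{m-1}(-1)^j\omega_j\wedge\omega_{2m-1-j};\end{aligned}$$ 4. $\mathfrak g^4_{(m,m-1)}$: $$d\omega_1=d\omega_2=0,\qquad d\omega_j=\omega_1\wedge\omega_{j-1}\ (3\le j\le 2m),\qquad d\omega_{2m+1}=\sum_{j=2}^{m}(-1)^j\omega_j\wedge\omega_{2m+1-j}.$$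 All these models are nonsplit naturally graded nilpotent Lie algebras with characteristic sequence $(2m-1,1,1)$, and they are pairwise non-isomorphic. Apart from the exceptions $\mathfrak g^1_{(4,2)}$ and $\mathfrak g^3_{(m,m-2)}$ they are central extensions by $\mathbb C$ of filiform algebras: $\mathfrak g^2_{(m,t)}$ of $Q_{2m-1}$ and $\mathfrak g^4_{(m,m-1)}$ of $L_{2m-1}$. -/

import Mathlib

open scoped DirectSum

noncomputable section

namespace NatGraded

/-! ### Lie algebra laws on `ℂⁿ` given by structural equations -/

/-- The `i`-th element `ω_i` (`1 ≤ i ≤ n`) of the dual of the standard basis of `ℂⁿ`;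
by convention `ω_i = 0` for other `i`. -/
def coordForm (n i : ℕ) : (Fin n → ℂ) →ₗ[ℂ] ℂ :=
  if h : 1 ≤ i ∧ i ≤ n then LinearMap.proj ⟨i - 1, by omega⟩ else 0

/-- The two-form `ω_i ∧ ω_j` on `ℂⁿ`. -/
def wedge (n i j : ℕ) : (Fin n → ℂ) →ₗ[ℂ] (Fin n → ℂ) →ₗ[ℂ] ℂ :=
  LinearMap.mk₂ ℂ (fun x y => coordForm n i x * coordForm n j y - coordForm n j x * coordForm n i y)
    (fun x x' y => by simp only [map_add]; ring)
    (fun c x y => by simp only [map_smul, smul_eq_mul]; ring)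
    (fun x y y' => by simp only [map_add]; ring)
    (fun c x y => by simp only [map_smul, smul_eq_mul]; ring)

/-- The bilinear map `μ` on `ℂⁿ` whose `k`-th coordinate is the two-form `d k`
(`1 ≤ k ≤ n`): if `d k` is a sum of terms `c • ω_i ∧ ω_j`, then `[X_i, X_j]` has
`X_k`-coefficient `c`. -/
def lawOf {n : ℕ} (d : ℕ → (Fin n → ℂ) →ₗ[ℂ] (Fin n → ℂ) →ₗ[ℂ] ℂ) :
    (Fin n → ℂ) →ₗ[ℂ] (Fin n → ℂ) →ₗ[ℂ] (Fin n → ℂ) :=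
  LinearMap.mk₂ ℂ (fun x y k => d (k.1 + 1) x y)
    (fun x x' y => by ext; simp) (fun c x y => by ext; simp)
    (fun x y y' => by ext; simp) (fun c x y => by ext; simp)

/-- A Lie algebra law on `ℂⁿ`: an alternating bilinear map satisfying the Jacobi identity. -/
structure LieLaw (n : ℕ) where
  /-- the bilinear map -/
  μ : (Fin n → ℂ) →ₗ[ℂ] (Fin n → ℂ) →ₗ[ℂ] (Fin n → ℂ)
  alt : ∀ x, μ x x = 0
  jacobi : ∀ x y z, μ x (μ y z) + μ z (μ x y) + μ y (μ z x) = 0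

/-- The Lie algebra `(ℂⁿ, μ)` of a law `μ`. -/
def LieLaw.Alg {n : ℕ} (_ : LieLaw n) : Type := Fin n → ℂ

namespace LieLaw

variable {n : ℕ} (L : LieLaw n)

instance : AddCommGroup L.Alg := inferInstanceAs (AddCommGroup (Fin n → ℂ))

instance : Module ℂ L.Alg := inferInstanceAs (Module ℂ (Fin n → ℂ))

instance : FiniteDimensional ℂ L.Alg := inferInstanceAs (FiniteDimensional ℂ (Fin n → ℂ))

theorem antisymm (x y : Fin n → ℂ) : L.μ x y = -L.μ y x := by
  have h := L.alt (x + y)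
  simp only [map_add, LinearMap.add_apply, L.alt, zero_add, add_zero] at h
  exact eq_neg_of_add_eq_zero_right h

instance : LieRing L.Alg where
  bracket x y := L.μ x y
  add_lie x y z := LinearMap.map_add₂ L.μ x y z
  lie_add x y z := map_add (L.μ x) y z
  lie_self x := L.alt x
  leibniz_lie x y z := by
    have h := L.jacobi x y z
    have h1 : L.μ z (L.μ x y) = -L.μ (L.μ x y) z := L.antisymm _ _
    have h2 : L.μ y (L.μ z x) = -L.μ y (L.μ x z) := by rw [L.antisymm z x, map_neg]
    rw [h1, h2, ← sub_eq_add_neg, ← sub_eq_add_neg, sub_sub, sub_eq_zero] at h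
    exact h

instance : LieAlgebra ℂ L.Alg where
  lie_smul c x y := map_smul (L.μ x) c y

end LieLaw

/-! ### Checking the Jacobi identity -/

theorem wedge_apply (n i j : ℕ) (x y : Fin n → ℂ) :
    wedge n i j x y = coordForm n i x * coordForm n j y - coordForm n j x * coordForm n i y := rfl

theorem coordForm_lawOf {n : ℕ} {d : ℕ → (Fin n → ℂ) →ₗ[ℂ] (Fin n → ℂ) →ₗ[ℂ] ℂ}
    (hd : ∀ k, ¬ (1 ≤ k ∧ k ≤ n) → d k = 0) (k : ℕ) (x y : Fin n → ℂ) :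
    coordForm n k (lawOf d x y) = d k x y := by
  by_cases h : 1 ≤ k ∧ k ≤ n
  · simp only [coordForm, h, and_self, dite_true, lawOf, LinearMap.mk₂_apply, LinearMap.proj_apply]
    rw [Nat.sub_add_cancel h.1]
  · simp [coordForm, h, hd k h]

/-- The three-form `ω_i ∧ F`. -/
def ext3 (n i : ℕ) (x y z : Fin n → ℂ) (F : (Fin n → ℂ) →ₗ[ℂ] (Fin n → ℂ) →ₗ[ℂ] ℂ) : ℂ :=
  coordForm n i x * F y z + coordForm n i z * F x y + coordForm n i y * F z x

theorem ext3_zero (n i : ℕ) (x y z : Fin n → ℂ) : ext3 n i x y z 0 = 0 := by simp [ext3]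

theorem ext3_add (n i : ℕ) (x y z : Fin n → ℂ) (F G) :
    ext3 n i x y z (F + G) = ext3 n i x y z F + ext3 n i x y z G := by
  simp only [ext3, LinearMap.add_apply]; ring

theorem ext3_smul (n i : ℕ) (x y z : Fin n → ℂ) (c : ℂ) (F) :
    ext3 n i x y z (c • F) = c * ext3 n i x y z F := by
  simp only [ext3, LinearMap.smul_apply, smul_eq_mul]; ring

theorem ext3_sub (n i : ℕ) (x y z : Fin n → ℂ) (F G) :
    ext3 n i x y z (F - G) = ext3 n i x y z F - ext3 n i x y z G := by
  simp only [ext3, LinearMap.sub_apply]; ring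

theorem ext3_sum (n i : ℕ) (x y z : Fin n → ℂ) {ι : Type} (s : Finset ι) (F : ι → _) :
    ext3 n i x y z (∑ j ∈ s, F j) = ∑ j ∈ s, ext3 n i x y z (F j) := by
  simp only [ext3, LinearMap.sum_apply, Finset.mul_sum, Finset.sum_add_distrib]

theorem ext3_wedge_rot (n i j k : ℕ) (x y z : Fin n → ℂ) :
    ext3 n i x y z (wedge n j k) = ext3 n j x y z (wedge n k i) := by
  simp only [ext3, wedge_apply]; ring

theorem ext3_wedge_swap (n i j k : ℕ) (x y z : Fin n → ℂ) :
    ext3 n i x y z (wedge n j k) = - ext3 n j x y z (wedge n i k) := by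
  simp only [ext3, wedge_apply]; ring

theorem ext3_wedge_left (n i k : ℕ) (x y z : Fin n → ℂ) :
    ext3 n i x y z (wedge n i k) = 0 := by
  simp only [ext3, wedge_apply]; ring

theorem ext3_wedge_self (n i k : ℕ) (x y z : Fin n → ℂ) :
    ext3 n i x y z (wedge n k k) = 0 := by
  simp only [ext3, wedge_apply]; ring

/-- The cyclic sum of `F (x, [y, z])`. -/
def cyc {n : ℕ} (d : ℕ → (Fin n → ℂ) →ₗ[ℂ] (Fin n → ℂ) →ₗ[ℂ] ℂ) (x y z : Fin n → ℂ)
    (F : (Fin n → ℂ) →ₗ[ℂ] (Fin n → ℂ) →ₗ[ℂ] ℂ) : ℂ :=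
  F x (lawOf d y z) + F z (lawOf d x y) + F y (lawOf d z x)

section cyc

variable {n : ℕ} (d : ℕ → (Fin n → ℂ) →ₗ[ℂ] (Fin n → ℂ) →ₗ[ℂ] ℂ) (x y z : Fin n → ℂ)

theorem cyc_zero : cyc d x y z 0 = 0 := by simp [cyc]

theorem cyc_add (F G) : cyc d x y z (F + G) = cyc d x y z F + cyc d x y z G := by
  simp only [cyc, LinearMap.add_apply]; ring

theorem cyc_sub (F G) : cyc d x y z (F - G) = cyc d x y z F - cyc d x y z G := by
  simp only [cyc, LinearMap.sub_apply]; ring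

theorem cyc_smul (c : ℂ) (F) : cyc d x y z (c • F) = c * cyc d x y z F := by
  simp only [cyc, LinearMap.smul_apply, smul_eq_mul]; ring

theorem cyc_sum {ι : Type} (s : Finset ι) (F : ι → _) :
    cyc d x y z (∑ j ∈ s, F j) = ∑ j ∈ s, cyc d x y z (F j) := by
  simp only [cyc, LinearMap.sum_apply, Finset.sum_add_distrib]

theorem cyc_wedge (hd : ∀ k, ¬ (1 ≤ k ∧ k ≤ n) → d k = 0) (i j : ℕ) :
    cyc d x y z (wedge n i j) = ext3 n i x y z (d j) - ext3 n j x y z (d i) := by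
  simp only [cyc, wedge_apply, coordForm_lawOf hd, ext3]; ring

end cyc

/-- The law with structural equations `d`, provided that these are closed. -/
def LieLaw.mk' {n : ℕ} (d : ℕ → (Fin n → ℂ) →ₗ[ℂ] (Fin n → ℂ) →ₗ[ℂ] ℂ)
    (halt : ∀ k x, d k x x = 0) (hcyc : ∀ k x y z, cyc d x y z (d k) = 0) : LieLaw n where
  μ := lawOf d
  alt x := by ext k; simp [lawOf, halt]
  jacobi x y z := by ext k; exact hcyc (k.1 + 1) x y z

theorem wedge_self_apply (n i j : ℕ) (x : Fin n → ℂ) : wedge n i j x x = 0 := by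
  rw [wedge_apply]; ring

/-- The two-form `∑_{j=2}^{a} (-1)^j ω_j ∧ ω_{2a+1-j}` on `ℂⁿ`. -/
def altForm (n a : ℕ) : (Fin n → ℂ) →ₗ[ℂ] (Fin n → ℂ) →ₗ[ℂ] ℂ :=
  ∑ j ∈ Finset.Icc 2 a, (-1 : ℂ) ^ j • wedge n j (2 * a + 1 - j)

theorem altForm_self_apply (n a : ℕ) (x : Fin n → ℂ) : altForm n a x x = 0 := by
  simp [altForm, LinearMap.sum_apply, wedge_self_apply]

theorem sum_telescope (f : ℕ → ℂ) (a : ℕ) (h1 : f 1 = 0) (ha : f a = 0) (h2 : 1 ≤ a) :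
    ∑ j ∈ Finset.Icc 2 a, (f j - f (j - 1)) = 0 := by
  have key : ∀ b, 1 ≤ b → ∑ j ∈ Finset.Icc 2 b, (f j - f (j - 1)) = f b - f 1 := by
    intro b hb
    induction b, hb using Nat.le_induction with
    | base => simp
    | succ b hb ih => rw [Finset.sum_Icc_succ_top (by omega), ih]; simp
  rw [key a h2, h1, ha, sub_zero]

/-- `d(ω_i ∧ ω_j)` when `dω_i = ω_1 ∧ ω_{i-1}` and `dω_j = ω_1 ∧ ω_{j-1}`. -/
theorem cyc_wedge_chain {n : ℕ} {d : ℕ → (Fin n → ℂ) →ₗ[ℂ] (Fin n → ℂ) →ₗ[ℂ] ℂ}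
    (hd : ∀ k, ¬ (1 ≤ k ∧ k ≤ n) → d k = 0) (x y z : Fin n → ℂ) {i j : ℕ}
    (hi : d i = wedge n 1 (i - 1)) (hj : d j = wedge n 1 (j - 1)) :
    cyc d x y z (wedge n i j) =
      -(ext3 n 1 x y z (wedge n i (j - 1)) + ext3 n 1 x y z (wedge n (i - 1) j)) := by
  rw [cyc_wedge d x y z hd, hi, hj, ext3_wedge_swap n i 1, ext3_wedge_rot n j 1 (i - 1)]
  ring

theorem cyc_altForm {n a : ℕ} {d : ℕ → (Fin n → ℂ) →ₗ[ℂ] (Fin n → ℂ) →ₗ[ℂ] ℂ}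
    (hd : ∀ k, ¬ (1 ≤ k ∧ k ≤ n) → d k = 0)
    (h : ∀ j, 2 ≤ j → j + 1 ≤ 2 * a → d j = wedge n 1 (j - 1)) (x y z : Fin n → ℂ) :
    cyc d x y z (altForm n a) = 0 := by
  rcases Nat.eq_zero_or_pos a with rfl | ha
  · simp [altForm, cyc]
  rw [altForm, cyc_sum]
  rw [← neg_eq_zero, ← Finset.sum_neg_distrib,
    ← sum_telescope (fun j => (-1) ^ j * ext3 n 1 x y z (wedge n j (2 * a - j))) a
      (by simp [ext3_wedge_left])
      (by simp [show 2 * a - a = a by omega, ext3_wedge_self]) ha]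
  refine Finset.sum_congr rfl fun j hj => ?_
  rw [Finset.mem_Icc] at hj
  rw [cyc_smul, cyc_wedge_chain hd x y z (h _ hj.1 (by omega)) (h _ (by omega) (by omega)),
    show 2 * a + 1 - j - 1 = 2 * a - j by omega, show 2 * a - (j - 1) = 2 * a + 1 - j by omega]
  obtain ⟨i, rfl⟩ : ∃ i, j = i + 1 := ⟨j - 1, by omega⟩
  simp only [Nat.add_sub_cancel, pow_succ]
  ring

/-! ### The models -/

/-- Structural equations of `L_n`: `[X_1, X_i] = X_{i+1}` for `2 ≤ i ≤ n`. -/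
def dL (n : ℕ) (k : ℕ) : (Fin (n + 1) → ℂ) →ₗ[ℂ] (Fin (n + 1) → ℂ) →ₗ[ℂ] ℂ :=
  if 3 ≤ k ∧ k ≤ n + 1 then wedge (n + 1) 1 (k - 1) else 0

/-- Structural equations of `Q_{2m-1}`: `[X_1, X_i] = X_{i+1}` for `2 ≤ i ≤ 2m-1` and
`[X_j, X_{2m+1-j}] = (-1)^j X_{2m}` for `2 ≤ j ≤ m`. -/
def dQ (m : ℕ) (k : ℕ) : (Fin (2 * m) → ℂ) →ₗ[ℂ] (Fin (2 * m) → ℂ) →ₗ[ℂ] ℂ :=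
  if 3 ≤ k ∧ k + 1 ≤ 2 * m then wedge (2 * m) 1 (k - 1)
  else if k = 2 * m then
    wedge (2 * m) 1 (2 * m - 1)
      + ∑ j ∈ Finset.Icc 2 m, (-1 : ℂ) ^ j • wedge (2 * m) j (2 * m + 1 - j)
  else 0

/-- Structural equations of the nine-dimensional model `𝔤¹_(4,2)`. -/
def dg1 (k : ℕ) : (Fin 9 → ℂ) →ₗ[ℂ] (Fin 9 → ℂ) →ₗ[ℂ] ℂ :=
  if 3 ≤ k ∧ k ≤ 5 then wedge 9 1 (k - 1)
  else if k = 6 then wedge 9 1 5 + wedge 9 2 5 - wedge 9 3 4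
  else if k = 7 then
    wedge 9 1 6 + (2 : ℂ) • wedge 9 2 6 - wedge 9 3 5 - (2 : ℂ) • wedge 9 2 9
  else if k = 8 then
    wedge 9 1 7 + wedge 9 2 7 + wedge 9 3 6 - (2 : ℂ) • wedge 9 4 5 - (2 : ℂ) • wedge 9 3 9
  else if k = 9 then wedge 9 2 5 - wedge 9 3 4
  else 0

/-- Structural equations of `𝔤²_(m,t)`. -/
def dg2 (m t : ℕ) (k : ℕ) : (Fin (2 * m + 1) → ℂ) →ₗ[ℂ] (Fin (2 * m + 1) → ℂ) →ₗ[ℂ] ℂ :=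
  if 3 ≤ k ∧ k + 1 ≤ 2 * m then wedge (2 * m + 1) 1 (k - 1)
  else if k = 2 * m then
    wedge (2 * m + 1) 1 (2 * m - 1)
      + ∑ j ∈ Finset.Icc 2 m, (-1 : ℂ) ^ j • wedge (2 * m + 1) j (2 * m + 1 - j)
  else if k = 2 * m + 1 then
    ∑ j ∈ Finset.Icc 2 (t + 1), (-1 : ℂ) ^ j • wedge (2 * m + 1) j (2 * t + 3 - j)
  else 0

/-- Structural equations of `𝔤³_(m,m-2)`. -/
def dg3 (m : ℕ) (k : ℕ) : (Fin (2 * m + 1) → ℂ) →ₗ[ℂ] (Fin (2 * m + 1) → ℂ) →ₗ[ℂ] ℂ :=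
  if 3 ≤ k ∧ k + 3 ≤ 2 * m then wedge (2 * m + 1) 1 (k - 1)
  else if k + 2 = 2 * m then
    wedge (2 * m + 1) 1 (2 * m - 3)
      + ∑ j ∈ Finset.Icc 2 (m - 1), (-1 : ℂ) ^ j • wedge (2 * m + 1) j (2 * m - 1 - j)
  else if k + 1 = 2 * m then
    wedge (2 * m + 1) 1 (2 * m - 2) - ((m : ℂ) - 2) • wedge (2 * m + 1) 2 (2 * m + 1)
      + ∑ j ∈ Finset.Icc 2 (m - 1),
          ((-1 : ℂ) ^ j * ((m : ℂ) - j)) • wedge (2 * m + 1) j (2 * m - j)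
  else if k = 2 * m then
    wedge (2 * m + 1) 1 (2 * m - 1) - ((m : ℂ) - 2) • wedge (2 * m + 1) 3 (2 * m + 1)
      + ∑ j ∈ Finset.Icc 3 m,
          ((-1 : ℂ) ^ (j + 1) * (((j : ℂ) - 2) * (2 * (m : ℂ) - 1 - j) / 2)) •
            wedge (2 * m + 1) j (2 * m + 1 - j)
  else if k = 2 * m + 1 then
    ∑ j ∈ Finset.Icc 2 (m - 1), (-1 : ℂ) ^ j • wedge (2 * m + 1) j (2 * m - 1 - j)
  else 0

/-- Structural equations of `𝔤⁴_(m,m-1)`. -/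
def dg4 (m : ℕ) (k : ℕ) : (Fin (2 * m + 1) → ℂ) →ₗ[ℂ] (Fin (2 * m + 1) → ℂ) →ₗ[ℂ] ℂ :=
  if 3 ≤ k ∧ k ≤ 2 * m then wedge (2 * m + 1) 1 (k - 1)
  else if k = 2 * m + 1 then
    ∑ j ∈ Finset.Icc 2 m, (-1 : ℂ) ^ j • wedge (2 * m + 1) j (2 * m + 1 - j)
  else 0

/-- The filiform Lie algebra law `L_n` on `ℂ^{n+1}`. -/
def lawL (n : ℕ) : LieLaw (n + 1) :=
  LieLaw.mk' (dL n)
    (fun k x => by unfold dL; split_ifs <;> simp [wedge_self_apply])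
    (fun k x y z => by
      have hd : ∀ k, ¬ (1 ≤ k ∧ k ≤ n + 1) → dL n k = 0 := fun k hk => by
        unfold dL; rw [if_neg (by omega)]
      by_cases h : 3 ≤ k ∧ k ≤ n + 1
      · have e : dL n k = wedge (n + 1) 1 (k - 1) := by unfold dL; rw [if_pos h]
        have e1 : dL n 1 = 0 := by unfold dL; rw [if_neg (by omega)]
        rw [e, cyc_wedge _ _ _ _ hd, e1, ext3_zero]
        unfold dL; split_ifs
        · rw [ext3_wedge_left, sub_zero]
        · rw [ext3_zero, sub_zero]
      · have e : dL n k = 0 := by unfold dL; rw [if_neg h]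
        rw [e, cyc_zero])

theorem cyc_wedge_one {n : ℕ} {d : ℕ → (Fin n → ℂ) →ₗ[ℂ] (Fin n → ℂ) →ₗ[ℂ] ℂ}
    (hd : ∀ k, ¬ (1 ≤ k ∧ k ≤ n) → d k = 0) (h1 : d 1 = 0) {p q : ℕ}
    (hp : d p = wedge n 1 q) (x y z : Fin n → ℂ) : cyc d x y z (wedge n 1 p) = 0 := by
  rw [cyc_wedge _ _ _ _ hd, h1, ext3_zero, hp, ext3_wedge_left, sub_zero]

theorem wedge_self (n i : ℕ) : wedge n i i = 0 := by
  ext x y; simp [wedge_apply]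

/-- The filiform Lie algebra law `Q_{2m-1}` on `ℂ^{2m}`. -/
def lawQ (m : ℕ) (hm : 3 ≤ m) : LieLaw (2 * m) :=
  LieLaw.mk' (dQ m)
    (fun k x => by
      unfold dQ; split_ifs <;> simp [LinearMap.sum_apply, wedge_self_apply])
    (fun k x y z => by
      have hd : ∀ k, ¬ (1 ≤ k ∧ k ≤ 2 * m) → dQ m k = 0 := fun k hk => by
        unfold dQ; rw [if_neg (by omega), if_neg (by omega)]
      have hc : ∀ j, 2 ≤ j → j + 1 ≤ 2 * m → dQ m j = wedge (2 * m) 1 (j - 1) := by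
        intro j h2 hj
        rcases h2.eq_or_lt with rfl | h3
        · unfold dQ; rw [if_neg (by omega), if_neg (by omega), wedge_self]
        · unfold dQ; rw [if_pos ⟨h3, hj⟩]
      have h1 : dQ m 1 = 0 := by unfold dQ; rw [if_neg (by omega), if_neg (by omega)]
      by_cases ha : 2 ≤ k ∧ k + 1 ≤ 2 * m
      · rw [hc k ha.1 ha.2]
        by_cases hk : k = 2
        · subst hk; rw [wedge_self, cyc_zero]
        · exact cyc_wedge_one hd h1 (hc (k - 1) (by omega) (by omega)) x y z
      · by_cases hb : k = 2 * m
        · have e : dQ m k = wedge (2 * m) 1 (2 * m - 1) + altForm (2 * m) m := by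
            unfold dQ altForm; rw [if_neg (by omega), if_pos hb]
          rw [e, cyc_add, cyc_altForm hd hc,
            cyc_wedge_one hd h1 (hc (2 * m - 1) (by omega) (by omega)), add_zero]
        · have e : dQ m k = 0 := by
            unfold dQ; rw [if_neg (by omega), if_neg hb]
          rw [e, cyc_zero])

/-- The Lie algebra law `𝔤²_(m,t)` on `ℂ^{2m+1}`. -/
def lawg2 (m t : ℕ) (hm : 4 ≤ m) (ht : t + 2 ≤ m) : LieLaw (2 * m + 1) :=
  LieLaw.mk' (dg2 m t)
    (fun k x => by
      unfold dg2; split_ifs <;> simp [LinearMap.sum_apply, wedge_self_apply])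
    (fun k x y z => by
      have hd : ∀ k, ¬ (1 ≤ k ∧ k ≤ 2 * m + 1) → dg2 m t k = 0 := fun k hk => by
        unfold dg2; rw [if_neg (by omega), if_neg (by omega), if_neg (by omega)]
      have hc : ∀ j, 2 ≤ j → j + 1 ≤ 2 * m → dg2 m t j = wedge (2 * m + 1) 1 (j - 1) := by
        intro j h2 hj
        rcases h2.eq_or_lt with rfl | h3
        · unfold dg2
          rw [if_neg (by omega), if_neg (by omega), if_neg (by omega), wedge_self]
        · unfold dg2; rw [if_pos ⟨h3, hj⟩]
      have h1 : dg2 m t 1 = 0 := by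
        unfold dg2; rw [if_neg (by omega), if_neg (by omega), if_neg (by omega)]
      by_cases ha : 2 ≤ k ∧ k + 1 ≤ 2 * m
      · rw [hc k ha.1 ha.2]
        by_cases hk : k = 2
        · subst hk; rw [wedge_self, cyc_zero]
        · exact cyc_wedge_one hd h1 (hc (k - 1) (by omega) (by omega)) x y z
      · by_cases hb : k = 2 * m
        · have e : dg2 m t k = wedge (2 * m + 1) 1 (2 * m - 1) + altForm (2 * m + 1) m := by
            unfold dg2 altForm; rw [if_neg (by omega), if_pos hb]
          rw [e, cyc_add, cyc_altForm hd hc,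
            cyc_wedge_one hd h1 (hc (2 * m - 1) (by omega) (by omega)), add_zero]
        · by_cases he : k = 2 * m + 1
          · have e : dg2 m t k = altForm (2 * m + 1) (t + 1) := by
              unfold dg2 altForm; rw [if_neg (by omega), if_neg hb, if_pos he]; rfl
            rw [e, cyc_altForm hd fun j hj hj' => hc j hj (by omega)]
          · have e : dg2 m t k = 0 := by
              unfold dg2; rw [if_neg (by omega), if_neg hb, if_neg he]
            rw [e, cyc_zero])

/-- The Lie algebra law `𝔤⁴_(m,m-1)` on `ℂ^{2m+1}`. -/
def lawg4 (m : ℕ) (hm : 4 ≤ m) : LieLaw (2 * m + 1) :=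
  LieLaw.mk' (dg4 m)
    (fun k x => by
      unfold dg4; split_ifs <;> simp [LinearMap.sum_apply, wedge_self_apply])
    (fun k x y z => by
      have hd : ∀ k, ¬ (1 ≤ k ∧ k ≤ 2 * m + 1) → dg4 m k = 0 := fun k hk => by
        unfold dg4; rw [if_neg (by omega), if_neg (by omega)]
      have hc : ∀ j, 2 ≤ j → j ≤ 2 * m → dg4 m j = wedge (2 * m + 1) 1 (j - 1) := by
        intro j h2 hj
        rcases h2.eq_or_lt with rfl | h3
        · unfold dg4; rw [if_neg (by omega), if_neg (by omega), wedge_self]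
        · unfold dg4; rw [if_pos ⟨h3, hj⟩]
      have h1 : dg4 m 1 = 0 := by unfold dg4; rw [if_neg (by omega), if_neg (by omega)]
      by_cases ha : 2 ≤ k ∧ k ≤ 2 * m
      · rw [hc k ha.1 ha.2]
        by_cases hk : k = 2
        · subst hk; rw [wedge_self, cyc_zero]
        · exact cyc_wedge_one hd h1 (hc (k - 1) (by omega) (by omega)) x y z
      · by_cases hb : k = 2 * m + 1
        · have e : dg4 m k = altForm (2 * m + 1) m := by
            unfold dg4 altForm; rw [if_neg (by omega), if_pos hb]
          rw [e, cyc_altForm hd fun j hj hj' => hc j hj (by omega)]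
        · have e : dg4 m k = 0 := by
            unfold dg4; rw [if_neg (by omega), if_neg hb]
          rw [e, cyc_zero])

/-- The Lie algebra law `𝔤¹_(4,2)` on `ℂ⁹`. -/
def lawg1 : LieLaw 9 :=
  LieLaw.mk' dg1
    (fun k x => by unfold dg1; split_ifs <;> simp [wedge_self_apply])
    (fun k x y z => by
      have hd : ∀ k, ¬ (1 ≤ k ∧ k ≤ 9) → dg1 k = 0 := fun k hk => by
        unfold dg1
        rw [if_neg (by omega), if_neg (by omega), if_neg (by omega), if_neg (by omega),
          if_neg (by omega)]
      by_cases hk : 1 ≤ k ∧ k ≤ 9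
      · obtain ⟨h1, h2⟩ := hk
        interval_cases k <;>
          simp [dg1, cyc_add, cyc_sub, cyc_smul, cyc_zero, cyc_wedge _ _ _ _ hd] <;>
          simp [ext3, wedge_apply] <;> ring
      · rw [hd k hk, cyc_zero])

/-- The Lie algebra law `𝔤³_(m,m-2)` on `ℂ^{2m+1}`. -/
def lawg3 (m : ℕ) (hm : 4 ≤ m) : LieLaw (2 * m + 1) :=
  LieLaw.mk' (dg3 m)
    (fun k x => by
      unfold dg3; split_ifs <;> simp [LinearMap.sum_apply, wedge_self_apply])
    (fun k x y z => by
      have hd : ∀ k, ¬ (1 ≤ k ∧ k ≤ 2 * m + 1) → dg3 m k = 0 := fun k hk => by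
        unfold dg3
        rw [if_neg (by omega), if_neg (by omega), if_neg (by omega), if_neg (by omega),
          if_neg (by omega)]
      have hlow : ∀ k, k ≤ 2 → dg3 m k = 0 := fun k hk => by
        unfold dg3
        rw [if_neg (by omega), if_neg (by omega), if_neg (by omega), if_neg (by omega),
          if_neg (by omega)]
      have h1 := hlow 1 (by omega)
      have hc : ∀ j, 2 ≤ j → j + 3 ≤ 2 * m → dg3 m j = wedge (2 * m + 1) 1 (j - 1) := by
        intro j h2 hj
        rcases h2.eq_or_lt with rfl | h3
        · rw [hlow 2 le_rfl, wedge_self]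
        · unfold dg3; rw [if_pos ⟨h3, hj⟩]
      have halt : ∑ j ∈ Finset.Icc 2 (m - 1),
          (-1 : ℂ) ^ j • wedge (2 * m + 1) j (2 * m - 1 - j) = altForm (2 * m + 1) (m - 1) := by
        unfold altForm
        exact Finset.sum_congr rfl fun j _ => by
          rw [show 2 * (m - 1) + 1 - j = 2 * m - 1 - j by omega]
      have hA : dg3 m (2 * m - 2) =
          wedge (2 * m + 1) 1 (2 * m - 3) + altForm (2 * m + 1) (m - 1) := by
        unfold dg3; rw [if_neg (by omega), if_pos (by omega), halt]
      have hB : dg3 m (2 * m - 1) =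
          wedge (2 * m + 1) 1 (2 * m - 2) - ((m : ℂ) - 2) • wedge (2 * m + 1) 2 (2 * m + 1)
            + ∑ j ∈ Finset.Icc 2 (m - 1),
              ((-1 : ℂ) ^ j * ((m : ℂ) - j)) • wedge (2 * m + 1) j (2 * m - j) := by
        unfold dg3; rw [if_neg (by omega), if_neg (by omega), if_pos (by omega)]
      have hC : dg3 m (2 * m) =
          wedge (2 * m + 1) 1 (2 * m - 1) - ((m : ℂ) - 2) • wedge (2 * m + 1) 3 (2 * m + 1)
            + ∑ j ∈ Finset.Icc 3 m,
              ((-1 : ℂ) ^ (j + 1) * (((j : ℂ) - 2) * (2 * (m : ℂ) - 1 - j) / 2)) •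
                wedge (2 * m + 1) j (2 * m + 1 - j) := by
        unfold dg3
        rw [if_neg (by omega), if_neg (by omega), if_neg (by omega), if_pos rfl]
      have hD : dg3 m (2 * m + 1) = altForm (2 * m + 1) (m - 1) := by
        unfold dg3
        rw [if_neg (by omega), if_neg (by omega), if_neg (by omega), if_neg (by omega),
          if_pos rfl, halt]
      have hcA : cyc (dg3 m) x y z (altForm (2 * m + 1) (m - 1)) = 0 :=
        cyc_altForm hd (fun j hj hj' => hc j hj (by omega)) x y z
      by_cases ha : 2 ≤ k ∧ k + 3 ≤ 2 * m
      · rw [hc k ha.1 ha.2]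
        by_cases hk : k = 2
        · subst hk; rw [wedge_self, cyc_zero]
        · exact cyc_wedge_one hd h1 (hc (k - 1) (by omega) (by omega)) x y z
      by_cases hk1 : k = 2 * m - 2
      · rw [hk1, hA, cyc_add, hcA,
          cyc_wedge_one hd h1 (hc (2 * m - 3) (by omega) (by omega)), add_zero]
      by_cases hk2 : k = 2 * m - 1
      · have e1 : cyc (dg3 m) x y z (wedge (2 * m + 1) 1 (2 * m - 2)) =
            ∑ j ∈ Finset.Icc 2 (m - 1),
              (-1 : ℂ) ^ j * ext3 (2 * m + 1) 1 x y z (wedge (2 * m + 1) j (2 * m - 1 - j)) := by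
          rw [cyc_wedge _ _ _ _ hd, h1, ext3_zero, sub_zero, hA, ext3_add, ext3_wedge_left,
            zero_add, ← halt, ext3_sum]
          exact Finset.sum_congr rfl fun j _ => ext3_smul ..
        have e2 : cyc (dg3 m) x y z (wedge (2 * m + 1) 2 (2 * m + 1)) =
            ext3 (2 * m + 1) 2 x y z (altForm (2 * m + 1) (m - 1)) := by
          rw [cyc_wedge _ _ _ _ hd, hlow 2 le_rfl, ext3_zero, sub_zero, hD]
        have e3 : ∀ j ∈ Finset.Icc 2 (m - 1),
            cyc (dg3 m) x y z
                (((-1 : ℂ) ^ j * ((m : ℂ) - j)) • wedge (2 * m + 1) j (2 * m - j)) =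
              ((-1 : ℂ) ^ j * ((m : ℂ) - j)) *
                -(ext3 (2 * m + 1) 1 x y z (wedge (2 * m + 1) j (2 * m - 1 - j)) +
                  ext3 (2 * m + 1) 1 x y z (wedge (2 * m + 1) (j - 1) (2 * m - j))) +
              if j = 2 then ((m : ℂ) - 2) *
                ext3 (2 * m + 1) 2 x y z (altForm (2 * m + 1) (m - 1)) else 0 := by
          intro j hj
          rw [Finset.mem_Icc] at hj
          rw [cyc_smul]
          by_cases h2 : j = 2
          · subst h2
            rw [cyc_wedge _ _ _ _ hd, hlow 2 le_rfl, ext3_zero, sub_zero, hA, ext3_add,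
              ext3_wedge_swap _ 2 1, if_pos rfl, show 2 * m - 1 - 2 = 2 * m - 3 by omega,
              ext3_wedge_left]
            push_cast
            ring
          · rw [if_neg h2, add_zero, cyc_wedge_chain hd x y z (hc _ hj.1 (by omega))
              (hc _ (by omega) (by omega)), show 2 * m - j - 1 = 2 * m - 1 - j by omega]
        rw [hk2, hB, cyc_add, cyc_sub, cyc_smul, cyc_sum, Finset.sum_congr rfl e3,
          Finset.sum_add_distrib, Finset.sum_ite_eq',
          if_pos (Finset.mem_Icc.2 ⟨le_rfl, by omega⟩), e1, e2]
        have key := sum_telescope (fun j => (-1 : ℂ) ^ j * ((m : ℂ) - 1 - j) *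
            ext3 (2 * m + 1) 1 x y z (wedge (2 * m + 1) j (2 * m - 1 - j))) (m - 1)
          (by simp [ext3_wedge_left])
          (by rw [Nat.cast_sub (by omega)]; simp) (by omega)
        rw [← neg_eq_zero, ← key, ← sub_eq_zero]
        have : ∀ a b c d : ℂ, -(a - b + (c + b)) - d = -(a + c + d) := fun a b c d => by ring
        rw [this, neg_eq_zero, ← Finset.sum_add_distrib, ← Finset.sum_add_distrib]
        refine Finset.sum_eq_zero fun j hj => ?_
        rw [Finset.mem_Icc] at hj
        rw [show 2 * m - 1 - (j - 1) = 2 * m - j by omega]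
        obtain ⟨i, rfl⟩ : ∃ i, j = i + 1 := ⟨j - 1, by omega⟩
        simp only [Nat.add_sub_cancel, pow_succ]
        push_cast
        ring
      by_cases hk3 : k = 2 * m
      · have e1 : cyc (dg3 m) x y z (wedge (2 * m + 1) 1 (2 * m - 1)) =
            -(((m : ℂ) - 2) * ext3 (2 * m + 1) 1 x y z (wedge (2 * m + 1) 2 (2 * m + 1))) +
            ∑ j ∈ Finset.Icc 2 m, ((-1 : ℂ) ^ j * ((m : ℂ) - j)) *
              ext3 (2 * m + 1) 1 x y z (wedge (2 * m + 1) j (2 * m - j)) := by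
          rw [cyc_wedge _ _ _ _ hd, h1, ext3_zero, sub_zero, hB, ext3_add, ext3_sub,
            ext3_wedge_left, zero_sub, ext3_smul, ext3_sum]
          obtain ⟨p, rfl⟩ : ∃ p, m = p + 1 := ⟨m - 1, by omega⟩
          rw [Finset.sum_Icc_succ_top (by omega), sub_self, mul_zero, zero_mul, add_zero]
          simp only [Nat.add_sub_cancel, ext3_smul]
        have e2 : cyc (dg3 m) x y z (wedge (2 * m + 1) 3 (2 * m + 1)) =
            ext3 (2 * m + 1) 3 x y z (altForm (2 * m + 1) (m - 1)) -
            ext3 (2 * m + 1) 1 x y z (wedge (2 * m + 1) 2 (2 * m + 1)) := by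
          rw [cyc_wedge _ _ _ _ hd, hD, hc 3 (by omega) (by omega),
            ext3_wedge_rot _ (2 * m + 1) 1]
        have e3 : ∀ j ∈ Finset.Icc 3 m,
            cyc (dg3 m) x y z
                (((-1 : ℂ) ^ (j + 1) * (((j : ℂ) - 2) * (2 * (m : ℂ) - 1 - j) / 2)) •
                  wedge (2 * m + 1) j (2 * m + 1 - j)) =
              ((-1 : ℂ) ^ (j + 1) * (((j : ℂ) - 2) * (2 * (m : ℂ) - 1 - j) / 2)) *
                -(ext3 (2 * m + 1) 1 x y z (wedge (2 * m + 1) j (2 * m - j)) +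
                  ext3 (2 * m + 1) 1 x y z (wedge (2 * m + 1) (j - 1) (2 * m + 1 - j))) +
              if j = 3 then ((m : ℂ) - 2) *
                ext3 (2 * m + 1) 3 x y z (altForm (2 * m + 1) (m - 1)) else 0 := by
          intro j hj
          rw [Finset.mem_Icc] at hj
          rw [cyc_smul]
          by_cases h3 : j = 3
          · subst h3
            rw [show 2 * m + 1 - 3 = 2 * m - 2 by omega, cyc_wedge _ _ _ _ hd,
              hc 3 (by omega) (by omega), hA, ext3_add,
              ext3_wedge_swap _ 3 1, if_pos rfl, ext3_wedge_rot _ (2 * m - 2) 1]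
            push_cast
            ring
          · rw [if_neg h3, add_zero, cyc_wedge_chain hd x y z (hc _ (by omega) (by omega))
              (hc _ (by omega) (by omega)), show 2 * m + 1 - j - 1 = 2 * m - j by omega]
        have e4 : ∑ j ∈ Finset.Icc 3 m,
              ((-1 : ℂ) ^ (j + 1) * (((j : ℂ) - 2) * (2 * (m : ℂ) - 1 - j) / 2)) *
                -(ext3 (2 * m + 1) 1 x y z (wedge (2 * m + 1) j (2 * m - j)) +
                  ext3 (2 * m + 1) 1 x y z (wedge (2 * m + 1) (j - 1) (2 * m + 1 - j))) =
            ∑ j ∈ Finset.Icc 2 m,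
              ((-1 : ℂ) ^ (j + 1) * (((j : ℂ) - 2) * (2 * (m : ℂ) - 1 - j) / 2)) *
                -(ext3 (2 * m + 1) 1 x y z (wedge (2 * m + 1) j (2 * m - j)) +
                  ext3 (2 * m + 1) 1 x y z (wedge (2 * m + 1) (j - 1) (2 * m + 1 - j))) := by
          refine Finset.sum_subset (Finset.Icc_subset_Icc_left (by omega)) fun j hj hj' => ?_
          rw [Finset.mem_Icc] at hj hj'
          obtain rfl : j = 2 := by omega
          push_cast
          ring
        rw [hk3, hC, cyc_add, cyc_sub, cyc_smul, cyc_sum, Finset.sum_congr rfl e3,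
          Finset.sum_add_distrib, Finset.sum_ite_eq',
          if_pos (Finset.mem_Icc.2 ⟨le_rfl, by omega⟩), e1, e2, e4]
        have key := sum_telescope (fun j =>
            (-1 : ℂ) ^ j * (((j : ℂ) - 1) * (2 * (m : ℂ) - 2 - j) / 2) *
              ext3 (2 * m + 1) 1 x y z (wedge (2 * m + 1) j (2 * m - j))) m
          (by simp)
          (by simp [show 2 * m - m = m by omega, ext3_wedge_self]) (by omega)
        rw [← key, ← sub_eq_zero]
        have : ∀ a b c d e f : ℂ, -(a * b) + c - a * (d - b) + (e + a * d) - f = c + e - f :=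
          fun a b c d e f => by ring
        rw [this, ← Finset.sum_add_distrib, ← Finset.sum_sub_distrib]
        refine Finset.sum_eq_zero fun j hj => ?_
        rw [Finset.mem_Icc] at hj
        rw [show 2 * m - (j - 1) = 2 * m + 1 - j by omega]
        obtain ⟨i, rfl⟩ : ∃ i, j = i + 1 := ⟨j - 1, by omega⟩
        simp only [Nat.add_sub_cancel, pow_succ]
        push_cast
        ring
      by_cases hk4 : k = 2 * m + 1
      · rw [hk4, hD, hcA]
      · have e : dg3 m k = 0 := by
          rcases Nat.lt_or_ge k 3 with h | h
          · exact hlow k (by omega)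
          · exact hd k (by omega)
        rw [e, cyc_zero])

/-- The list of models: `𝔤¹_(4,2)`, `𝔤²_(m,t)` for `1 ≤ t ≤ m - 2`, `𝔤³_(m,m-2)` and
`𝔤⁴_(m,m-1)`, where `m ≥ 4`. -/
inductive Model : Type
  | g1 : Model
  | g2 (m t : ℕ) (hm : 4 ≤ m) (ht : 1 ≤ t) (ht' : t + 2 ≤ m) : Model
  | g3 (m : ℕ) (hm : 4 ≤ m) : Model
  | g4 (m : ℕ) (hm : 4 ≤ m) : Model

/-- The parameter `m` of a model (its dimension is `2m+1`). -/
def Model.m : Model → ℕ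
  | g1 => 4
  | g2 m _ _ _ _ => m
  | g3 m _ => m
  | g4 m _ => m

/-- The Lie algebra law of a model. -/
def Model.law : (M : Model) → LieLaw (2 * M.m + 1)
  | g1 => lawg1
  | g2 m t hm _ ht' => lawg2 m t hm ht'
  | g3 m hm => lawg3 m hm
  | g4 m hm => lawg4 m hm

/-! ### Notions for nilpotent Lie algebras -/

section Notions

variable (𝔤 : Type*) [LieRing 𝔤] [LieAlgebra ℂ 𝔤]

/-- The term `C^k 𝔤` of the descending central sequence: `C^0 𝔤 = 𝔤`,
`C^{k+1} 𝔤 = [𝔤, C^k 𝔤]`. -/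
abbrev C (k : ℕ) : LieIdeal ℂ 𝔤 := LieModule.lowerCentralSeries ℂ 𝔤 𝔤 k

theorem lie_mem_C {i j : ℕ} {x y : 𝔤} (hx : x ∈ C 𝔤 i) (hy : y ∈ C 𝔤 j) :
    ⁅x, y⁆ ∈ C 𝔤 (i + j + 1) := by
  induction i generalizing x y j with
  | zero =>
    rw [Nat.zero_add, C, LieModule.lowerCentralSeries_succ]
    exact LieSubmodule.lie_mem_lie (LieSubmodule.mem_top x) hy
  | succ i ih =>
    rw [C, LieModule.lowerCentralSeries_succ, ← LieSubmodule.mem_toSubmodule,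
      LieSubmodule.lieIdeal_oper_eq_linear_span'] at hx
    induction hx using Submodule.span_induction with
    | mem x h =>
      obtain ⟨a, -, b, hb, rfl⟩ := h
      rw [lie_lie]
      refine sub_mem ?_ ?_
      · have h1 := ih hb hy
        rw [show i + 1 + j + 1 = (i + j + 1) + 1 by omega, C, LieModule.lowerCentralSeries_succ]
        exact LieSubmodule.lie_mem_lie (LieSubmodule.mem_top a) h1
      · have h2 : ⁅a, y⁆ ∈ C 𝔤 (j + 1) := by
          rw [C, LieModule.lowerCentralSeries_succ]
          exact LieSubmodule.lie_mem_lie (LieSubmodule.mem_top a) hy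
        have h3 := ih hb h2
        rwa [show i + (j + 1) + 1 = i + 1 + j + 1 by omega] at h3
    | zero => rw [zero_lie]; exact zero_mem _
    | add u v _ _ hu hv => rw [add_lie]; exact add_mem hu hv
    | smul c u _ hu => rw [smul_lie]; exact (C 𝔤 _).smul_mem c hu

/-- The block `C^i 𝔤 / C^{i+1} 𝔤` of the associated graduation (it is the block of degree
`i + 1`). -/
abbrev GrPiece (i : ℕ) : Type _ :=
  (C 𝔤 i).toSubmodule ⧸ (C 𝔤 (i + 1)).toSubmodule.submoduleOf (C 𝔤 i).toSubmodule

/-- The bracket `C^i / C^{i+1} × C^j / C^{j+1} → C^{i+j+1} / C^{i+j+2}` induced by the bracket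
of `𝔤`. -/
def pieceBracket (i j : ℕ) : GrPiece 𝔤 i →ₗ[ℂ] GrPiece 𝔤 j →ₗ[ℂ] GrPiece 𝔤 (i + j + 1) :=
  LinearMap.liftQ₂ _ _
    (LinearMap.mk₂ ℂ
      (fun (x : (C 𝔤 i).toSubmodule) (y : (C 𝔤 j).toSubmodule) =>
        (Submodule.Quotient.mk ⟨⁅(x : 𝔤), (y : 𝔤)⁆, lie_mem_C 𝔤 x.2 y.2⟩ :
          GrPiece 𝔤 (i + j + 1)))
      (fun x x' y => by
        rw [← Submodule.Quotient.mk_add]; congr 1; ext; simp)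
      (fun c x y => by
        rw [← Submodule.Quotient.mk_smul]; congr 1; ext; simp)
      (fun x y y' => by
        rw [← Submodule.Quotient.mk_add]; congr 1; ext; simp)
      (fun c x y => by
        rw [← Submodule.Quotient.mk_smul]; congr 1; ext; simp))
    (fun x hx => by
      ext y
      refine (Submodule.Quotient.mk_eq_zero _).2 ?_
      have h := lie_mem_C 𝔤 (i := i + 1) (j := j) hx y.2
      rwa [show i + 1 + j + 1 = i + j + 1 + 1 by omega] at h)
    (fun y hy => by
      ext x
      refine (Submodule.Quotient.mk_eq_zero _).2 ?_
      exact lie_mem_C 𝔤 (i := i) (j := j + 1) x.2 hy)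

/-- The vector space `gr(𝔤)`, the direct sum of the blocks `C^i 𝔤 / C^{i+1} 𝔤`. -/
abbrev Gr : Type _ := ⨁ i, GrPiece 𝔤 i

/-- The bracket of `gr(𝔤)`. -/
def grBracket : Gr 𝔤 →ₗ[ℂ] Gr 𝔤 →ₗ[ℂ] Gr 𝔤 :=
  DirectSum.toModule ℂ ℕ _ fun i => LinearMap.flip <|
    DirectSum.toModule ℂ ℕ _ fun j => LinearMap.flip <|
      (pieceBracket 𝔤 i j).compr₂ (DirectSum.lof ℂ ℕ (GrPiece 𝔤) (i + j + 1))

/-- `𝔤` is naturally graded: it is isomorphic, as an algebra, to `gr(𝔤)`. -/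
def IsNaturallyGraded : Prop :=
  ∃ e : 𝔤 ≃ₗ[ℂ] Gr 𝔤, ∀ x y : 𝔤, e ⁅x, y⁆ = grBracket 𝔤 (e x) (e y)

/-- The nilindex `n(𝔤)`: for nilpotent `𝔤`, the least `k` with `C^k 𝔤 = 0`. -/
abbrev nilindex : ℕ := LieModule.nilpotencyLength 𝔤 𝔤

/-- The centralizer `C_𝔤(S)` of a subset `S` of `𝔤`. -/
def centralizer (S : Set 𝔤) : Set 𝔤 := {x | ∀ y ∈ S, ⁅x, y⁆ = 0}

/-- The centralizer property: `C_𝔤(C^p 𝔤)` contains `C^p 𝔤` for `p ≥ ⌊n(𝔤)/2⌋` and does not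
contain it for `p < ⌊n(𝔤)/2⌋`. -/
def CentralizerProperty : Prop :=
  (∀ p, nilindex 𝔤 / 2 ≤ p → (C 𝔤 p : Set 𝔤) ⊆ centralizer 𝔤 (C 𝔤 p : Set 𝔤)) ∧
    ∀ p, p < nilindex 𝔤 / 2 → ¬ (C 𝔤 p : Set 𝔤) ⊆ centralizer 𝔤 (C 𝔤 p : Set 𝔤)

/-- With `k = ⌊n(𝔤)/2⌋`: if homogeneous elements `X`, `Y` of `gr(𝔤)`, of degrees `a + 1 ≥ k`
and `b + 1 ≥ k`, satisfy `[X, Y] ≠ 0`, then one of them has degree greater than `k`. -/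
def ConditionTwo : Prop :=
  ∀ a b : ℕ, nilindex 𝔤 / 2 ≤ a + 1 → nilindex 𝔤 / 2 ≤ b + 1 →
    ∀ (X : GrPiece 𝔤 a) (Y : GrPiece 𝔤 b), pieceBracket 𝔤 a b X Y ≠ 0 →
      nilindex 𝔤 / 2 < a + 1 ∨ nilindex 𝔤 / 2 < b + 1

/-- A (P2)-algebra: a naturally graded nilpotent Lie algebra satisfying the centralizer property,
such that two homogeneous elements of degree `⌊n(𝔤)/2⌋` always commute. -/
def IsP2 : Prop :=
  LieRing.IsNilpotent 𝔤 ∧ IsNaturallyGraded 𝔤 ∧ CentralizerProperty 𝔤 ∧ ConditionTwo 𝔤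

/-- `𝔤` is nonsplit: it is not the direct sum of two nonzero ideals. -/
def IsNonsplit : Prop :=
  ¬ ∃ I J : LieIdeal ℂ 𝔤, I ≠ ⊥ ∧ J ≠ ⊥ ∧ IsCompl I J

end Notions

/-- The nilpotent endomorphism `f` has Jordan blocks of sizes `s = [s_0, s_1, …]`, in
nonincreasing order: there is a basis `b (i, j)`, `0 ≤ j < s_i`, such that `f` maps `b (i, j)`
to `b (i, j+1)` if `j + 1 < s_i` and to `0` otherwise. -/
def HasJordanType {V : Type*} [AddCommGroup V] [Module ℂ V] (f : V →ₗ[ℂ] V) (s : List ℕ) :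
    Prop :=
  s.Pairwise (· ≥ ·) ∧ (∀ a ∈ s, 1 ≤ a) ∧
    ∃ b : Module.Basis (Σ i : Fin s.length, Fin (s.get i)) ℂ V,
      ∀ (i : Fin s.length) (j : Fin (s.get i)),
        f (b ⟨i, j⟩) = if h : j.1 + 1 < s.get i then b ⟨i, ⟨j.1 + 1, h⟩⟩ else 0

/-- The characteristic sequence of `𝔤` is `s`: `s` is the maximum, in the lexicographic order, of
the sequences `c(X)` of sizes of Jordan blocks of `ad X`, `X ∈ 𝔤 - C^1 𝔤`. -/
def HasCharSeq (𝔤 : Type*) [LieRing 𝔤] [LieAlgebra ℂ 𝔤] (s : List ℕ) : Prop :=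
  (∃ X : 𝔤, X ∉ C 𝔤 1 ∧ HasJordanType (LieAlgebra.ad ℂ 𝔤 X) s) ∧
    ∀ (X : 𝔤) (s' : List ℕ), X ∉ C 𝔤 1 →
      HasJordanType (LieAlgebra.ad ℂ 𝔤 X) s' → s' ≤ s

/-- `𝔢` is a central extension of `𝔤` by `ℂ`: there is an exact sequence
`0 → ℂ → 𝔢 → 𝔤 → 0`, where `𝔢 → 𝔤` is a homomorphism of Lie algebras and the image of `ℂ` is
central in `𝔢`. -/
def IsCentralExtension (𝔢 𝔤 : Type*) [LieRing 𝔢] [LieAlgebra ℂ 𝔢] [LieRing 𝔤]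
    [LieAlgebra ℂ 𝔤] : Prop :=
  ∃ (i : ℂ →ₗ[ℂ] 𝔢) (p : 𝔢 →ₗ⁅ℂ⁆ 𝔤),
    Function.Injective i ∧ Function.Exact i p ∧ Function.Surjective p ∧
      ∀ z : ℂ, i z ∈ LieAlgebra.center ℂ 𝔢

end NatGraded

end

open NatGraded

/-! Everything is reduced to one normal form, `IsTable`: a basis `x`, `e 1, …, e (2m-1)`, `y` with
`[x, e_j] = e_{j+1}`, `[x, y] = 0`, `[e_i, e_j] = A i j e_{i+j}` plus an alternating multiple of `y`
when `i + j = 2t+1`, and `[e_j, y] = f e_{j+2t+1}`. The classification then becomes the solution of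
the Jacobi equations for `A` and `f`.

Reaching the table (`exists_isTable`). Being naturally graded means having a grading generated in
degree one (`NatGrading`). The characteristic sequence gives dimension `2m+1` and an `X` with
`ad(X)^{2m-2} ≠ 0`. Generation in degree one bounds the nilindex by `2m`, and the (P2) conditions
make it odd (`odd_nilindex`), so it is `2m-1`. The degree one parts of `X` and of a suitable vector
generate a chain `e_j`, and one further homogeneous vector `y` completes the basis. It can be
corrected so that `[x, y] = 0`. If `y` had degree one, the algebra would split. Otherwise `y` must
appear in a bracket `[e_1, e_k]`; since `ad x` is a derivation killing `y`, its coefficients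
alternate along a degree, and antisymmetry makes the degree of `y` odd. A change of `e_1` gives `A 1
2 = 0`.

Solving the equations (`TableRel`). The derivation `ad x` gives `A (i+1) j + A i (j+1) = A i j`, so
each total degree contains a single new parameter `A 1 S`, and in even degree antisymmetry on the
diagonal gives a further linear condition. Hence the lowest nonzero degree is odd, say `2p+1`, and
the Jacobi identity on `e_1, e_2, e_{2p-1}` shows that the square of its parameter is a multiple of
`f`, unless `2p+1` is the top degree `2m-1`. If `f = 0`, only the top degree survives: it is
absorbed into `y` when `t = m-1` (model `g4`), and otherwise the centralizer property makes it
nonzero, so that it can be scaled to one (models `g2`). If `f ≠ 0` and `t ≤ m-2`, the identities in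
the next degrees force `t = m-2` and leave one parameter `γ`, which vanishes unless `m = 4`. For `γ
= 0` this is `g3`; for `m = 4` the centralizer property excludes `γ = 3`, and all other nonzero
values are carried to `γ = 1` (model `g1`) by `base_change`.

Conversely every model has a table (`Model.isTable`), from which (P2), nonsplitness and the
characteristic sequence are read off. Models are separated by the dimension, by the degree of `y`,
by the vanishing of `f` (centrality of `y`), and, for `g1` against `g3` with `m = 4`, by
`HasSquareZeroElement`. -/

noncomputable section

namespace NatGraded

/-! ### Natural gradings as gradings generated in degree one. -/

section Grading

variable {𝔤 : Type*} [LieRing 𝔤] [LieAlgebra ℂ 𝔤]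

/-- A grading of a Lie algebra by subspaces `V i`, where `V i` has degree `i + 1`, with projections
`π i`, such that `V 0` generates. -/
structure NatGrading (V : ℕ → Submodule ℂ 𝔤) (π : ℕ → 𝔤 →ₗ[ℂ] 𝔤) : Prop where
  proj_mem : ∀ i x, π i x ∈ V i
  proj_same : ∀ i, ∀ x ∈ V i, π i x = x
  proj_ne : ∀ i j, j ≠ i → ∀ x ∈ V i, π j x = 0
  iSup_eq_top : ⨆ i, V i = ⊤
  lie_mem : ∀ i j, ∀ x ∈ V i, ∀ y ∈ V j, ⁅x, y⁆ ∈ V (i + j + 1)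
  gen : ∀ i, V (i + 1) ≤ Submodule.span ℂ {z | ∃ x ∈ V 0, ∃ y ∈ V i, ⁅x, y⁆ = z}

theorem mem_iSup_induction {M : Type*} [AddCommGroup M] [Module ℂ M] {V : ℕ → Submodule ℂ M}
    {motive : ∀ x, x ∈ ⨆ i, V i → Prop}
    (mem : ∀ i x (h : x ∈ V i), motive x (Submodule.mem_iSup_of_mem i h))
    (zero : motive 0 (zero_mem _))
    (add : ∀ x y hx hy, motive x hx → motive y hy → motive (x + y) (add_mem hx hy))
    {x : M} (hx : x ∈ ⨆ i, V i) : motive x hx :=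
  Submodule.iSup_induction' V mem zero add hx

theorem lie_mem_C_succ {k : ℕ} (x : 𝔤) {y : 𝔤} (hy : y ∈ C 𝔤 k) : ⁅x, y⁆ ∈ C 𝔤 (k + 1) := by
  have := lie_mem_C 𝔤 (i := 0) (j := k) (x := x) (y := y) (by simp) hy
  rwa [Nat.zero_add] at this

theorem C_antitone {i j : ℕ} (h : i ≤ j) : C 𝔤 j ≤ C 𝔤 i :=
  LieModule.antitone_lowerCentralSeries ℂ 𝔤 𝔤 h

theorem C_succ_eq_span (k : ℕ) :
    (C 𝔤 (k + 1)).toSubmodule = Submodule.span ℂ {z | ∃ x : 𝔤, ∃ y ∈ C 𝔤 k, ⁅x, y⁆ = z} := by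
  rw [C, LieModule.lowerCentralSeries_succ, LieSubmodule.lieIdeal_oper_eq_linear_span']
  simp

theorem mem_C_zero (x : 𝔤) : x ∈ C 𝔤 0 := by simp

namespace NatGrading

variable {V : ℕ → Submodule ℂ 𝔤} {π : ℕ → 𝔤 →ₗ[ℂ] 𝔤} (G : NatGrading V π)
include G

theorem le_C (i : ℕ) : V i ≤ (C 𝔤 i).toSubmodule := by
  induction i with
  | zero => intro x _; exact mem_C_zero x
  | succ i ih =>
    refine (G.gen i).trans (Submodule.span_le.2 ?_)
    rintro _ ⟨x, -, y, hy, rfl⟩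
    exact lie_mem_C_succ x (ih hy)

theorem lie_iSup_mem {k : ℕ} (x : 𝔤) {y : 𝔤} (hy : y ∈ ⨆ i, V (k + i)) :
    ⁅x, y⁆ ∈ ⨆ i, V (k + 1 + i) := by
  have hx : x ∈ ⨆ i, V i := by rw [G.iSup_eq_top]; trivial
  induction hx using mem_iSup_induction with
  | mem i x hx =>
    induction hy using mem_iSup_induction with
    | mem j y hy =>
      have := G.lie_mem i (k + j) x hx y hy
      rw [show i + (k + j) + 1 = k + 1 + (i + j) by omega] at this
      exact Submodule.mem_iSup_of_mem _ this
    | zero => simp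
    | add y z _ _ hy hz => rw [lie_add]; exact add_mem hy hz
  | zero => simp
  | add x z _ _ hx hz => rw [add_lie]; exact add_mem hx hz

/-- Additivity of degrees under the bracket gives one inclusion; generation by `V 0` gives the
other, through `le_C`. -/
theorem C_eq_iSup (k : ℕ) : (C 𝔤 k).toSubmodule = ⨆ i, V (k + i) := by
  apply le_antisymm
  · induction k with
    | zero => simp [G.iSup_eq_top]
    | succ k ih =>
      rw [C_succ_eq_span, Submodule.span_le]
      rintro _ ⟨x, y, hy, rfl⟩
      exact G.lie_iSup_mem x (ih hy)
  · exact iSup_le fun i => (G.le_C _).trans (C_antitone (Nat.le_add_right k i))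

theorem proj_eq_zero {i k : ℕ} (h : i < k) {x : 𝔤} (hx : x ∈ C 𝔤 k) : π i x = 0 := by
  rw [← LieSubmodule.mem_toSubmodule, G.C_eq_iSup] at hx
  induction hx using mem_iSup_induction with
  | mem j x hx => exact G.proj_ne (k + j) i (by omega) x hx
  | zero => simp
  | add x z _ _ hx hz => rw [map_add, hx, hz, add_zero]

theorem sub_proj_mem {k : ℕ} {x : 𝔤} (hx : x ∈ C 𝔤 k) : x - π k x ∈ C 𝔤 (k + 1) := by
  rw [← LieSubmodule.mem_toSubmodule, G.C_eq_iSup] at hx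
  induction hx using mem_iSup_induction with
  | mem j x hx =>
    rcases Nat.eq_zero_or_pos j with rfl | hj
    · rw [G.proj_same k x hx, sub_self]; exact zero_mem _
    · rw [G.proj_ne (k + j) k (by omega) x hx, sub_zero]
      exact C_antitone (by omega) (G.le_C _ hx)
  | zero => simp
  | add x z _ _ hx hz =>
    rw [map_add, add_sub_add_comm]; exact add_mem hx hz

/-- This is how leading terms are compared throughout: an identity modulo `C^k` between homogeneous
vectors of lower degree is an exact identity. -/
theorem eq_zero_of_mem {i k : ℕ} (h : i < k) {x : 𝔤} (hx : x ∈ V i) (hx' : x ∈ C 𝔤 k) : x = 0 := by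
  rw [← G.proj_same i x hx, G.proj_eq_zero h hx']

theorem lie_ne_mem {k : ℕ} (hk : C 𝔤 k = ⊥) {i : ℕ} (hi : k ≤ i) : V i = ⊥ := by
  refine le_bot_iff.1 ((G.le_C i).trans ?_)
  have h : C 𝔤 i ≤ ⊥ := hk ▸ C_antitone hi
  exact h

/-- Projecting a linear combination of homogeneous vectors to one degree keeps exactly the terms of
that degree. No independence of the family is needed. -/
theorem le_span {ι : Type*} {b : ι → 𝔤} {deg : ι → ℕ} (hb : ∀ i, b i ∈ V (deg i))
    (htop : Submodule.span ℂ (Set.range b) = ⊤) (k : ℕ) :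
    V k ≤ Submodule.span ℂ {z | ∃ i, deg i = k ∧ b i = z} := by
  intro x hx
  rw [← G.proj_same k x hx]
  have : x ∈ Submodule.span ℂ (Set.range b) := by rw [htop]; trivial
  clear hx
  induction this using Submodule.span_induction with
  | mem x h =>
    obtain ⟨i, rfl⟩ := h
    by_cases h : deg i = k
    · rw [G.proj_same k _ (h ▸ hb i)]
      exact Submodule.subset_span ⟨i, h, rfl⟩
    · rw [G.proj_ne _ k (Ne.symm h) _ (hb i)]; exact zero_mem _
  | zero => simp
  | add x y _ _ hx hy => rw [map_add]; exact add_mem hx hy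
  | smul c x _ hx => rw [map_smul]; exact Submodule.smul_mem _ c hx

end NatGrading

/-- The map `C^i 𝔤 → gr(𝔤)`. -/
def toGr (i : ℕ) : (C 𝔤 i).toSubmodule →ₗ[ℂ] Gr 𝔤 :=
  DirectSum.lof ℂ ℕ (GrPiece 𝔤) i ∘ₗ Submodule.mkQ _

theorem toGr_eq_zero {i : ℕ} {x : 𝔤} (hx : x ∈ C 𝔤 i) (h : x ∈ C 𝔤 (i + 1)) :
    toGr i ⟨x, hx⟩ = 0 := by
  have h0 : Submodule.mkQ ((C 𝔤 (i + 1)).toSubmodule.submoduleOf (C 𝔤 i).toSubmodule) ⟨x, hx⟩ = 0 :=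
    (Submodule.Quotient.mk_eq_zero _).2 h
  rw [toGr, LinearMap.comp_apply, h0, map_zero]

theorem grBracket_lof (i j : ℕ) (a : GrPiece 𝔤 i) (b : GrPiece 𝔤 j) :
    grBracket 𝔤 (DirectSum.lof ℂ ℕ (GrPiece 𝔤) i a) (DirectSum.lof ℂ ℕ (GrPiece 𝔤) j b) =
      DirectSum.lof ℂ ℕ (GrPiece 𝔤) (i + j + 1) (pieceBracket 𝔤 i j a b) := by
  simp only [grBracket, DirectSum.toModule_lof, LinearMap.flip_apply, LinearMap.compr₂_apply]

theorem grBracket_toGr {i j : ℕ} {x y : 𝔤} (hx : x ∈ C 𝔤 i) (hy : y ∈ C 𝔤 j) :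
    grBracket 𝔤 (toGr i ⟨x, hx⟩) (toGr j ⟨y, hy⟩) = toGr (i + j + 1) ⟨⁅x, y⁆, lie_mem_C 𝔤 hx hy⟩ :=
  grBracket_lof ..

/-- The blocks of `gr(𝔤)` are transported to `𝔤` by the given isomorphism. Generation in degree one
reflects that `C^{i+1}` is spanned by the brackets `[x, y]` with `y` in `C^i`, whose classes are
brackets of classes of degree one and of degree `i+1`. -/
theorem IsNaturallyGraded.exists_natGrading (h : IsNaturallyGraded 𝔤) :
    ∃ (V : ℕ → Submodule ℂ 𝔤) (π : ℕ → 𝔤 →ₗ[ℂ] 𝔤), NatGrading V π := by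
  obtain ⟨e, he⟩ := h
  let ℓ : ∀ i, GrPiece 𝔤 i →ₗ[ℂ] 𝔤 := fun i => e.symm.toLinearMap ∘ₗ DirectSum.lof ℂ ℕ (GrPiece 𝔤) i
  have hℓ : ∀ i a, e (ℓ i a) = DirectSum.lof ℂ ℕ (GrPiece 𝔤) i a := fun i a => by simp [ℓ]
  have hlie : ∀ i j a b, ⁅ℓ i a, ℓ j b⁆ = ℓ (i + j + 1) (pieceBracket 𝔤 i j a b) := by
    intro i j a b
    apply e.injective
    rw [he, hℓ, hℓ, hℓ, grBracket_lof]
  refine ⟨fun i => LinearMap.range (ℓ i),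
    fun i => ℓ i ∘ₗ DirectSum.component ℂ ℕ (GrPiece 𝔤) i ∘ₗ e.toLinearMap, ?_, ?_, ?_, ?_, ?_, ?_⟩
  · exact fun i x => ⟨_, rfl⟩
  · rintro i _ ⟨a, rfl⟩
    simp only [LinearMap.comp_apply, LinearEquiv.coe_coe, hℓ, DirectSum.component.lof_self]
  · rintro i j hij _ ⟨a, rfl⟩
    simp only [LinearMap.comp_apply, LinearEquiv.coe_coe, hℓ, DirectSum.component.of,
      dif_neg hij.symm, map_zero]
  · rw [eq_top_iff]
    intro x _
    rw [← e.symm_apply_apply x]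
    induction e x using DirectSum.induction_on with
    | zero => simp
    | of i a => exact Submodule.mem_iSup_of_mem i ⟨a, rfl⟩
    | add a b ha hb => rw [map_add]; exact add_mem ha hb
  · rintro i j _ ⟨a, rfl⟩ _ ⟨b, rfl⟩
    exact ⟨_, (hlie ..).symm⟩
  · rintro i _ ⟨c, rfl⟩
    obtain ⟨⟨w, hw⟩, rfl⟩ := Submodule.Quotient.mk_surjective _ c
    have hw' := hw
    rw [C_succ_eq_span] at hw'
    induction hw' using Submodule.span_induction with
    | mem w h =>
      obtain ⟨x, y, hy, rfl⟩ := h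
      have h1 := hlie i 0 (Submodule.Quotient.mk ⟨y, hy⟩) (Submodule.Quotient.mk ⟨x, mem_C_zero x⟩)
      have h2 : ℓ (i + 1) (Submodule.Quotient.mk ⟨⁅x, y⁆, hw⟩) =
          - ⁅ℓ i (Submodule.Quotient.mk ⟨y, hy⟩), ℓ 0 (Submodule.Quotient.mk ⟨x, mem_C_zero x⟩)⁆ := by
        rw [h1, ← map_neg]
        congr 1
        change _ = -(Submodule.Quotient.mk ⟨⁅y, x⁆, lie_mem_C 𝔤 hy (mem_C_zero x)⟩ : GrPiece 𝔤 (i + 1))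
        rw [← Submodule.Quotient.mk_neg]
        congr 1
        ext
        simp
      rw [h2, lie_skew]
      exact Submodule.subset_span ⟨_, ⟨_, rfl⟩, _, ⟨_, rfl⟩, rfl⟩
    | zero =>
      have h0 : ℓ (i + 1) (Submodule.Quotient.mk ⟨0, hw⟩) = 0 :=
        map_zero (ℓ (i + 1) ∘ₗ Submodule.mkQ _)
      rw [h0]
      exact zero_mem _
    | add u v hu hv hu' hv' =>
      rw [← C_succ_eq_span] at hu hv
      convert add_mem (hu' hu) (hv' hv)
      exact map_add (ℓ (i + 1) ∘ₗ Submodule.mkQ _) ⟨u, hu⟩ ⟨v, hv⟩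
    | smul c u hu hu' =>
      rw [← C_succ_eq_span] at hu
      convert Submodule.smul_mem _ c (hu' hu)
      exact map_smul (ℓ (i + 1) ∘ₗ Submodule.mkQ _) c ⟨u, hu⟩

/-- The map sends a vector to the classes of its homogeneous components; nilpotency makes this a
finite sum. -/
theorem NatGrading.isNaturallyGraded {V : ℕ → Submodule ℂ 𝔤} {π : ℕ → 𝔤 →ₗ[ℂ] 𝔤}
    (G : NatGrading V π) {n : ℕ} (hn : C 𝔤 n = ⊥) : IsNaturallyGraded 𝔤 := by
  let p : ∀ i, 𝔤 →ₗ[ℂ] (C 𝔤 i).toSubmodule := fun i =>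
    LinearMap.codRestrict _ (π i) fun x => G.le_C i (G.proj_mem i x)
  let φ : 𝔤 →ₗ[ℂ] Gr 𝔤 := ∑ i ∈ Finset.range n, toGr i ∘ₗ p i
  have hφ : ∀ i x (hx : x ∈ V i), φ x = toGr i ⟨x, G.le_C i hx⟩ := by
    intro i x hx
    rw [LinearMap.sum_apply, Finset.sum_eq_single i]
    · simp only [LinearMap.comp_apply]
      congr 1
      ext
      exact G.proj_same i x hx
    · intro j _ hj
      have : p j x = 0 := by ext; exact G.proj_ne i j hj x hx
      rw [LinearMap.comp_apply, this, map_zero]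
    · intro hi
      have h0 : x = 0 := by
        have := G.lie_ne_mem hn (i := i) (by simpa using hi)
        rw [this] at hx
        simpa using hx
      subst h0
      simp
  have hinj : Function.Injective φ := by
    rw [injective_iff_map_eq_zero]
    intro x hx
    -- Each component of an element of the kernel lies one step deeper in the central sequence than
    -- its degree allows, hence vanishes; this pushes `x` down to `C^n = 0`.
    have hp : ∀ i < n, π i x ∈ C 𝔤 (i + 1) := by
      intro i hi
      have h1 : DirectSum.component ℂ ℕ (GrPiece 𝔤) i (φ x) = Submodule.Quotient.mk (p i x) := by
        rw [LinearMap.sum_apply, map_sum, Finset.sum_eq_single i]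
        · simp only [toGr, LinearMap.comp_apply, DirectSum.component.lof_self, Submodule.mkQ_apply]
        · intro j _ hj
          simp only [toGr, LinearMap.comp_apply, DirectSum.component.of, dif_neg hj]
        · intro h; exact absurd (Finset.mem_range.2 hi) h
      rw [hx, map_zero, eq_comm, Submodule.Quotient.mk_eq_zero] at h1
      exact h1
    have hC : ∀ k ≤ n, x ∈ C 𝔤 k := by
      intro k
      induction k with
      | zero => intro _; exact mem_C_zero x
      | succ k ih =>
        intro hk
        have := G.sub_proj_mem (ih (by omega))
        rwa [G.eq_zero_of_mem (Nat.lt_succ_self k) (G.proj_mem k x) (hp k hk), sub_zero] at this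
    simpa [hn] using hC n le_rfl
  have hsurj : Function.Surjective φ := by
    intro y
    induction y using DirectSum.induction_on with
    | zero => exact ⟨0, map_zero _⟩
    | of i a =>
      obtain ⟨⟨w, hw⟩, rfl⟩ := Submodule.Quotient.mk_surjective _ a
      refine ⟨π i w, ?_⟩
      rw [hφ i _ (G.proj_mem i w)]
      have h1 := toGr_eq_zero (C_antitone (Nat.le_succ i) (G.sub_proj_mem hw)) (G.sub_proj_mem hw)
      have h2 : (⟨w, hw⟩ : (C 𝔤 i).toSubmodule) = ⟨w - π i w, C_antitone (Nat.le_succ i)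
          (G.sub_proj_mem hw)⟩ + ⟨π i w, G.le_C i (G.proj_mem i w)⟩ := by ext; simp
      have h3 : toGr i ⟨w, hw⟩ = toGr i ⟨π i w, G.le_C i (G.proj_mem i w)⟩ := by
        rw [h2, map_add, h1, zero_add]
      exact h3.symm
    | add a b ha hb =>
      obtain ⟨u, rfl⟩ := ha
      obtain ⟨v, rfl⟩ := hb
      exact ⟨u + v, map_add ..⟩
  refine ⟨LinearEquiv.ofBijective φ ⟨hinj, hsurj⟩, fun x y => ?_⟩
  change φ ⁅x, y⁆ = grBracket 𝔤 (φ x) (φ y)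
  have hx : x ∈ ⨆ i, V i := by rw [G.iSup_eq_top]; trivial
  have hy : y ∈ ⨆ i, V i := by rw [G.iSup_eq_top]; trivial
  induction hx using mem_iSup_induction with
  | mem i x hx =>
    induction hy using mem_iSup_induction with
    | mem j y hy =>
      rw [hφ _ _ (G.lie_mem i j x hx y hy), hφ i x hx, hφ j y hy, grBracket_toGr]
    | zero => simp
    | add y z _ _ hy hz => rw [lie_add, map_add, map_add, hy, hz, map_add]
  | zero => simp
  | add x z _ _ hx hz => rw [add_lie, map_add, map_add, hx, hz, map_add, LinearMap.add_apply]

theorem natGrading_of_basis {ι : Type*} (b : Module.Basis ι ℂ 𝔤) (deg : ι → ℕ)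
    (hlie : ∀ i j, ⁅b i, b j⁆ ∈ Submodule.span ℂ (b '' {k | deg k = deg i + deg j + 1}))
    (hgen : ∀ k i, deg i = k + 1 → b i ∈ Submodule.span ℂ
      {z | ∃ x ∈ Submodule.span ℂ (b '' {j | deg j = 0}),
        ∃ y ∈ Submodule.span ℂ (b '' {j | deg j = k}), ⁅x, y⁆ = z}) :
    NatGrading (fun k => Submodule.span ℂ (b '' {j | deg j = k}))
      (fun k => b.constr ℂ fun i => if deg i = k then b i else 0) where
  proj_mem k x := by
    rw [b.constr_apply]
    refine Submodule.sum_mem _ fun i _ => Submodule.smul_mem _ _ ?_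
    split_ifs with h
    · exact Submodule.subset_span ⟨i, h, rfl⟩
    · exact zero_mem _
  proj_same k x hx := by
    induction hx using Submodule.span_induction with
    | mem x h => obtain ⟨i, hi, rfl⟩ := h; rw [b.constr_basis]; exact if_pos hi
    | zero => simp
    | add x y _ _ hx hy => rw [map_add, hx, hy]
    | smul c x _ hx => rw [map_smul, hx]
  proj_ne k j hj x hx := by
    induction hx using Submodule.span_induction with
    | mem x h =>
      obtain ⟨i, hi, rfl⟩ := h
      rw [b.constr_basis, if_neg]
      rintro rfl
      exact hj hi
    | zero => simp
    | add x y _ _ hx hy => rw [map_add, hx, hy, add_zero]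
    | smul c x _ hx => rw [map_smul, hx, smul_zero]
  iSup_eq_top := by
    rw [eq_top_iff, ← b.span_eq, Submodule.span_le]
    rintro _ ⟨i, rfl⟩
    exact Submodule.mem_iSup_of_mem (deg i) (Submodule.subset_span ⟨i, rfl, rfl⟩)
  lie_mem p q x hx y hy := by
    induction hx using Submodule.span_induction with
    | mem x h =>
      obtain ⟨i, rfl, rfl⟩ := h
      induction hy using Submodule.span_induction with
      | mem y h => obtain ⟨j, rfl, rfl⟩ := h; exact hlie i j
      | zero => simp
      | add y z _ _ hy hz => rw [lie_add]; exact add_mem hy hz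
      | smul c y _ hy => rw [lie_smul]; exact Submodule.smul_mem _ c hy
    | zero => simp
    | add y z _ _ hy hz => rw [add_lie]; exact add_mem hy hz
    | smul c y _ hy => rw [smul_lie]; exact Submodule.smul_mem _ c hy
  gen k := by
    rw [Submodule.span_le]
    rintro _ ⟨i, hi, rfl⟩
    exact hgen k i hi

end Grading

/-! ### The normal form: its grading and the (P2) conditions. -/

section Table

/-- The vectors `x`, `e 1, …, e (2m-1)`, `y` form a basis of the Lie algebra `𝔤`, in which the
bracket is given by the coefficients `A i j` and `f`; here `e j` has degree `j` and `y` has degree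
`2t+1`. -/
structure IsTable {𝔤 : Type*} [LieRing 𝔤] [LieAlgebra ℂ 𝔤] (m t : ℕ) (A : ℕ → ℕ → ℂ) (f : ℂ)
    (x : 𝔤) (e : ℕ → 𝔤) (y : 𝔤) : Prop where
  four_le : 4 ≤ m
  one_le : 1 ≤ t
  lt : t < m
  zero : ∀ j, 2 * m ≤ j → e j = 0
  xe : ∀ j, 1 ≤ j → ⁅x, e j⁆ = e (j + 1)
  xy : ⁅x, y⁆ = 0
  ee : ∀ i j, 1 ≤ i → 1 ≤ j →
    ⁅e i, e j⁆ = A i j • e (i + j) + if i + j = 2 * t + 1 then (-1 : ℂ) ^ (i + 1) • y else 0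
  ey : ∀ j, 1 ≤ j → ⁅e j, y⁆ = f • e (j + (2 * t + 1))
  span : Submodule.span ℂ ({x, y} ∪ e '' {j | 1 ≤ j}) = ⊤
  dim : Module.finrank ℂ 𝔤 = 2 * m + 1

/-- The vectors of a table as a family. -/
def tableVec {𝔤 : Type*} (m : ℕ) (x : 𝔤) (e : ℕ → 𝔤) (y : 𝔤) (i : Fin (2 * m + 1)) : 𝔤 :=
  if i.1 = 0 then x else if i.1 = 2 * m then y else e i.1

/-- The degrees, diminished by one, of the vectors of a table. -/
def tableDeg (m t : ℕ) (i : Fin (2 * m + 1)) : ℕ :=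
  if i.1 = 0 then 0 else if i.1 = 2 * m then 2 * t else i.1 - 1

theorem tableVec_cases {m : ℕ} (i : Fin (2 * m + 1)) :
    i.1 = 0 ∨ (i.1 ≠ 0 ∧ i.1 = 2 * m) ∨ (1 ≤ i.1 ∧ i.1 < 2 * m) := by
  omega

variable {𝔤 : Type*} [LieRing 𝔤] [LieAlgebra ℂ 𝔤] {m t : ℕ} {A : ℕ → ℕ → ℂ} {f : ℂ}
  {x : 𝔤} {e : ℕ → 𝔤} {y : 𝔤}

theorem lie_eq_zero_of_mem_span {S : Set 𝔤} (hS : ∀ a ∈ S, ∀ b ∈ S, ⁅a, b⁆ = 0) {u v : 𝔤}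
    (hu : u ∈ Submodule.span ℂ S) (hv : v ∈ Submodule.span ℂ S) : ⁅u, v⁆ = 0 := by
  induction hu using Submodule.span_induction with
  | mem u hu =>
    induction hv using Submodule.span_induction with
    | mem v hv => exact hS u hu v hv
    | zero => simp
    | add a b _ _ ha hb => rw [lie_add, ha, hb, add_zero]
    | smul c a _ ha => rw [lie_smul, ha, smul_zero]
  | zero => simp
  | add a b _ _ ha hb => rw [add_lie, ha, hb, add_zero]
  | smul c a _ ha => rw [smul_lie, ha, smul_zero]

namespace IsTable

variable (h : IsTable m t A f x e y)
include h

theorem ye (j : ℕ) (hj : 1 ≤ j) : ⁅y, e j⁆ = -(f • e (j + (2 * t + 1))) := by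
  rw [← lie_skew, h.ey j hj]

theorem ex (j : ℕ) (hj : 1 ≤ j) : ⁅e j, x⁆ = -e (j + 1) := by
  rw [← lie_skew, h.xe j hj]

theorem yx : ⁅y, x⁆ = 0 := by rw [← lie_skew, h.xy, neg_zero]

theorem span_tableVec : Submodule.span ℂ (Set.range (tableVec m x e y)) = ⊤ := by
  have hm := h.four_le
  rw [eq_top_iff, ← h.span, Submodule.span_le]
  rintro z ((rfl | rfl) | ⟨j, hj, rfl⟩)
  · exact Submodule.subset_span ⟨⟨0, by omega⟩, by simp [tableVec]⟩
  · exact Submodule.subset_span ⟨⟨2 * m, by omega⟩, by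
      simp only [tableVec]; rw [if_neg (by omega)]; simp⟩
  · rcases Nat.lt_or_ge j (2 * m) with h1 | h1
    · refine Submodule.subset_span ⟨⟨j, by omega⟩, ?_⟩
      have hj : 1 ≤ j := hj
      simp only [tableVec]
      rw [if_neg (by omega), if_neg (by omega)]
    · rw [h.zero j h1]; exact zero_mem _

/-- The basis given by a table. -/
def basis : Module.Basis (Fin (2 * m + 1)) ℂ 𝔤 :=
  basisOfTopLeSpanOfCardEqFinrank (tableVec m x e y) h.span_tableVec.ge (by simp [h.dim])

theorem basis_apply (i : Fin (2 * m + 1)) : h.basis i = tableVec m x e y i := by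
  simp [basis]

theorem basis_zero : h.basis 0 = x := by
  rw [basis_apply]; simp [tableVec]

theorem basis_last : h.basis (Fin.last (2 * m)) = y := by
  have := h.four_le
  rw [basis_apply]; simp [tableVec]; omega

theorem basis_mid {i : Fin (2 * m + 1)} (h1 : 1 ≤ i.1) (h2 : i.1 < 2 * m) : h.basis i = e i.1 := by
  rw [basis_apply, tableVec, if_neg (by omega), if_neg (by omega)]

omit h in
omit [LieRing 𝔤] [LieAlgebra ℂ 𝔤] in
theorem tableDeg_zero : tableDeg m t 0 = 0 := by simp [tableDeg]

theorem tableDeg_last : tableDeg m t (Fin.last (2 * m)) = 2 * t := by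
  have := h.four_le
  simp [tableDeg]; omega

omit h in
theorem tableDeg_mid {i : Fin (2 * m + 1)} (h1 : 1 ≤ i.1) (h2 : i.1 < 2 * m) :
    tableDeg m t i = i.1 - 1 := by
  rw [tableDeg, if_neg (by omega), if_neg (by omega)]

/-- The component of degree `k + 1`. -/
def piece (k : ℕ) : Submodule ℂ 𝔤 := Submodule.span ℂ (h.basis '' {j | tableDeg m t j = k})

/-- The projection onto the component of degree `k + 1`. -/
def proj (k : ℕ) : 𝔤 →ₗ[ℂ] 𝔤 :=
  h.basis.constr ℂ fun i => if tableDeg m t i = k then h.basis i else 0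

theorem x_mem_piece : x ∈ h.piece 0 :=
  Submodule.subset_span ⟨0, tableDeg_zero, h.basis_zero⟩

theorem y_mem_piece : y ∈ h.piece (2 * t) :=
  Submodule.subset_span ⟨Fin.last _, h.tableDeg_last, h.basis_last⟩

theorem e_mem_piece (j : ℕ) (hj : 1 ≤ j) : e j ∈ h.piece (j - 1) := by
  rcases Nat.lt_or_ge j (2 * m) with h1 | h1
  · exact Submodule.subset_span ⟨⟨j, by omega⟩, tableDeg_mid hj h1, h.basis_mid hj h1⟩
  · rw [h.zero j h1]; exact zero_mem _

/-- The degree is an argument of `P` so that the case analysis on a basis index replaces the vector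
and its degree at the same time. -/
theorem basis_cases {P : 𝔤 → ℕ → Prop} (hx : P x 0) (hy : P y (2 * t))
    (he : ∀ j, 1 ≤ j → j < 2 * m → P (e j) (j - 1)) (i : Fin (2 * m + 1)) :
    P (h.basis i) (tableDeg m t i) := by
  rcases tableVec_cases i with h1 | ⟨h0, h1⟩ | ⟨h1, h2⟩
  · obtain rfl : i = 0 := Fin.ext h1
    rw [h.basis_zero, tableDeg_zero]; exact hx
  · obtain rfl : i = Fin.last _ := Fin.ext h1
    rw [h.basis_last, h.tableDeg_last]; exact hy
  · rw [h.basis_mid h1 h2, tableDeg_mid h1 h2]; exact he _ h1 h2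

theorem grading : NatGrading h.piece h.proj := by
  have hm := h.four_le
  have h1 := h.one_le
  apply natGrading_of_basis
  · intro i j
    change _ ∈ h.piece _
    refine h.basis_cases (P := fun u k => ⁅u, h.basis j⁆ ∈ h.piece (k + tableDeg m t j + 1))
      ?_ ?_ ?_ i
    · refine h.basis_cases (P := fun v k => ⁅x, v⁆ ∈ h.piece (0 + k + 1)) ?_ ?_ ?_ j
      · rw [lie_self]; exact zero_mem _
      · rw [h.xy]; exact zero_mem _
      · intro j hj _
        rw [h.xe j hj]
        convert h.e_mem_piece (j + 1) (by omega) using 2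
        omega
    · refine h.basis_cases (P := fun v k => ⁅y, v⁆ ∈ h.piece (2 * t + k + 1)) ?_ ?_ ?_ j
      · rw [h.yx]; exact zero_mem _
      · rw [lie_self]; exact zero_mem _
      · intro j hj _
        rw [h.ye j hj]
        refine neg_mem (Submodule.smul_mem _ _ ?_)
        convert h.e_mem_piece (j + (2 * t + 1)) (by omega) using 2
        omega
    · intro i hi _
      refine h.basis_cases (P := fun v k => ⁅e i, v⁆ ∈ h.piece (i - 1 + k + 1)) ?_ ?_ ?_ j
      · rw [h.ex i hi]
        refine neg_mem ?_
        convert h.e_mem_piece (i + 1) (by omega) using 2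
        omega
      · rw [h.ey i hi]
        refine Submodule.smul_mem _ _ ?_
        convert h.e_mem_piece (i + (2 * t + 1)) (by omega) using 2
        omega
      · intro j hj _
        rw [h.ee i j hi hj]
        refine add_mem (Submodule.smul_mem _ _ ?_) ?_
        · convert h.e_mem_piece (i + j) (by omega) using 2
          omega
        · split_ifs with hij
          · refine Submodule.smul_mem _ _ ?_
            convert h.y_mem_piece using 2
            omega
          · exact zero_mem _
  · intro k i
    change _ → h.basis i ∈ Submodule.span ℂ {z | ∃ x ∈ h.piece 0, ∃ y ∈ h.piece k, ⁅x, y⁆ = z}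
    refine h.basis_cases (P := fun u d => d = k + 1 → u ∈ Submodule.span ℂ
      {z | ∃ x ∈ h.piece 0, ∃ y ∈ h.piece k, ⁅x, y⁆ = z}) ?_ ?_ ?_ i
    · intro h; omega
    · intro hk
      -- The vector `y` is generated because `[e_1, e_{2t}] = A 1 (2t) e_{2t+1} + y`, where
      -- `e_{2t+1} = [x, e_{2t}]` is itself generated.
      have hey : e (2 * t + 1) ∈ Submodule.span ℂ
          {z | ∃ x ∈ h.piece 0, ∃ y ∈ h.piece k, ⁅x, y⁆ = z} := by
        refine Submodule.subset_span ⟨x, h.x_mem_piece, e (2 * t), ?_, h.xe _ (by omega)⟩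
        convert h.e_mem_piece (2 * t) (by omega) using 2
        omega
      have hb : ⁅e 1, e (2 * t)⁆ ∈ Submodule.span ℂ
          {z | ∃ x ∈ h.piece 0, ∃ y ∈ h.piece k, ⁅x, y⁆ = z} := by
        refine Submodule.subset_span ⟨e 1, h.e_mem_piece 1 le_rfl, e (2 * t), ?_, rfl⟩
        convert h.e_mem_piece (2 * t) (by omega) using 2
        omega
      rw [h.ee 1 (2 * t) le_rfl (by omega), if_pos (by omega), Nat.add_comm 1 (2 * t)] at hb
      simpa using sub_mem hb (Submodule.smul_mem _ (A 1 (2 * t)) hey)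
    · intro j hj _ hk
      obtain ⟨i, rfl⟩ : ∃ i, j = i + 1 := ⟨j - 1, by omega⟩
      refine Submodule.subset_span ⟨x, h.x_mem_piece, e i, ?_, h.xe i (by omega)⟩
      convert h.e_mem_piece i (by omega) using 2
      omega

theorem e_ne_zero (j : ℕ) (h1 : 1 ≤ j) (h2 : j < 2 * m) : e j ≠ 0 := by
  rw [← h.basis_mid (i := ⟨j, by omega⟩) h1 h2]
  exact h.basis.ne_zero _

theorem smul_e_eq_zero {j : ℕ} (h1 : 1 ≤ j) (h2 : j < 2 * m) {c : ℂ} (hc : c • e j = 0) :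
    c = 0 := (smul_eq_zero.1 hc).resolve_right (h.e_ne_zero j h1 h2)

theorem e_y_eq_zero {j : ℕ} (h1 : 1 ≤ j) (h2 : j < 2 * m) {a b : ℂ} (hab : a • e j + b • y = 0) :
    a = 0 ∧ b = 0 := by
  have he := congrArg h.basis.repr (h.basis_mid (i := ⟨j, by omega⟩) h1 h2)
  have hy := congrArg h.basis.repr h.basis_last
  rw [Module.Basis.repr_self] at he hy
  have hr := congrArg h.basis.repr hab
  simp only [map_add, map_smul, ← he, ← hy, map_zero] at hr
  have ha := DFunLike.congr_fun hr ⟨j, by omega⟩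
  have hb := DFunLike.congr_fun hr (Fin.last (2 * m))
  have hne : (⟨j, by omega⟩ : Fin (2 * m + 1)) ≠ Fin.last (2 * m) := by
    intro h; have := congrArg Fin.val h; simp at this; omega
  simp [hne, hne.symm] at ha hb
  exact ⟨ha, hb⟩

theorem e_x_eq_zero {a b : ℂ} (hab : a • x + b • e 1 = 0) : a = 0 ∧ b = 0 := by
  have hm := h.four_le
  have h1 : b = 0 := by
    have := congrArg (fun z => ⁅x, z⁆) hab
    simp only [lie_add, lie_smul, lie_self, smul_zero, zero_add, lie_zero, h.xe 1 le_rfl] at this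
    exact h.smul_e_eq_zero (by omega) (by omega) this
  refine ⟨?_, h1⟩
  have := congrArg (fun z => ⁅z, e 1⁆) hab
  simp only [h1, zero_smul, add_zero, smul_lie, zero_lie, h.xe 1 le_rfl] at this
  exact h.smul_e_eq_zero (by omega) (by omega) this

theorem e_mem_C {k j : ℕ} (hj : k + 1 ≤ j) : e j ∈ C 𝔤 k :=
  C_antitone (by omega) (h.grading.le_C _ (h.e_mem_piece j (by omega)))

theorem y_mem_C {k : ℕ} (hk : k ≤ 2 * t) : y ∈ C 𝔤 k :=
  C_antitone hk (h.grading.le_C _ h.y_mem_piece)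

theorem C_le_span {k : ℕ} (hk : 1 ≤ k) :
    (C 𝔤 k).toSubmodule ≤ Submodule.span ℂ ({y} ∪ e '' {j | k + 1 ≤ j}) := by
  rw [h.grading.C_eq_iSup]
  refine iSup_le fun i => Submodule.span_le.2 ?_
  rintro _ ⟨j, hj, rfl⟩
  change tableDeg m t j = k + i at hj
  revert hj
  refine h.basis_cases (P := fun v d => d = k + i → v ∈ _) ?_ ?_ ?_ j
  · intro h; omega
  · intro _; exact Submodule.subset_span (by simp)
  · intro j h1 h2 hj; exact Submodule.subset_span (Or.inr ⟨j, by simp; omega, rfl⟩)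

theorem C_eq_bot : C 𝔤 (2 * m - 1) = ⊥ := by
  have hm := h.four_le
  have ht := h.lt
  rw [← LieSubmodule.toSubmodule_inj, h.grading.C_eq_iSup, LieSubmodule.bot_toSubmodule, eq_bot_iff]
  refine iSup_le fun i => Submodule.span_le.2 ?_
  rintro _ ⟨j, hj, rfl⟩
  change tableDeg m t j = _ at hj
  exfalso
  revert hj
  refine h.basis_cases (P := fun v d => d = 2 * m - 1 + i → False) ?_ ?_ ?_ j
  · intro h; omega
  · intro h; omega
  · intro j h1 h2 hj; omega

theorem C_ne_bot {k : ℕ} (hk : k + 1 < 2 * m) : C 𝔤 k ≠ ⊥ := by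
  intro h0
  have := h.e_mem_C (k := k) (j := k + 1) le_rfl
  rw [h0] at this
  exact h.e_ne_zero (k + 1) (by omega) (by omega) (by simpa using this)

theorem eq_zero_of_mem_C {z : 𝔤} {k : ℕ} (hk : 2 * m - 1 ≤ k) (hz : z ∈ C 𝔤 k) : z = 0 := by
  have := C_antitone hk hz
  rw [h.C_eq_bot] at this
  simpa using this

theorem isNilpotent : LieRing.IsNilpotent 𝔤 :=
  LieModule.IsNilpotent.mk (R := ℂ) (L := 𝔤) (M := 𝔤) h.C_eq_bot

theorem isNaturallyGraded : IsNaturallyGraded 𝔤 := h.grading.isNaturallyGraded h.C_eq_bot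

theorem nilindex_eq : nilindex 𝔤 = 2 * m - 1 := by
  have hm := h.four_le
  obtain ⟨k, hk⟩ : ∃ k, 2 * m - 1 = k + 1 := ⟨2 * m - 2, by omega⟩
  rw [hk, LieModule.nilpotencyLength_eq_succ_iff ℂ, ← hk]
  exact ⟨h.C_eq_bot, h.C_ne_bot (by omega)⟩

theorem exists_sub_mem_C_one (z : 𝔤) : ∃ p q : ℂ, z - (p • x + q • e 1) ∈ C 𝔤 1 := by
  have h1 := h.grading.sub_proj_mem (mem_C_zero z)
  have h2 : h.proj 0 z ∈ Submodule.span ℂ {x, e 1} := by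
    have := h.grading.proj_mem 0 z
    refine Submodule.span_le.2 ?_ this
    rintro _ ⟨j, hj, rfl⟩
    change tableDeg m t j = _ at hj
    revert hj
    refine h.basis_cases (P := fun v d => d = 0 → v ∈ _) ?_ ?_ ?_ j
    · intro _; exact Submodule.subset_span (by simp)
    · intro h0; have := h.one_le; omega
    · intro j h1 h2 hj
      obtain rfl : j = 1 := by omega
      exact Submodule.subset_span (by simp)
  obtain ⟨p, q, hpq⟩ := Submodule.mem_span_pair.1 h2
  exact ⟨p, q, hpq ▸ h1⟩

theorem exists_sub_mem_C {k : ℕ} (hk : 1 ≤ k) {z : 𝔤} (hz : z ∈ C 𝔤 k) :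
    ∃ a b : ℂ, z - (a • e (k + 1) + b • y) ∈ C 𝔤 (k + 1) ∧ (k ≠ 2 * t → b = 0) := by
  have h1 := h.grading.sub_proj_mem hz
  have h3 := h.grading.proj_mem k z
  by_cases hkt : k = 2 * t
  · have h2 : h.proj k z ∈ Submodule.span ℂ {e (k + 1), y} := by
      refine Submodule.span_le.2 ?_ h3
      rintro _ ⟨j, hj, rfl⟩
      change tableDeg m t j = _ at hj
      revert hj
      refine h.basis_cases (P := fun v d => d = k → v ∈ _) ?_ ?_ ?_ j
      · intro _; omega
      · intro _; exact Submodule.subset_span (by simp)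
      · intro j h1 h2 hj
        obtain rfl : j = k + 1 := by omega
        exact Submodule.subset_span (by simp)
    obtain ⟨p, q, hpq⟩ := Submodule.mem_span_pair.1 h2
    exact ⟨p, q, hpq ▸ h1, fun h => absurd hkt h⟩
  · have h2 : h.proj k z ∈ Submodule.span ℂ {e (k + 1)} := by
      refine Submodule.span_le.2 ?_ h3
      rintro _ ⟨j, hj, rfl⟩
      change tableDeg m t j = _ at hj
      revert hj
      refine h.basis_cases (P := fun v d => d = k → v ∈ _) ?_ ?_ ?_ j
      · intro _; omega
      · intro _; omega
      · intro j h1 h2 hj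
        obtain rfl : j = k + 1 := by omega
        exact Submodule.subset_span (by simp)
    obtain ⟨p, hp⟩ := Submodule.mem_span_singleton.1 h2
    exact ⟨p, 0, by rw [zero_smul, add_zero, hp]; exact h1, fun _ => rfl⟩

theorem e_not_mem_C {j : ℕ} (h1 : 1 ≤ j) (h2 : j < 2 * m) : e j ∉ C 𝔤 j := fun hj =>
  h.e_ne_zero j h1 h2 (h.grading.eq_zero_of_mem (by omega) (h.e_mem_piece j h1) hj)

theorem smul_e_mem_C {j : ℕ} (h1 : 1 ≤ j) (h2 : j < 2 * m) {c : ℂ} (hc : c • e j ∈ C 𝔤 j) :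
    c = 0 := h.smul_e_eq_zero h1 h2 (h.grading.eq_zero_of_mem (by omega)
      (Submodule.smul_mem _ c (h.e_mem_piece j h1)) hc)

theorem x_e_mem_C {a b : ℂ} (hab : a • x + b • e 1 ∈ C 𝔤 1) : a = 0 ∧ b = 0 :=
  h.e_x_eq_zero <| h.grading.eq_zero_of_mem (by omega : 0 < 1)
    (add_mem (Submodule.smul_mem _ a h.x_mem_piece)
      (Submodule.smul_mem _ b (h.e_mem_piece 1 le_rfl))) hab

/-- Since `[C^p, C^p] ⊆ C^{2p+1}`, commutativity is automatic from `p = m-1` on. Below, the single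
bracket `[e_{m-1}, e_m]` is the obstruction: it equals `A (m-1) m e_{2m-1}`, plus a nonzero multiple
of `y` when `t = m-1`. -/
theorem centralizerProperty (hA : A (m - 1) m ≠ 0 ∨ t = m - 1) : CentralizerProperty 𝔤 := by
  have hm := h.four_le
  rw [CentralizerProperty, h.nilindex_eq]
  constructor
  · intro p hp u hu v hv
    exact h.eq_zero_of_mem_C (by omega) (lie_mem_C 𝔤 hu hv)
  · intro p hp hC
    have := hC (h.e_mem_C (k := p) (j := m - 1) (by omega)) (e m) (h.e_mem_C (by omega))
    rw [h.ee _ _ (by omega) (by omega)] at this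
    by_cases ht : t = m - 1
    · rw [if_pos (by omega), ← mul_one ((-1 : ℂ) ^ (m - 1 + 1))] at this
      have := (h.e_y_eq_zero (by omega) (by omega) this).2
      simp at this
    · rw [if_neg (by omega), add_zero] at this
      exact hA.resolve_right ht (h.smul_e_eq_zero (by omega) (by omega) this)

/-- The critical degree is `m-1`. Its component is spanned by `e_{m-1}`, together with `y` if `2t+1
= m-1`, so that only `[e_{m-1}, y]`, a multiple of `f`, could be nonzero. -/
theorem conditionTwo (hf : f = 0 ∨ t = m - 2) : ConditionTwo 𝔤 := by
  have hm := h.four_le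
  have ht := h.one_le
  intro a b
  rw [h.nilindex_eq]
  intro ha hb X Y hXY
  by_contra hab
  obtain rfl : a = m - 2 := by omega
  obtain rfl : b = m - 2 := by omega
  obtain ⟨⟨u, hu⟩, rfl⟩ := Submodule.Quotient.mk_surjective _ X
  obtain ⟨⟨v, hv⟩, rfl⟩ := Submodule.Quotient.mk_surjective _ Y
  apply hXY
  refine (Submodule.Quotient.mk_eq_zero _).2 ?_
  change ⁅u, v⁆ ∈ C 𝔤 (m - 2 + (m - 2) + 1 + 1)
  obtain ⟨p, q, hu', hq⟩ := h.exists_sub_mem_C (by omega) hu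
  obtain ⟨p', q', hv', hq'⟩ := h.exists_sub_mem_C (by omega) hv
  have h1 := lie_mem_C 𝔤 hu' hv
  have hp := (C 𝔤 (m - 2)).smul_mem p (h.e_mem_C (k := m - 2) (j := m - 2 + 1) le_rfl)
  have hqy : q • y ∈ C 𝔤 (m - 2) := by
    by_cases hmt : m - 2 = 2 * t
    · exact (C 𝔤 (m - 2)).smul_mem q (h.y_mem_C hmt.le)
    · rw [hq hmt, zero_smul]; exact zero_mem _
  have h2 := lie_mem_C 𝔤 (add_mem hp hqy) hv'
  have h3 : ⁅p • e (m - 2 + 1) + q • y, p' • e (m - 2 + 1) + q' • y⁆ = 0 := by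
    by_cases hmt : m - 2 = 2 * t
    · have hf0 : f = 0 := hf.resolve_right (by omega)
      simp only [lie_add, add_lie, lie_smul, smul_lie, lie_self, h.ey _ (by omega : 1 ≤ m - 2 + 1),
        h.ye _ (by omega : 1 ≤ m - 2 + 1), hf0]
      simp
    · simp [hq hmt, hq' hmt]
  have e1 : ⁅u, v⁆ = ⁅u - (p • e (m - 2 + 1) + q • y), v⁆ +
      ⁅p • e (m - 2 + 1) + q • y, v - (p' • e (m - 2 + 1) + q' • y)⁆ +
      ⁅p • e (m - 2 + 1) + q • y, p' • e (m - 2 + 1) + q' • y⁆ := by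
    rw [sub_lie, lie_sub]; abel
  rw [e1, h3, add_zero]
  refine add_mem ?_ ?_
  · exact C_antitone (by omega) h1
  · exact C_antitone (by omega) h2

theorem isP2 (hA : A (m - 1) m ≠ 0 ∨ t = m - 1) (hf : f = 0 ∨ t = m - 2) : IsP2 𝔤 :=
  ⟨h.isNilpotent, h.isNaturallyGraded, h.centralizerProperty hA, h.conditionTwo hf⟩

/-- In `C^{m-2}` the only pair of basis vectors whose bracket is not zero for reasons of degree or
by the assumption on `f` is `e_{m-1}, e_m`. This is the source of the nonvanishing conditions in the
classification. -/
theorem not_centralizerProperty (hA : A (m - 1) m = 0) (ht : t ≠ m - 1) (hf : f = 0 ∨ t = m - 2) :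
    ¬ CentralizerProperty 𝔤 := by
  have hm := h.four_le
  have hlt := h.lt
  rintro ⟨-, h2⟩
  refine h2 (m - 2) (by rw [h.nilindex_eq]; omega) ?_
  intro u hu v hv
  have hS := h.C_le_span (k := m - 2) (by omega)
  refine lie_eq_zero_of_mem_span ?_ (hS hu) (hS hv)
  have hey : ∀ j, m - 2 + 1 ≤ j → ⁅e j, y⁆ = 0 := by
    intro j hj
    rw [h.ey j (by omega)]
    rcases hf with rfl | rfl
    · rw [zero_smul]
    · rw [h.zero _ (by omega), smul_zero]
  have hee : ∀ i j, m - 2 + 1 ≤ i → i ≤ j → ⁅e i, e j⁆ = 0 := by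
    intro i j hi hij
    rcases hij.eq_or_lt with rfl | hij
    · exact lie_self _
    rw [h.ee i j (by omega) (by omega), if_neg (by omega), add_zero]
    by_cases hs : i + j < 2 * m
    · obtain rfl : i = m - 1 := by omega
      obtain rfl : j = m := by omega
      rw [hA, zero_smul]
    · rw [h.zero _ (by omega), smul_zero]
  rintro _ (rfl | ⟨i, hi, rfl⟩) _ (rfl | ⟨j, hj, rfl⟩)
  · exact lie_self _
  · rw [← lie_skew, hey j hj, neg_zero]
  · exact hey i hi
  · rcases le_total i j with hij | hij
    · exact hee i j hi hij
    · rw [← lie_skew, hee j i hj hij, neg_zero]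

end IsTable

end Table

/-! ### Consequences of a Jordan type. -/

section Jordan

variable {V : Type*} [AddCommGroup V] [Module ℂ V] {f : V →ₗ[ℂ] V} {s : List ℕ}

theorem card_jordan_index (s : List ℕ) :
    Fintype.card (Σ i : Fin s.length, Fin (s.get i)) = s.sum := by
  rw [Fintype.card_sigma]
  simp only [Fintype.card_fin]
  rw [← List.sum_ofFn, List.ofFn_get]

theorem HasJordanType.finrank_eq (h : HasJordanType f s) : Module.finrank ℂ V = s.sum := by
  obtain ⟨-, -, b, -⟩ := h
  rw [Module.finrank_eq_card_basis b, card_jordan_index]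

theorem HasJordanType.exists_pow_ne_zero {a : ℕ} {l : List ℕ} (h : HasJordanType f (a :: l)) :
    ∃ v, (f ^ (a - 1)) v ≠ 0 := by
  obtain ⟨-, hpos, b, hb⟩ := h
  have ha : 1 ≤ a := hpos a (by simp)
  refine ⟨b ⟨⟨0, by simp⟩, ⟨0, ha⟩⟩, ?_⟩
  have key : ∀ k (hk : k < a), (f ^ k) (b ⟨⟨0, by simp⟩, ⟨0, ha⟩⟩) =
      b ⟨⟨0, by simp⟩, ⟨k, hk⟩⟩ := by
    intro k
    induction k with
    | zero => intro _; simp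
    | succ k ih =>
      intro hk
      rw [pow_succ', Module.End.mul_apply, ih (by omega), hb]
      exact dif_pos hk
  rw [key (a - 1) (by omega)]
  exact b.ne_zero _

/-- If all Jordan blocks have size at least two, then the kernel lies in the range. -/
theorem HasJordanType.ker_le_range (h : HasJordanType f s) (h2 : ∀ a ∈ s, 2 ≤ a) :
    LinearMap.ker f ≤ LinearMap.range f := by
  obtain ⟨-, -, b, hb⟩ := h
  have hs : ∀ i : Fin s.length, 2 ≤ s.get i := fun i => h2 _ (List.get_mem s i)
  have hrange : ∀ (i : Fin s.length) (j : ℕ) (hj : j + 1 < s.get i),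
      b ⟨i, ⟨j + 1, hj⟩⟩ ∈ LinearMap.range f := by
    intro i j hj
    refine ⟨b ⟨i, ⟨j, by omega⟩⟩, ?_⟩
    rw [hb]
    exact dif_pos hj
  -- In each block the second coordinate of `f v` is the first coordinate of `v`. So a vector of the
  -- kernel has no component along the heads of the blocks, and all other basis vectors are in the
  -- range.
  have hcoord : ∀ i : Fin s.length,
      b.coord ⟨i, ⟨1, hs i⟩⟩ ∘ₗ f = b.coord ⟨i, ⟨0, by have := hs i; omega⟩⟩ := by
    intro i
    apply b.ext
    rintro ⟨i', j'⟩
    rw [LinearMap.comp_apply, hb]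
    split_ifs with hj
    · simp only [Module.Basis.coord_apply, Module.Basis.repr_self, Finsupp.single_apply]
      congr 1
      simp only [Sigma.mk.injEq, eq_iff_iff]
      constructor
      · rintro ⟨rfl, h⟩
        refine ⟨rfl, ?_⟩
        have := congrArg Fin.val (eq_of_heq h)
        simp only [Nat.add_eq_right] at this
        exact heq_of_eq (Fin.ext this)
      · rintro ⟨rfl, h⟩
        refine ⟨rfl, ?_⟩
        have := congrArg Fin.val (eq_of_heq h)
        simp only at this
        exact heq_of_eq (Fin.ext (by simp [this]))
    · rw [map_zero, Module.Basis.coord_apply, Module.Basis.repr_self, Finsupp.single_eq_of_ne]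
      rintro h
      simp only [Sigma.mk.injEq] at h
      obtain ⟨rfl, h⟩ := h
      have := congrArg Fin.val (eq_of_heq h)
      simp only at this
      have := hs i
      omega
  intro v hv
  rw [← b.sum_repr v]
  refine Submodule.sum_mem _ fun p _ => ?_
  obtain ⟨i, ⟨j, hj⟩⟩ := p
  rcases j with _ | j
  · have h0 := LinearMap.congr_fun (hcoord i) v
    rw [LinearMap.comp_apply, LinearMap.mem_ker.1 hv, map_zero] at h0
    rw [Module.Basis.coord_apply] at h0
    rw [← h0, zero_smul]
    exact zero_mem _
  · exact Submodule.smul_mem _ _ (hrange i j hj)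

end Jordan

/-! ### Nonsplitness, characteristic sequence and isomorphisms of tables. -/

section Table

variable {𝔤 : Type*} [LieRing 𝔤] [LieAlgebra ℂ 𝔤] {m t : ℕ} {A : ℕ → ℕ → ℂ} {f : ℂ}
  {x : 𝔤} {e : ℕ → 𝔤} {y : 𝔤}

theorem lie_mem_C_one (u v : 𝔤) : ⁅u, v⁆ ∈ C 𝔤 1 := lie_mem_C_succ u (mem_C_zero v)

theorem ad_pow_mem_C (u v : 𝔤) (k : ℕ) : ((LieAlgebra.ad ℂ 𝔤 u) ^ k) v ∈ C 𝔤 k := by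
  induction k with
  | zero => exact mem_C_zero _
  | succ k ih =>
    rw [pow_succ', Module.End.mul_apply, LieAlgebra.ad_apply]
    exact lie_mem_C_succ u ih

/-- In a nilpotent algebra an ideal that fills the abelianization is everything: inductively `J +
C^{k+1} = 𝔤` improves to `J + C^{k+2} = 𝔤`, since `C^1 = [𝔤, 𝔤] ⊆ J + C^{k+2}`. -/
theorem eq_top_of_sup_C_one {J : LieIdeal ℂ 𝔤} (hJ : ∀ z, ∃ j ∈ J, z - j ∈ C 𝔤 1)
    {n : ℕ} (hn : C 𝔤 n = ⊥) : J = ⊤ := by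
  have key : ∀ k, J.toSubmodule ⊔ (C 𝔤 (k + 1)).toSubmodule = ⊤ := by
    intro k
    induction k with
    | zero =>
      rw [eq_top_iff]
      intro z _
      obtain ⟨j, hj, hz⟩ := hJ z
      exact Submodule.mem_sup.2 ⟨j, hj, _, hz, by abel⟩
    | succ k ih =>
      have h1 : (C 𝔤 1).toSubmodule ≤ J.toSubmodule ⊔ (C 𝔤 (k + 1 + 1)).toSubmodule := by
        rw [C_succ_eq_span, Submodule.span_le]
        rintro _ ⟨a, b, -, rfl⟩
        have ha : a ∈ J.toSubmodule ⊔ (C 𝔤 (k + 1)).toSubmodule := by rw [ih]; trivial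
        obtain ⟨j, hj, w, hw, rfl⟩ := Submodule.mem_sup.1 ha
        rw [add_lie]
        refine Submodule.mem_sup.2 ⟨_, lie_mem_left ℂ 𝔤 J j b hj, _, ?_, rfl⟩
        rw [← lie_skew]
        exact neg_mem (lie_mem_C_succ b hw)
      rw [eq_top_iff]
      intro z _
      obtain ⟨j, hj, hz⟩ := hJ z
      have := add_mem ((le_sup_left : J.toSubmodule ≤ J.toSubmodule ⊔ (C 𝔤 (k + 1 + 1)).toSubmodule) hj)
        (h1 hz)
      simpa using this
  have h2 := key n
  have h3 : (C 𝔤 (n + 1)).toSubmodule = ⊥ := by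
    rw [eq_bot_iff]
    have : C 𝔤 (n + 1) ≤ ⊥ := hn ▸ C_antitone (Nat.le_succ n)
    exact this
  rw [h3, sup_bot_eq] at h2
  exact (LieSubmodule.toSubmodule_inj J ⊤).1 h2

theorem det_eq_zero_of_proportional {a b c d p q : ℂ} (hpq : ¬ (p = 0 ∧ q = 0))
    (h1 : a * q = b * p) (h2 : c * q = d * p) : a * d = b * c := by
  by_cases hp : p = 0
  · have hq : q ≠ 0 := fun hq => hpq ⟨hp, hq⟩
    subst hp
    simp only [mul_zero, mul_eq_zero, hq, or_false] at h1 h2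
    rw [h1, h2]; ring
  · have : p * (a * d - b * c) = 0 := by linear_combination c * h1 - a * h2
    exact sub_eq_zero.1 ((mul_eq_zero.1 this).resolve_left hp)

namespace IsTable

variable (h : IsTable m t A f x e y)
include h

/-- The component of degree two of `[u, v]` is the determinant of the parts of degree one, times
`e_2`. -/
theorem lie_generic {u v : 𝔤} {p q p' q' : ℂ} (hu : u - (p • x + q • e 1) ∈ C 𝔤 1)
    (hv : v - (p' • x + q' • e 1) ∈ C 𝔤 1) (huv : ⁅u, v⁆ = 0) : p * q' = q * p' := by
  have hm := h.four_le
  have h1 : ⁅p • x + q • e 1, p' • x + q' • e 1⁆ = (p * q' - q * p') • e 2 := by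
    simp only [lie_add, add_lie, lie_smul, smul_lie, lie_self, h.xe 1 le_rfl, h.ex 1 le_rfl]
    module
  have h2 : (p * q' - q * p') • e 2 ∈ C 𝔤 2 := by
    have e1 : (p * q' - q * p') • e 2 = -(⁅u - (p • x + q • e 1), v⁆ +
        ⁅p • x + q • e 1, v - (p' • x + q' • e 1)⁆) := by
      rw [sub_lie, lie_sub, huv, ← h1]; abel
    rw [e1]
    refine neg_mem (add_mem ?_ ?_)
    · rw [← lie_skew]; exact neg_mem (lie_mem_C_succ _ hu)
    · exact lie_mem_C_succ _ hv
  exact sub_eq_zero.1 (h.smul_e_mem_C (by omega) (by omega) h2)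

/-- Complementary ideals commute. If neither lies in `C^1`, `lie_generic` makes the images of both
in the two-dimensional abelianization proportional to each other, so they cannot span it. If one
lies in `C^1`, the other fills the abelianization and is the whole algebra. -/
theorem isNonsplit : IsNonsplit 𝔤 := by
  have hm := h.four_le
  rintro ⟨I, J, hI, hJ, hIJ⟩
  have hlie : ∀ u ∈ I, ∀ v ∈ J, ⁅u, v⁆ = 0 := by
    intro u hu v hv
    have h1 : ⁅u, v⁆ ∈ I ⊓ J := ⟨lie_mem_left ℂ 𝔤 I u v hu, lie_mem_right ℂ 𝔤 J u v hv⟩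
    rw [hIJ.inf_eq_bot] at h1
    simpa using h1
  have hsum : ∀ z, ∃ u ∈ I, ∃ v ∈ J, u + v = z := by
    intro z
    have : z ∈ I ⊔ J := by rw [hIJ.sup_eq_top]; trivial
    exact (LieSubmodule.mem_sup ..).1 this
  have hnot : ∀ K : LieIdeal ℂ 𝔤, ¬ K ≤ C 𝔤 1 →
      ∃ u ∈ K, ∃ p q : ℂ, u - (p • x + q • e 1) ∈ C 𝔤 1 ∧ ¬ (p = 0 ∧ q = 0) := by
    intro K hK
    obtain ⟨u, hu, hu'⟩ := Set.not_subset.1 hK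
    obtain ⟨p, q, hpq⟩ := h.exists_sub_mem_C_one u
    refine ⟨u, hu, p, q, hpq, ?_⟩
    rintro ⟨rfl, rfl⟩
    exact hu' (by simpa using hpq)
  have hC : I ≤ C 𝔤 1 ∨ J ≤ C 𝔤 1 := by
    by_contra hcon
    rw [not_or] at hcon
    obtain ⟨u, hu, p, q, hupq, hpq⟩ := hnot I hcon.1
    obtain ⟨v, hv, r, s, hvrs, hrs⟩ := hnot J hcon.2
    obtain ⟨u0, hu0, v0, hv0, h0⟩ := hsum x
    obtain ⟨u1, hu1, v1, hv1, h1⟩ := hsum (e 1)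
    obtain ⟨a0, b0, hab0⟩ := h.exists_sub_mem_C_one u0
    obtain ⟨a1, b1, hab1⟩ := h.exists_sub_mem_C_one u1
    obtain ⟨c0, d0, hcd0⟩ := h.exists_sub_mem_C_one v0
    obtain ⟨c1, d1, hcd1⟩ := h.exists_sub_mem_C_one v1
    have k0 := h.lie_generic hab0 hvrs (hlie _ hu0 _ hv)
    have k1 := h.lie_generic hab1 hvrs (hlie _ hu1 _ hv)
    have l0 := h.lie_generic hupq hcd0 (hlie _ hu _ hv0)
    have l1 := h.lie_generic hupq hcd1 (hlie _ hu _ hv1)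
    have D1 := det_eq_zero_of_proportional hrs k0 k1
    have D2 := det_eq_zero_of_proportional (a := c0) (b := d0) (c := c1) (d := d1) hpq
      (by linear_combination -l0) (by linear_combination -l1)
    have M1 := h.lie_generic hab0 hcd1 (hlie _ hu0 _ hv1)
    have M2 := h.lie_generic hab1 hcd0 (hlie _ hu1 _ hv0)
    have x1 : (1 - (a0 + c0)) • x + (-(b0 + d0)) • e 1 ∈ C 𝔤 1 := by
      have := add_mem hab0 hcd0
      convert this using 1
      rw [eq_sub_of_add_eq h0]
      module
    have x2 : (-(a1 + c1)) • x + (1 - (b1 + d1)) • e 1 ∈ C 𝔤 1 := by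
      have := add_mem hab1 hcd1
      convert this using 1
      rw [eq_sub_of_add_eq h1]
      module
    obtain ⟨y1, y2⟩ := h.x_e_mem_C x1
    obtain ⟨y3, y4⟩ := h.x_e_mem_C x2
    -- The pair `x, e 1` has determinant one. Expanding it along the decomposition into `I`-parts
    -- and `J`-parts, the two pure determinants vanish by `D1` and `D2`, the mixed ones by `M1` and
    -- `M2`.
    have : (1 : ℂ) = 0 := by
      linear_combination D1 + D2 + M1 - M2 + y1 + y4 * (a0 + c0) - y2 * (a1 + c1) 
    exact one_ne_zero this
  have hfin : ∀ I J : LieIdeal ℂ 𝔤, IsCompl I J → I ≤ C 𝔤 1 → I = ⊥ := by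
    intro I J hIJ hI
    have : J = ⊤ := by
      refine eq_top_of_sup_C_one (fun z => ?_) h.C_eq_bot
      have : z ∈ I ⊔ J := by rw [hIJ.sup_eq_top]; trivial
      obtain ⟨u, hu, v, hv, rfl⟩ := (LieSubmodule.mem_sup ..).1 this
      exact ⟨v, hv, by simpa using hI hu⟩
    rw [this] at hIJ
    simpa using hIJ.inf_eq_bot
  rcases hC with hC | hC
  · exact hI (hfin I J hIJ hC)
  · exact hJ (hfin J I hIJ.symm hC)

theorem x_not_mem_C_one : x ∉ C 𝔤 1 := by
  intro hx
  have := h.x_e_mem_C (a := 1) (b := 0) (by simpa using hx)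
  simp at this

theorem hasJordanType : HasJordanType (LieAlgebra.ad ℂ 𝔤 x) [2 * m - 1, 1, 1] := by
  have hm := h.four_le
  refine ⟨by simp; omega, by simp; omega, ?_⟩
  let w : (Σ i : Fin [2 * m - 1, 1, 1].length, Fin ([2 * m - 1, 1, 1].get i)) → 𝔤 := fun p =>
    if p.1.1 = 0 then e (p.2.1 + 1) else if p.1.1 = 1 then x else y
  have hspan : ⊤ ≤ Submodule.span ℂ (Set.range w) := by
    rw [← h.span, Submodule.span_le]
    rintro z ((rfl | rfl) | ⟨j, hj, rfl⟩)
    · exact Submodule.subset_span ⟨⟨⟨1, by simp⟩, ⟨0, by simp⟩⟩, by simp [w]⟩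
    · exact Submodule.subset_span ⟨⟨⟨2, by simp⟩, ⟨0, by simp⟩⟩, by simp [w]⟩
    · rcases Nat.lt_or_ge j (2 * m) with h1 | h1
      · have hj : 1 ≤ j := hj
        refine Submodule.subset_span ⟨⟨⟨0, by simp⟩, ⟨j - 1, ?_⟩⟩, ?_⟩
        · simp; omega
        · simp only [w, if_true]
          rw [Nat.sub_add_cancel hj]
      · rw [h.zero j h1]; exact zero_mem _
  let b := basisOfTopLeSpanOfCardEqFinrank w hspan (by
    rw [card_jordan_index, h.dim]; simp; omega)
  have hbw : ∀ p, b p = w p := fun p => by simp [b]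
  refine ⟨b, ?_⟩
  intro i j
  rw [hbw, LieAlgebra.ad_apply]
  obtain ⟨i, hi⟩ := i
  obtain ⟨j, hj⟩ := j
  have hi' : i = 0 ∨ i = 1 ∨ i = 2 := by simp at hi; omega
  rcases hi' with rfl | rfl | rfl
  · simp only [w, if_true]
    rw [h.xe _ (by omega)]
    split_ifs with hj'
    · rw [hbw]; simp [w]
    · rw [h.zero]
      simp at hj' hj
      omega
  · rw [dif_neg (by simp)]
    simp [w]
  · rw [dif_neg (by simp)]
    simp [w, h.xy]

/-- A block longer than `2m-1` contradicts `C^{2m-1} = 0`. With a first block of size `2m-1` the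
only competitor is `(2m-1, 2)`; then the kernel of `ad X` lies in its range, and since `X` is in the
kernel it would lie in `C^1`. -/
theorem hasCharSeq : HasCharSeq 𝔤 [2 * m - 1, 1, 1] := by
  have hm := h.four_le
  refine ⟨⟨x, h.x_not_mem_C_one, h.hasJordanType⟩, ?_⟩
  intro X s hX hs
  have hsum := hs.finrank_eq
  rw [h.dim] at hsum
  rcases s with _ | ⟨a, l⟩
  · simp at hsum
  have ha : a ≤ 2 * m - 1 := by
    by_contra hcon
    obtain ⟨v, hv⟩ := hs.exists_pow_ne_zero
    exact hv (h.eq_zero_of_mem_C (by omega) (ad_pow_mem_C X v (a - 1)))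
  rcases ha.lt_or_eq with ha | ha
  · exact le_of_lt (List.cons_lt_cons_iff.2 (Or.inl ha))
  subst ha
  have hl : l.sum = 2 := by simp at hsum; omega
  have hpos := hs.2.1
  rcases l with _ | ⟨b, l⟩
  · simp at hl
  have hb := hpos b (by simp)
  rcases l with _ | ⟨c, l⟩
  · obtain rfl : b = 2 := by simpa using hl
    exfalso
    have := hs.ker_le_range (by simp; omega) (x := X) (by simp)
    obtain ⟨v, hv⟩ := this
    rw [LieAlgebra.ad_apply] at hv
    exact hX (hv ▸ lie_mem_C_one X v)
  have hc := hpos c (by simp)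
  rcases l with _ | ⟨d, l⟩
  · simp at hl
    obtain rfl : b = 1 := by omega
    obtain rfl : c = 1 := by omega
    exact le_rfl
  · have hd := hpos d (by simp)
    simp at hl
    omega

theorem map {𝔥 : Type*} [LieRing 𝔥] [LieAlgebra ℂ 𝔥] (φ : 𝔤 ≃ₗ⁅ℂ⁆ 𝔥) :
    IsTable m t A f (φ x) (fun j => φ (e j)) (φ y) where
  four_le := h.four_le
  one_le := h.one_le
  lt := h.lt
  zero j hj := by rw [h.zero j hj, map_zero]
  xe j hj := by rw [← LieEquiv.map_lie, h.xe j hj]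
  xy := by rw [← LieEquiv.map_lie, h.xy, map_zero]
  ee i j hi hj := by
    rw [← LieEquiv.map_lie, h.ee i j hi hj, map_add, map_smul]
    split_ifs <;> simp
  ey j hj := by rw [← LieEquiv.map_lie, h.ey j hj, map_smul]
  span := by
    have h1 := congrArg (Submodule.map (φ.toLinearEquiv : 𝔤 →ₗ[ℂ] 𝔥)) h.span
    rw [Submodule.map_span, Submodule.map_top, LinearEquiv.range, Set.image_union,
      Set.image_pair, Set.image_image] at h1
    exact h1
  dim := by rw [← h.dim]; exact (LinearEquiv.finrank_eq φ.toLinearEquiv).symm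

/-- Only the coefficients with `i + j < 2m` need to agree, the others being multiplied by the zero
vector. -/
theorem nonempty_equiv {𝔥 : Type*} [LieRing 𝔥] [LieAlgebra ℂ 𝔥] {A' : ℕ → ℕ → ℂ} {x' : 𝔥}
    {e' : ℕ → 𝔥} {y' : 𝔥} (h' : IsTable m t A' f x' e' y')
    (hA : ∀ i j, 1 ≤ i → 1 ≤ j → i + j < 2 * m → A i j = A' i j) : Nonempty (𝔤 ≃ₗ⁅ℂ⁆ 𝔥) := by
  have hm := h.four_le
  let φ : 𝔤 ≃ₗ[ℂ] 𝔥 := h.basis.equiv h'.basis (Equiv.refl _)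
  have hx : φ x = x' := by
    rw [← h.basis_zero, Module.Basis.equiv_apply, Equiv.refl_apply, h'.basis_zero]
  have hy : φ y = y' := by
    rw [← h.basis_last, Module.Basis.equiv_apply, Equiv.refl_apply, h'.basis_last]
  have he : ∀ j, 1 ≤ j → φ (e j) = e' j := by
    intro j hj
    rcases Nat.lt_or_ge j (2 * m) with h1 | h1
    · rw [← h.basis_mid (i := ⟨j, by omega⟩) hj h1, Module.Basis.equiv_apply, Equiv.refl_apply,
        h'.basis_mid (i := ⟨j, by omega⟩) hj h1]
    · rw [h.zero j h1, h'.zero j h1, map_zero]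
  have hlie : ∀ u v, φ ⁅u, v⁆ = ⁅φ u, φ v⁆ := by
    intro u v
    have hu : u ∈ Submodule.span ℂ ({x, y} ∪ e '' {j | 1 ≤ j}) := by rw [h.span]; trivial
    have hv : v ∈ Submodule.span ℂ ({x, y} ∪ e '' {j | 1 ≤ j}) := by rw [h.span]; trivial
    induction hu using Submodule.span_induction with
    | mem u hu =>
      induction hv using Submodule.span_induction with
      | mem v hv =>
        rcases hu with (rfl | rfl) | ⟨i, hi, rfl⟩ <;> rcases hv with (rfl | rfl) | ⟨j, hj, rfl⟩
        · simp
        · rw [h.xy, hx, hy, h'.xy, map_zero]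
        · rw [h.xe j hj, hx, he j hj, h'.xe j hj, he _ (by omega)]
        · rw [h.yx, hx, hy, h'.yx, map_zero]
        · simp
        · rw [h.ye j hj, hy, he j hj, h'.ye j hj, map_neg, map_smul, he _ (by omega)]
        · rw [h.ex i hi, hx, he i hi, h'.ex i hi, map_neg, he _ (by omega)]
        · rw [h.ey i hi, hy, he i hi, h'.ey i hi, map_smul, he _ (by omega)]
        · have hi : 1 ≤ i := hi
          rw [h.ee i j hi hj, he i hi, he j hj, h'.ee i j hi hj, map_add, map_smul,
            he _ (by omega)]
          congr 1
          · rcases Nat.lt_or_ge (i + j) (2 * m) with h1 | h1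
            · rw [hA i j hi hj h1]
            · rw [h'.zero _ h1, smul_zero, smul_zero]
          · split_ifs
            · rw [map_smul, hy]
            · exact map_zero _
      | zero => simp
      | add a b _ _ ha hb => rw [lie_add, map_add, map_add, lie_add, ha, hb]
      | smul c a _ ha => rw [lie_smul, map_smul, map_smul, lie_smul, ha]
    | zero => simp
    | add a b _ _ ha hb => rw [add_lie, map_add, map_add, add_lie, ha, hb]
    | smul c a _ ha => rw [smul_lie, map_smul, map_smul, smul_lie, ha]
  exact ⟨{ φ with map_lie' := fun {u v} => hlie u v }⟩

end IsTable
end Table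

/-! ### Tables of the models. -/

section Models

/-- The basis vector `X_k` of `ℂⁿ`, for `1 ≤ k ≤ n`. -/
def stdVec (n k : ℕ) : Fin n → ℂ := fun i => if i.1 + 1 = k then 1 else 0

theorem coordForm_stdVec {n k : ℕ} (h1 : 1 ≤ k) (h2 : k ≤ n) (i : ℕ) :
    coordForm n i (stdVec n k) = if i = k then 1 else 0 := by
  unfold coordForm stdVec
  split_ifs with h h' h'
  · simp; omega
  · simp; omega
  · omega
  · rfl

theorem wedge_stdVec {n i j : ℕ} (hi : 1 ≤ i) (hi' : i ≤ n) (hj : 1 ≤ j) (hj' : j ≤ n) (a b : ℕ) :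
    wedge n a b (stdVec n i) (stdVec n j) =
      (if a = i ∧ b = j then 1 else 0) - if b = i ∧ a = j then 1 else 0 := by
  rw [wedge_apply, coordForm_stdVec hi hi', coordForm_stdVec hj hj', coordForm_stdVec hi hi',
    coordForm_stdVec hj hj']
  simp only [← ite_and, mul_ite, mul_one, mul_zero]
  congr 1 <;> simp only [and_comm]

theorem sum_wedge_stdVec {n i j : ℕ} (hi : 1 ≤ i) (hi' : i ≤ n) (hj : 1 ≤ j) (hj' : j ≤ n)
    (c : ℕ → ℂ) {p q S : ℕ} (_hq : q < S) :
    (∑ l ∈ Finset.Icc p q, c l • wedge n l (S - l)) (stdVec n i) (stdVec n j) =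
      if i + j = S then (if i ∈ Finset.Icc p q then c i else 0) -
        (if j ∈ Finset.Icc p q then c j else 0) else 0 := by
  simp only [LinearMap.sum_apply, LinearMap.smul_apply, wedge_stdVec hi hi' hj hj', smul_eq_mul]
  by_cases hS : i + j = S
  · rw [if_pos hS, ← Finset.sum_ite_eq' _ i c, ← Finset.sum_ite_eq' _ j c, ← Finset.sum_sub_distrib]
    refine Finset.sum_congr rfl fun l hl => ?_
    rw [Finset.mem_Icc] at hl
    have h1 : (l = i ∧ S - l = j) ↔ l = i := by omega
    have h2 : (S - l = i ∧ l = j) ↔ l = j := by omega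
    simp only [h1, h2]
    split_ifs <;> simp
  · rw [if_neg hS]
    refine Finset.sum_eq_zero fun l hl => ?_
    rw [Finset.mem_Icc] at hl
    rw [if_neg (by omega), if_neg (by omega)]
    simp

/-- The basis vector `X_k` as an element of the Lie algebra of a law. -/
def LieLaw.X {n : ℕ} (L : LieLaw n) (k : ℕ) : L.Alg := stdVec n k

/-- The coordinates on the Lie algebra of a law. -/
def LieLaw.crd {n : ℕ} (L : LieLaw n) (k : Fin n) : L.Alg →ₗ[ℂ] ℂ :=
  LinearMap.proj (R := ℂ) (φ := fun _ : Fin n => ℂ) k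

theorem LieLaw.ext_crd {n : ℕ} {L : LieLaw n} {u v : L.Alg} (h : ∀ k, L.crd k u = L.crd k v) :
    u = v := funext h

theorem LieLaw.crd_X {n : ℕ} (L : LieLaw n) (k : Fin n) (i : ℕ) :
    L.crd k (L.X i) = if k.1 + 1 = i then 1 else 0 := rfl

theorem LieLaw.crd_lie_X {n : ℕ} {L : LieLaw n}
    {d : ℕ → (Fin n → ℂ) →ₗ[ℂ] (Fin n → ℂ) →ₗ[ℂ] ℂ} (hL : L.μ = lawOf d) (k : Fin n) (i j : ℕ) :
    L.crd k ⁅L.X i, L.X j⁆ = d (k.1 + 1) (stdVec n i) (stdVec n j) := by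
  change L.μ (stdVec n i) (stdVec n j) k = _
  rw [hL]; rfl

theorem LieLaw.eq_sum {n : ℕ} (L : LieLaw n) (z : L.Alg) :
    z = ∑ i : Fin n, L.crd i z • L.X (i.1 + 1) := by
  refine LieLaw.ext_crd fun k => ?_
  simp only [map_sum, map_smul, L.crd_X, smul_eq_mul, Nat.add_right_cancel_iff, ← Fin.ext_iff]
  simp

/-- The dictionary is `x = X_1`, `e_j = X_{j+1}`, `y = X_{2m+1}`; the shift by one explains the
indices `i + j + 1` and `i + 2t + 2` of the forms. -/
theorem isTable_of_forms {m t : ℕ} (hm : 4 ≤ m) (ht : 1 ≤ t) (ht' : t < m) {A : ℕ → ℕ → ℂ} {f : ℂ}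
    (L : LieLaw (2 * m + 1))
    {d : ℕ → (Fin (2 * m + 1) → ℂ) →ₗ[ℂ] (Fin (2 * m + 1) → ℂ) →ₗ[ℂ] ℂ} (hL : L.μ = lawOf d)
    (hx : ∀ k j, 1 ≤ k → k ≤ 2 * m + 1 → 1 ≤ j → j < 2 * m →
      d k (stdVec (2 * m + 1) 1) (stdVec (2 * m + 1) (j + 1)) =
        if k = j + 2 ∧ k ≤ 2 * m then 1 else 0)
    (hxy : ∀ k, 1 ≤ k → k ≤ 2 * m + 1 →
      d k (stdVec (2 * m + 1) 1) (stdVec (2 * m + 1) (2 * m + 1)) = 0)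
    (hee : ∀ k i j, 1 ≤ k → k ≤ 2 * m + 1 → 1 ≤ i → i < 2 * m → 1 ≤ j → j < 2 * m →
      d k (stdVec (2 * m + 1) (i + 1)) (stdVec (2 * m + 1) (j + 1)) =
        (if k = i + j + 1 ∧ k ≤ 2 * m then A i j else 0) +
          if k = 2 * m + 1 ∧ i + j = 2 * t + 1 then (-1) ^ (i + 1) else 0)
    (hey : ∀ k i, 1 ≤ k → k ≤ 2 * m + 1 → 1 ≤ i → i < 2 * m →
      d k (stdVec (2 * m + 1) (i + 1)) (stdVec (2 * m + 1) (2 * m + 1)) =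
        if k = i + 2 * t + 2 ∧ k ≤ 2 * m then f else 0) :
    IsTable m t A f (L.X 1) (fun j => if j < 2 * m then L.X (j + 1) else 0)
      (L.X (2 * m + 1)) := by
  refine ⟨hm, ht, ht', ?_, ?_, ?_, ?_, ?_, ?_, ?_⟩
  · intro j hj
    exact if_neg (by omega)
  · intro j hj
    by_cases hj' : j < 2 * m
    · rw [if_pos hj']
      refine LieLaw.ext_crd fun k => ?_
      rw [LieLaw.crd_lie_X hL, hx _ _ (by omega) (by omega) hj hj']
      by_cases hj2 : j + 1 < 2 * m
      · rw [if_pos hj2, L.crd_X]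
        congr 1
        simp only [eq_iff_iff]; omega
      · rw [if_neg hj2, if_neg (by omega), map_zero]
    · rw [if_neg hj', if_neg (by omega), lie_zero]
  · refine LieLaw.ext_crd fun k => ?_
    rw [LieLaw.crd_lie_X hL, hxy _ (by omega) (by omega), map_zero]
  · intro i j hi hj
    by_cases hi' : i < 2 * m
    · by_cases hj' : j < 2 * m
      · rw [if_pos hj', if_pos hi']
        refine LieLaw.ext_crd fun k => ?_
        rw [LieLaw.crd_lie_X hL, hee _ _ _ (by omega) (by omega) hi hi' hj hj', map_add, map_smul]
        congr 1
        · by_cases hij : i + j < 2 * m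
          · rw [if_pos hij, L.crd_X, smul_eq_mul, mul_ite, mul_one, mul_zero]
            congr 1
            simp only [eq_iff_iff]; omega
          · rw [if_neg hij, if_neg (by omega), map_zero, smul_zero]
        · by_cases h2 : i + j = 2 * t + 1
          · rw [if_pos h2, map_smul, L.crd_X, smul_eq_mul, mul_ite, mul_one, mul_zero]
            congr 1
            simp only [eq_iff_iff]; omega
          · rw [if_neg h2, if_neg (by omega), map_zero]
      · rw [if_neg hj', if_neg (by omega : ¬ (i + j < 2 * m)),
          if_neg (by omega : ¬ (i + j = 2 * t + 1)), lie_zero, smul_zero, add_zero]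
    · rw [if_neg hi', if_neg (by omega : ¬ (i + j < 2 * m)),
        if_neg (by omega : ¬ (i + j = 2 * t + 1)), zero_lie, smul_zero, add_zero]
  · intro i hi
    by_cases hi' : i < 2 * m
    · rw [if_pos hi']
      refine LieLaw.ext_crd fun k => ?_
      rw [LieLaw.crd_lie_X hL, hey _ _ (by omega) (by omega) hi hi', map_smul]
      by_cases hit : i + (2 * t + 1) < 2 * m
      · rw [if_pos hit, L.crd_X, smul_eq_mul, mul_ite, mul_one, mul_zero]
        congr 1
        simp only [eq_iff_iff]; omega
      · rw [if_neg hit, if_neg (by omega), map_zero, smul_zero]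
    · rw [if_neg hi', if_neg (by omega), zero_lie, smul_zero]
  · rw [eq_top_iff]
    intro z _
    rw [L.eq_sum z]
    refine Submodule.sum_mem _ fun i _ => Submodule.smul_mem _ _ (Submodule.subset_span ?_)
    rcases tableVec_cases i with h1 | ⟨-, h1⟩ | ⟨h1, h2⟩
    · rw [h1]; exact Or.inl (Or.inl rfl)
    · rw [h1]; exact Or.inl (Or.inr rfl)
    · exact Or.inr ⟨i.1, h1, if_pos h2⟩
  · exact Module.finrank_fin_fun ℂ

/-- The coefficients of the tables of `𝔤³_(m,m-2)` (`γ = 0`) and of `𝔤¹_(4,2)` (`m = 4`, `γ = 1`). -/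
def exceptionalCoeff (m : ℕ) (γ : ℂ) (i j : ℕ) : ℂ :=
  if i + j + 3 = 2 * m then (-1) ^ (i + 1)
  else if i + j + 2 = 2 * m then (-1) ^ (i + 1) * ((m : ℂ) - 1 - i)
  else if i + j + 1 = 2 * m then
    (-1) ^ (i + 1) * (γ - ((i : ℂ) - 1) * (2 * (m : ℂ) - 2 - i) / 2)
  else 0

/-- The coefficients of the table of `𝔤²_(m,t)`. -/
def topCoeff (m i j : ℕ) : ℂ := if i + j + 1 = 2 * m then (-1) ^ (i + 1) else 0

theorem neg_one_pow_eq_neg {i j S : ℕ} (h : i + j = 2 * S + 1) : (-1 : ℂ) ^ i = -(-1) ^ j := by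
  rcases Nat.even_or_odd j with hj | hj
  · have hi : Odd i := by
      by_contra h'
      rw [Nat.not_odd_iff_even] at h'
      have := hj.add h'
      rw [Nat.add_comm, h] at this
      exact (Nat.not_even_iff_odd.2 ⟨S, rfl⟩) this
    rw [hj.neg_one_pow, hi.neg_one_pow]
  · have hi : Even i := by
      by_contra h'
      rw [Nat.not_even_iff_odd] at h'
      have := hj.add_odd h'
      rw [Nat.add_comm, h] at this
      exact (Nat.not_even_iff_odd.2 ⟨S, rfl⟩) this
    rw [hj.neg_one_pow, hi.neg_one_pow, neg_neg]

theorem neg_one_pow_eq {i j S : ℕ} (h : i + j = 2 * S) : (-1 : ℂ) ^ i = (-1) ^ j := by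
  have := neg_one_pow_eq_neg (i := i + 1) (j := j) (S := S) (by omega)
  rw [pow_succ] at this
  linear_combination -this

theorem altForm_stdVec {n i j a : ℕ} (hi : 1 ≤ i) (hi' : i ≤ n) (hj : 1 ≤ j) (hj' : j ≤ n) :
    (∑ l ∈ Finset.Icc 2 a, (-1 : ℂ) ^ l • wedge n l (2 * a + 1 - l)) (stdVec n i) (stdVec n j) =
      if 2 ≤ i ∧ 2 ≤ j ∧ i + j = 2 * a + 1 then (-1) ^ i else 0 := by
  rcases Nat.eq_zero_or_pos a with rfl | ha
  · rw [if_neg (by omega)]; simp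
  rw [sum_wedge_stdVec hi hi' hj hj' _ (by omega)]
  simp only [Finset.mem_Icc]
  by_cases h : i + j = 2 * a + 1
  · rw [if_pos h]
    have := neg_one_pow_eq_neg h
    split_ifs <;> first | omega | simp [this]
  · rw [if_neg h, if_neg (by omega)]

/-- Here the chain `ω_1 ∧ ω_{k-1}` common to all models is split off; the remainder `F` vanishes on
`X_1`, so it alone determines `A` and `f`. -/
theorem isTable_of_chain {m t : ℕ} (hm : 4 ≤ m) (ht : 1 ≤ t) (ht' : t < m) {A : ℕ → ℕ → ℂ}
    {f : ℂ} (L : LieLaw (2 * m + 1))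
    {d F : ℕ → (Fin (2 * m + 1) → ℂ) →ₗ[ℂ] (Fin (2 * m + 1) → ℂ) →ₗ[ℂ] ℂ} (hL : L.μ = lawOf d)
    (hd : ∀ k, d k = (if 3 ≤ k ∧ k ≤ 2 * m then wedge (2 * m + 1) 1 (k - 1) else 0) + F k)
    (hF : ∀ k j, 1 ≤ j → j ≤ 2 * m + 1 →
      F k (stdVec (2 * m + 1) 1) (stdVec (2 * m + 1) j) = 0)
    (hee : ∀ k i j, 1 ≤ i → i < 2 * m → 1 ≤ j → j < 2 * m →
      F k (stdVec (2 * m + 1) (i + 1)) (stdVec (2 * m + 1) (j + 1)) =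
        (if k = i + j + 1 ∧ k ≤ 2 * m then A i j else 0) +
          if k = 2 * m + 1 ∧ i + j = 2 * t + 1 then (-1) ^ (i + 1) else 0)
    (hey : ∀ k i, 1 ≤ i → i < 2 * m →
      F k (stdVec (2 * m + 1) (i + 1)) (stdVec (2 * m + 1) (2 * m + 1)) =
        if k = i + 2 * t + 2 ∧ k ≤ 2 * m then f else 0) :
    ∃ (x : L.Alg) (e : ℕ → L.Alg) (y : L.Alg), IsTable m t A f x e y := by
  have h0 : ∀ k i j, 1 ≤ i → i ≤ 2 * m → 1 ≤ j → j ≤ 2 * m + 1 →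
      d k (stdVec (2 * m + 1) (i + 1)) (stdVec (2 * m + 1) (j)) =
        (if 3 ≤ k ∧ k ≤ 2 * m then if k - 1 = i + 1 ∧ j = 1 then -1 else 0 else 0) +
        F k (stdVec (2 * m + 1) (i + 1)) (stdVec (2 * m + 1) j) := by
    intro k i j hi hi' hj hj'
    rw [hd, LinearMap.add_apply, LinearMap.add_apply]
    congr 1
    split_ifs
    · rw [wedge_stdVec (by omega) (by omega) hj hj', if_neg (by omega), if_pos (by omega)]; simp
    · rw [wedge_stdVec (by omega) (by omega) hj hj', if_neg (by omega), if_neg (by omega)]; simp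
    · simp
  refine ⟨_, _, _, isTable_of_forms hm ht ht' L hL ?_ ?_ ?_ ?_⟩
  · intro k j hk hk' hj hj'
    rw [hd, LinearMap.add_apply, LinearMap.add_apply, hF _ _ (by omega) (by omega), add_zero]
    split_ifs with h1 h2 h2
    · rw [wedge_stdVec (by omega) (by omega) (by omega) (by omega), if_pos (by omega),
        if_neg (by omega), sub_zero]
    · rw [wedge_stdVec (by omega) (by omega) (by omega) (by omega), if_neg (by omega),
        if_neg (by omega), sub_zero]
    · omega
    · simp
  · intro k hk hk'
    rw [hd, LinearMap.add_apply, LinearMap.add_apply, hF _ _ (by omega) (by omega), add_zero]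
    split_ifs with h1
    · rw [wedge_stdVec (by omega) (by omega) (by omega) (by omega), if_neg (by omega),
        if_neg (by omega), sub_zero]
    · simp
  · intro k i j hk hk' hi hi' hj hj'
    rw [h0 _ _ _ hi hi'.le (by omega) (by omega), hee _ _ _ hi hi' hj hj',
      if_neg (by omega : ¬ (k - 1 = i + 1 ∧ j + 1 = 1)), ite_self, zero_add]
  · intro k i hk hk' hi hi'
    rw [h0 _ _ _ hi hi'.le (by omega) (by omega), hey _ _ hi hi',
      if_neg (by omega : ¬ (k - 1 = i + 1 ∧ 2 * m + 1 = 1)), ite_self, zero_add]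

theorem isTable_g2 (m t : ℕ) (hm : 4 ≤ m) (ht : 1 ≤ t) (ht' : t + 2 ≤ m) :
    ∃ (x : (lawg2 m t hm ht').Alg) (e : ℕ → (lawg2 m t hm ht').Alg) (y : (lawg2 m t hm ht').Alg),
      IsTable m t (topCoeff m) 0 x e y := by
  refine isTable_of_chain (d := dg2 m t) (F := fun k =>
    (if k = 2 * m then ∑ l ∈ Finset.Icc 2 m, (-1 : ℂ) ^ l • wedge (2 * m + 1) l (2 * m + 1 - l)
      else 0) +
    if k = 2 * m + 1 then
      ∑ l ∈ Finset.Icc 2 (t + 1), (-1 : ℂ) ^ l • wedge (2 * m + 1) l (2 * (t + 1) + 1 - l)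
    else 0) hm ht (by omega) _ rfl ?_ ?_ ?_ ?_
  · intro k
    unfold dg2
    by_cases h1 : 3 ≤ k ∧ k + 1 ≤ 2 * m
    · rw [if_pos h1, if_pos (by omega), if_neg (by omega), if_neg (by omega), add_zero, add_zero]
    rw [if_neg h1]
    by_cases h2 : k = 2 * m
    · rw [if_pos h2, if_pos (by omega), if_pos h2, if_neg (by omega), add_zero, h2]
    by_cases h3 : k = 2 * m + 1
    · rw [if_neg h2, if_pos h3, if_neg (by omega : ¬ (3 ≤ k ∧ k ≤ 2 * m)), if_neg h2, if_pos h3,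
        zero_add, zero_add]
      rfl
    · rw [if_neg h2, if_neg h3, if_neg (by omega : ¬ (3 ≤ k ∧ k ≤ 2 * m)), if_neg h2, if_neg h3,
        zero_add, zero_add]
  · intro k j hj hj'
    split_ifs <;>
    simp only [LinearMap.add_apply, LinearMap.zero_apply, add_zero, zero_add,
      altForm_stdVec (le_refl 1) (by omega : 1 ≤ 2 * m + 1) hj hj'] <;> simp
  · intro k i j hi hi' hj hj'
    split_ifs <;>
    simp only [LinearMap.add_apply, LinearMap.zero_apply, add_zero, zero_add, topCoeff,
      altForm_stdVec (by omega : 1 ≤ i + 1) (by omega : i + 1 ≤ 2 * m + 1)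
        (by omega : 1 ≤ j + 1) (by omega : j + 1 ≤ 2 * m + 1)] <;>
    first | omega | rfl | (split_ifs <;> first | omega | rfl)
  · intro k i hi hi'
    split_ifs <;>
    simp only [LinearMap.add_apply, LinearMap.zero_apply, add_zero, zero_add,
      altForm_stdVec (by omega : 1 ≤ i + 1) (by omega : i + 1 ≤ 2 * m + 1)
        (by omega : 1 ≤ 2 * m + 1) (by omega : 2 * m + 1 ≤ 2 * m + 1)] <;>
    first | omega | rfl | (split_ifs <;> first | omega | rfl)

theorem isTable_g4 (m : ℕ) (hm : 4 ≤ m) :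
    ∃ (x : (lawg4 m hm).Alg) (e : ℕ → (lawg4 m hm).Alg) (y : (lawg4 m hm).Alg),
      IsTable m (m - 1) (fun _ _ => 0) 0 x e y := by
  refine isTable_of_chain (d := dg4 m) (F := fun k =>
    if k = 2 * m + 1 then
      ∑ l ∈ Finset.Icc 2 m, (-1 : ℂ) ^ l • wedge (2 * m + 1) l (2 * m + 1 - l)
    else 0) hm (by omega) (by omega) _ rfl ?_ ?_ ?_ ?_
  · intro k
    unfold dg4
    split_ifs with h1 h2 h3 <;> first | omega | simp
  · intro k j hj hj'
    split_ifs <;>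
    simp only [LinearMap.zero_apply, altForm_stdVec (le_refl 1) (by omega : 1 ≤ 2 * m + 1) hj hj']
    simp
  · intro k i j hi hi' hj hj'
    split_ifs <;>
    simp only [LinearMap.zero_apply, add_zero, zero_add,
      altForm_stdVec (by omega : 1 ≤ i + 1) (by omega : i + 1 ≤ 2 * m + 1)
        (by omega : 1 ≤ j + 1) (by omega : j + 1 ≤ 2 * m + 1)] <;>
    first | omega | rfl | (split_ifs <;> first | omega | rfl)
  · intro k i hi hi'
    split_ifs <;>
    simp only [LinearMap.zero_apply,
      altForm_stdVec (by omega : 1 ≤ i + 1) (by omega : i + 1 ≤ 2 * m + 1)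
        (by omega : 1 ≤ 2 * m + 1) (by omega : 2 * m + 1 ≤ 2 * m + 1)] <;>
    first | omega | rfl | (split_ifs <;> first | omega | rfl)

/-- The part of the structural equations of the exceptional models which does not involve `ω_1`. -/
def exceptionalForm (m : ℕ) (γ : ℂ) (k : ℕ) :
    (Fin (2 * m + 1) → ℂ) →ₗ[ℂ] (Fin (2 * m + 1) → ℂ) →ₗ[ℂ] ℂ :=
  if k + 2 = 2 * m ∨ k = 2 * m + 1 then
    ∑ l ∈ Finset.Icc 2 (m - 1), (-1 : ℂ) ^ l • wedge (2 * m + 1) l (2 * (m - 1) + 1 - l)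
  else if k + 1 = 2 * m then
    (-((m : ℂ) - 2)) • wedge (2 * m + 1) 2 (2 * m + 1)
      + ∑ l ∈ Finset.Icc 2 (m - 1),
          ((-1 : ℂ) ^ l * ((m : ℂ) - l)) • wedge (2 * m + 1) l (2 * m - l)
  else if k = 2 * m then
    (-((m : ℂ) - 2)) • wedge (2 * m + 1) 3 (2 * m + 1)
      + ∑ l ∈ Finset.Icc 3 m,
          ((-1 : ℂ) ^ (l + 1) * (((l : ℂ) - 2) * (2 * (m : ℂ) - 1 - l) / 2)) •
            wedge (2 * m + 1) l (2 * m + 1 - l)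
      + γ • ∑ l ∈ Finset.Icc 2 m, (-1 : ℂ) ^ l • wedge (2 * m + 1) l (2 * m + 1 - l)
  else 0

/-- The sum lists only the pairs with `l < 2m - l`. The formula covers both halves because it is
antisymmetric, `m-1-i` changing sign under `i ↔ 2m-2-i`, and it vanishes in the middle. -/
theorem sum_linear_stdVec {m i j : ℕ} (hm : 4 ≤ m) (hi : 1 ≤ i) (hi' : i ≤ 2 * m) (hj : 1 ≤ j)
    (hj' : j ≤ 2 * m) :
    (∑ l ∈ Finset.Icc 2 (m - 1), ((-1 : ℂ) ^ l * ((m : ℂ) - l)) • wedge (2 * m + 1) l (2 * m - l))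
      (stdVec (2 * m + 1) (i + 1)) (stdVec (2 * m + 1) (j + 1)) =
      if i + j + 2 = 2 * m then (-1) ^ (i + 1) * ((m : ℂ) - 1 - i) else 0 := by
  rw [sum_wedge_stdVec (by omega) (by omega) (by omega) (by omega) _ (by omega)]
  simp only [Finset.mem_Icc]
  by_cases h : i + j + 2 = 2 * m
  · rw [if_pos (by omega), if_pos h]
    have hs := neg_one_pow_eq (i := i) (j := j) (S := m - 1) (by omega)
    have hc : (i : ℂ) + j + 2 = 2 * m := by exact_mod_cast h
    rcases lt_trichotomy (i + 1) m with h1 | h1 | h1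
    · rw [if_pos (by omega), if_neg (by omega)]
      push_cast
      ring
    · rw [if_neg (by omega), if_neg (by omega), ← h1]
      push_cast
      ring
    · rw [if_neg (by omega), if_pos (by omega), pow_succ, pow_succ, hs]
      push_cast
      linear_combination -(-1) ^ j * hc
  · rw [if_neg (by omega), if_neg h]

/-- The product `(i-1)(2m-2-i)` is symmetric under `i ↔ 2m-1-i` while the sign changes. It vanishes
at `i = 1` and `i = 2m-2`, which are the indices not reached by a sum starting at `l = 3`. -/
theorem sum_quadratic_stdVec {m i j : ℕ} (hm : 4 ≤ m) (hi : 1 ≤ i) (hi' : i ≤ 2 * m) (hj : 1 ≤ j)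
    (hj' : j ≤ 2 * m) :
    (∑ l ∈ Finset.Icc 3 m,
        ((-1 : ℂ) ^ (l + 1) * (((l : ℂ) - 2) * (2 * (m : ℂ) - 1 - l) / 2)) •
          wedge (2 * m + 1) l (2 * m + 1 - l))
      (stdVec (2 * m + 1) (i + 1)) (stdVec (2 * m + 1) (j + 1)) =
      if i + j + 1 = 2 * m then (-1) ^ (i + 1) * -(((i : ℂ) - 1) * (2 * (m : ℂ) - 2 - i) / 2)
      else 0 := by
  rw [sum_wedge_stdVec (by omega) (by omega) (by omega) (by omega) _ (by omega)]
  simp only [Finset.mem_Icc]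
  by_cases h : i + j + 1 = 2 * m
  · rw [if_pos (by omega), if_pos h]
    have hs := neg_one_pow_eq_neg (i := i) (j := j) (S := m - 1) (by omega)
    have hc : (j : ℂ) = 2 * m - 1 - i := by
      have : (i : ℂ) + j + 1 = 2 * m := by exact_mod_cast h
      linear_combination this
    by_cases h0 : i = 1
    · subst h0
      rw [if_neg (by omega), if_neg (by omega)]
      simp
    by_cases h1 : i + 1 ≤ m
    · rw [if_pos (by omega), if_neg (by omega), pow_succ]
      push_cast
      ring
    · rw [if_neg (by omega), pow_succ (-1 : ℂ) i, hs]
      by_cases h2 : j = 1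
      · rw [if_neg (by omega)]
        have : (i : ℂ) = 2 * m - 2 := by rw [h2] at hc; push_cast at hc; linear_combination hc
        rw [this]; ring
      · rw [if_pos (by omega), pow_succ, pow_succ]
        push_cast
        rw [hc]
        ring
  · rw [if_neg (by omega), if_neg h]

/-- A single family contains `g3` (`γ = 0`) and `g1` (`m = 4`, `γ = 1`), because the parameter `γ`
only adds a multiple of the alternating form in the top degree of the chain. -/
theorem isTable_exceptional {m : ℕ} (hm : 4 ≤ m) (γ : ℂ) (L : LieLaw (2 * m + 1))
    {d : ℕ → (Fin (2 * m + 1) → ℂ) →ₗ[ℂ] (Fin (2 * m + 1) → ℂ) →ₗ[ℂ] ℂ} (hL : L.μ = lawOf d)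
    (hd : ∀ k, d k = (if 3 ≤ k ∧ k ≤ 2 * m then wedge (2 * m + 1) 1 (k - 1) else 0) +
      exceptionalForm m γ k) :
    ∃ (x : L.Alg) (e : ℕ → L.Alg) (y : L.Alg),
      IsTable m (m - 2) (exceptionalCoeff m γ) (-((m : ℂ) - 2)) x e y := by
  refine isTable_of_chain (d := d) hm (by omega) (by omega) _ hL hd ?_ ?_ ?_
  · intro k j hj hj'
    have hw : ∀ a b, 2 ≤ a → 2 ≤ b →
        wedge (2 * m + 1) a b (stdVec (2 * m + 1) 1) (stdVec (2 * m + 1) j) = 0 := by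
      intro a b ha hb
      rw [wedge_stdVec le_rfl (by omega) hj hj', if_neg (by omega), if_neg (by omega), sub_zero]
    have hs : ∀ p q S, 2 ≤ p → q + 2 ≤ S → ∀ c : ℕ → ℂ,
        (∑ l ∈ Finset.Icc p q, c l • wedge (2 * m + 1) l (S - l)) (stdVec (2 * m + 1) 1)
          (stdVec (2 * m + 1) j) = 0 := by
      intro p q S hp hq c
      rw [LinearMap.sum_apply, LinearMap.sum_apply]
      refine Finset.sum_eq_zero fun l hl => ?_
      rw [Finset.mem_Icc] at hl
      rw [LinearMap.smul_apply, LinearMap.smul_apply, hw _ _ (by omega) (by omega), smul_zero]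
    unfold exceptionalForm
    split_ifs
    · exact hs _ _ _ le_rfl (by omega) _
    · rw [LinearMap.add_apply, LinearMap.add_apply, hs _ _ _ le_rfl (by omega), LinearMap.smul_apply,
        LinearMap.smul_apply, hw _ _ le_rfl (by omega), smul_zero, zero_add]
    · simp only [LinearMap.add_apply, LinearMap.smul_apply]
      rw [hs _ _ _ (by omega) (by omega), hw _ _ (by omega) (by omega),
        hs _ _ _ (by omega) (by omega)]
      simp
    · rfl
  · intro k i j hi hi' hj hj'
    have hi1 : 1 ≤ i + 1 := by omega
    have hi2 : i + 1 ≤ 2 * m + 1 := by omega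
    have hj1 : 1 ≤ j + 1 := by omega
    have hj2 : j + 1 ≤ 2 * m + 1 := by omega
    unfold exceptionalForm exceptionalCoeff
    have hw : ∀ a, wedge (2 * m + 1) a (2 * m + 1) (stdVec (2 * m + 1) (i + 1))
        (stdVec (2 * m + 1) (j + 1)) = if 2 * m + 1 = i + 1 ∧ a = j + 1 then -1 else 0 := by
      intro a
      rw [wedge_stdVec hi1 hi2 hj1 hj2, if_neg (by omega)]
      split_ifs <;> simp
    have hw0 : ∀ a, wedge (2 * m + 1) a (2 * m + 1) (stdVec (2 * m + 1) (i + 1))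
        (stdVec (2 * m + 1) (j + 1)) = 0 := fun a => by rw [hw, if_neg (by omega)]
    split_ifs <;>
    simp only [LinearMap.add_apply, LinearMap.smul_apply, LinearMap.zero_apply, hw0, smul_zero,
      zero_add, add_zero, altForm_stdVec hi1 hi2 hj1 hj2,
      sum_linear_stdVec hm hi hi'.le hj hj'.le, sum_quadratic_stdVec hm hi hi'.le hj hj'.le] <;>
    first
    | omega
    | rfl
    | (split_ifs <;> first | omega | rfl | (simp only [smul_eq_mul]; ring))
  · intro k i hi hi'
    have hi1 : 1 ≤ i + 1 := by omega
    have hi2 : i + 1 ≤ 2 * m + 1 := by omega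
    have hj1 : 1 ≤ 2 * m + 1 := by omega
    have hj2 : 2 * m + 1 ≤ 2 * m + 1 := le_rfl
    have hm1 : 1 ≤ 2 * m := by omega
    have hw : ∀ a, wedge (2 * m + 1) a (2 * m + 1) (stdVec (2 * m + 1) (i + 1))
        (stdVec (2 * m + 1) (2 * m + 1)) = if a = i + 1 then 1 else 0 := by
      intro a
      rw [wedge_stdVec hi1 hi2 hj1 hj2, if_neg (by omega : ¬ (2 * m + 1 = i + 1 ∧ _)), sub_zero]
      simp
    unfold exceptionalForm
    split_ifs <;>
    simp only [LinearMap.add_apply, LinearMap.smul_apply, LinearMap.zero_apply, hw, 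
      altForm_stdVec hi1 hi2 hj1 hj2,
      sum_linear_stdVec hm hi hi'.le hm1 le_rfl, sum_quadratic_stdVec hm hi hi'.le hm1 le_rfl] <;>
    first
    | omega
    | rfl
    | (split_ifs <;> first | omega | rfl | simp)

theorem isTable_g3 (m : ℕ) (hm : 4 ≤ m) :
    ∃ (x : (lawg3 m hm).Alg) (e : ℕ → (lawg3 m hm).Alg) (y : (lawg3 m hm).Alg),
      IsTable m (m - 2) (exceptionalCoeff m 0) (-((m : ℂ) - 2)) x e y := by
  refine isTable_exceptional hm 0 _ (d := dg3 m) rfl fun k => ?_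
  have halt : ∑ j ∈ Finset.Icc 2 (m - 1), (-1 : ℂ) ^ j • wedge (2 * m + 1) j (2 * m - 1 - j) =
      ∑ j ∈ Finset.Icc 2 (m - 1), (-1 : ℂ) ^ j • wedge (2 * m + 1) j (2 * (m - 1) + 1 - j) :=
    Finset.sum_congr rfl fun j _ => by rw [show 2 * (m - 1) + 1 - j = 2 * m - 1 - j by omega]
  unfold dg3 exceptionalForm
  rw [halt]
  by_cases h1 : 3 ≤ k ∧ k + 3 ≤ 2 * m
  · rw [if_pos h1, if_pos (by omega), if_neg (by omega), if_neg (by omega), if_neg (by omega),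
      add_zero]
  rw [if_neg h1]
  by_cases h2 : k + 2 = 2 * m
  · rw [if_pos h2, if_pos (by omega), if_pos (by omega), show k - 1 = 2 * m - 3 by omega]
  rw [if_neg h2]
  by_cases h3 : k + 1 = 2 * m
  · rw [if_pos h3, if_pos (by omega), if_neg (by omega), if_pos h3,
      show k - 1 = 2 * m - 2 by omega]
    module
  rw [if_neg h3]
  by_cases h4 : k = 2 * m
  · rw [if_pos h4, if_pos (by omega), if_neg (by omega), if_neg h3, if_pos h4,
      show k - 1 = 2 * m - 1 by omega]
    module
  rw [if_neg h4]
  by_cases h5 : k = 2 * m + 1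
  · rw [if_pos h5, if_neg (by omega), if_pos (Or.inr h5), zero_add]
  · rw [if_neg h5, if_neg (by omega), if_neg (by omega), if_neg h3, if_neg h4, add_zero]

theorem isTable_g1 : ∃ (x : lawg1.Alg) (e : ℕ → lawg1.Alg) (y : lawg1.Alg),
    IsTable 4 2 (exceptionalCoeff 4 1) (-((4 : ℕ) - 2)) x e y := by
  refine isTable_exceptional le_rfl 1 _ (d := dg1) rfl fun k => ?_
  have h2 : Finset.Icc 2 (4 - 1) = {2, 3} := rfl
  have h3 : Finset.Icc 3 4 = {3, 4} := rfl
  have h4 : Finset.Icc 2 4 = {2, 3, 4} := rfl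
  unfold dg1 exceptionalForm
  rw [h2, h3, h4]
  by_cases hk : k ≤ 9
  · interval_cases k <;> simp <;> module
  · rw [if_neg (by omega), if_neg (by omega), if_neg (by omega), if_neg (by omega),
      if_neg (by omega), if_neg (by omega), if_neg (by omega), if_neg (by omega),
      if_neg (by omega), add_zero]

end Models

/-! ### The Jacobi identity as equations between coefficients. -/

/-- The coefficient of `y` in the bracket `[e i, e j]` of a table. -/
def tableSign (t i j : ℕ) : ℂ := if i + j = 2 * t + 1 then (-1) ^ (i + 1) else 0

theorem tableSign_of_ne {t i j : ℕ} (h : i + j ≠ 2 * t + 1) : tableSign t i j = 0 := if_neg h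

/-- The relations between the coefficients of a table imposed by the axioms of a Lie algebra. -/
structure TableRel (m t : ℕ) (A : ℕ → ℕ → ℂ) (f : ℂ) : Prop where
  anti : ∀ i j, 1 ≤ i → 1 ≤ j → i + j < 2 * m → A i j = -A j i
  der : ∀ i j, 1 ≤ i → 1 ≤ j → i + j + 1 < 2 * m → A (i + 1) j + A i (j + 1) = A i j
  jac : ∀ i j k, 1 ≤ i → 1 ≤ j → 1 ≤ k → i + j + k < 2 * m →
    A j k * A i (j + k) + tableSign t j k * f =
      A i j * A (i + j) k - tableSign t i j * f + (A i k * A j (i + k) + tableSign t i k * f)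
  jac_y : ∀ i j, 1 ≤ i → 1 ≤ j → i + j + (2 * t + 1) < 2 * m →
    f * A i (j + (2 * t + 1)) = A i j * f + f * A j (i + (2 * t + 1))

section

variable {𝔤 : Type*} [LieRing 𝔤] [LieAlgebra ℂ 𝔤] {m t : ℕ} {A : ℕ → ℕ → ℂ} {f : ℂ}
  {x : 𝔤} {e : ℕ → 𝔤} {y : 𝔤}

namespace IsTable

variable (h : IsTable m t A f x e y)
include h

theorem lie_e_e (i j : ℕ) (hi : 1 ≤ i) (hj : 1 ≤ j) :
    ⁅e i, e j⁆ = A i j • e (i + j) + tableSign t i j • y := by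
  rw [h.ee i j hi hj, tableSign]
  split_ifs <;> simp

theorem exists_functional {n : ℕ} (h1 : 1 ≤ n) (h2 : n < 2 * m) :
    ∃ ξ : 𝔤 →ₗ[ℂ] ℂ, ξ (e n) = 1 ∧ ξ y = 0 := by
  refine ⟨h.basis.coord ⟨n, by omega⟩, ?_, ?_⟩
  · have he := congrArg h.basis.repr (h.basis_mid (i := ⟨n, by omega⟩) h1 h2)
    rw [Module.Basis.coord_apply, ← he]
    simp
  · have hy := congrArg h.basis.repr h.basis_last
    rw [Module.Basis.coord_apply, ← hy, Module.Basis.repr_self, Finsupp.single_eq_of_ne]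
    intro hn
    have := congrArg Fin.val hn
    simp at this
    omega

/-- Each relation is the coefficient of one chain vector in antisymmetry or in a Leibniz identity.
The functional that reads it off kills `y`, so a possible contribution in the degree of `y`
disappears. -/
theorem tableRel : TableRel m t A f := by
  have hs : ∀ i j k, 1 ≤ i → tableSign t j k • ⁅e i, y⁆ = (tableSign t j k * f) • e (i + j + k) := by
    intro i j k hi
    unfold tableSign
    split_ifs with hjk
    · rw [h.ey i hi, smul_smul, ← hjk, Nat.add_assoc]
    · simp
  constructor
  · intro i j hi hj hij
    obtain ⟨ξ, h1, h2⟩ := h.exists_functional (n := i + j) (by omega) hij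
    have := congrArg ξ (lie_skew (e i) (e j))
    rw [h.lie_e_e i j hi hj, h.lie_e_e j i hj hi, Nat.add_comm j i] at this
    simp only [map_neg, map_add, map_smul, h1, h2, smul_eq_mul, mul_one, mul_zero, add_zero] at this
    exact this.symm
  · intro i j hi hj hij
    obtain ⟨ξ, h1, h2⟩ := h.exists_functional (n := i + j + 1) (by omega) hij
    have := congrArg ξ (leibniz_lie x (e i) (e j))
    rw [h.lie_e_e i j hi hj, h.xe i hi, h.xe j hj, h.lie_e_e _ j (by omega) hj,
      h.lie_e_e i _ hi (by omega), lie_add, lie_smul, lie_smul, h.xy, h.xe _ (by omega),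
      show i + 1 + j = i + j + 1 by omega, show i + (j + 1) = i + j + 1 by omega] at this
    simp only [map_add, map_smul, h1, h2, smul_eq_mul, mul_one, mul_zero, add_zero, map_zero] at this
    exact this.symm
  · intro i j k hi hj hk hijk
    obtain ⟨ξ, h1, h2⟩ := h.exists_functional (n := i + j + k) (by omega) hijk
    have := congrArg ξ (leibniz_lie (e i) (e j) (e k))
    rw [h.lie_e_e j k hj hk, h.lie_e_e i j hi hj, h.lie_e_e i k hi hk, lie_add, lie_smul, lie_smul,
      hs i j k hi, add_lie, smul_lie, smul_lie, ← lie_skew y, smul_neg, hs k i j hk, lie_add,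
      lie_smul, lie_smul, hs j i k hj, h.lie_e_e i (j + k) hi (by omega),
      h.lie_e_e (i + j) k (by omega) hk, h.lie_e_e j (i + k) hj (by omega),
      show i + (j + k) = i + j + k by omega, show k + i + j = i + j + k by omega,
      show j + (i + k) = i + j + k by omega, show j + i + k = i + j + k by omega] at this
    simp only [map_add, map_smul, map_neg, h1, h2, smul_eq_mul, mul_one, mul_zero, add_zero] at this
    linear_combination this
  · intro i j hi hj hij
    obtain ⟨ξ, h1, h2⟩ := h.exists_functional (n := i + j + (2 * t + 1)) (by omega) hij
    have := congrArg ξ (leibniz_lie (e i) (e j) y)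
    rw [h.ey j hj, h.lie_e_e i j hi hj, h.ey i hi, lie_smul, lie_smul, add_lie, smul_lie, smul_lie,
      lie_self, h.ey (i + j) (by omega), h.lie_e_e i _ hi (by omega), h.lie_e_e j _ hj (by omega),
      show i + (j + (2 * t + 1)) = i + j + (2 * t + 1) by omega,
      show j + (i + (2 * t + 1)) = i + j + (2 * t + 1) by omega] at this
    simp only [map_add, map_smul, h1, h2, smul_eq_mul, mul_one, mul_zero, add_zero, smul_zero] at this
    linear_combination this

end IsTable
end

/-! ### Solving the equations degree by degree. -/

namespace TableRel

variable {m t : ℕ} {A : ℕ → ℕ → ℂ} {f : ℂ} (R : TableRel m t A f)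
include R

theorem diag_eq_zero {i : ℕ} (hi : 1 ≤ i) (h : i + i < 2 * m) : A i i = 0 := by
  have := R.anti i i hi hi h
  linear_combination (1 / 2) * this

/-- The derivation rule is a first order recursion in `i` along each degree. After removal of the
alternating sign it says that the new coefficients form a discrete antiderivative of the old ones,
with constant `A 1 S`. -/
theorem next_degree {S : ℕ} (hS : S + 1 < 2 * m) {g G : ℕ → ℂ}
    (hA : ∀ i j, 1 ≤ i → 1 ≤ j → i + j = S → A i j = (-1) ^ (i + 1) * g i)
    (hG : ∀ i, 1 ≤ i → G i - G (i + 1) = g i) (h1 : G 1 = A 1 S) :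
    ∀ i j, 1 ≤ i → 1 ≤ j → i + j = S + 1 → A i j = (-1) ^ (i + 1) * G i := by
  intro i j hi
  induction i, hi using Nat.le_induction generalizing j with
  | base =>
    intro hj hij
    obtain rfl : j = S := by omega
    rw [← h1]; norm_num
  | succ i hi ih =>
    intro hj hij
    have h2 := ih (j + 1) (by omega) (by omega)
    have h3 := R.der i j hi hj (by omega)
    rw [hA i j hi hj (by omega)] at h3
    have h4 := hG i hi
    rw [pow_succ]
    linear_combination h3 - h2 - (-1) ^ (i + 1) * h4

theorem first_degree {S : ℕ} (hS : S + 1 < 2 * m)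
    (hA : ∀ i j, 1 ≤ i → 1 ≤ j → i + j = S → A i j = 0) :
    ∀ i j, 1 ≤ i → 1 ≤ j → i + j = S + 1 → A i j = (-1) ^ (i + 1) * A 1 S :=
  R.next_degree hS (g := fun _ => 0) (G := fun _ => A 1 S)
    (fun i j hi hj hij => by rw [hA i j hi hj hij, mul_zero]) (fun _ _ => sub_self _) rfl

/-- In the lowest possibly nonzero degree the coefficients have constant absolute value, but in even
degree the diagonal entry `A p p` is zero. -/
theorem zero_of_even {p : ℕ} (hp : 1 ≤ p) (hS : 2 * p < 2 * m)
    (hA : ∀ i j, 1 ≤ i → 1 ≤ j → i + j + 1 = 2 * p → A i j = 0) :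
    ∀ i j, 1 ≤ i → 1 ≤ j → i + j = 2 * p → A i j = 0 := by
  have h1 := R.first_degree (S := 2 * p - 1) (by omega)
    (fun i j hi hj hij => hA i j hi hj (by omega))
  have h2 := h1 p p hp hp (by omega)
  rw [R.diag_eq_zero hp (by omega)] at h2
  have h3 : A 1 (2 * p - 1) = 0 := by
    have := mul_eq_zero.1 h2.symm
    exact this.resolve_left (pow_ne_zero _ (by norm_num))
  intro i j hi hj hij
  rw [h1 i j hi hj (by omega), h3, mul_zero]

/-- The coefficients in degree `2p+2`, if those of degree `2p` vanish. -/
theorem second_degree {p : ℕ} (hS : 2 * p + 2 < 2 * m)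
    (hA : ∀ i j, 1 ≤ i → 1 ≤ j → i + j = 2 * p → A i j = 0) :
    ∀ i j, 1 ≤ i → 1 ≤ j → i + j = 2 * p + 2 →
      A i j = (-1) ^ (i + 1) * (((p : ℂ) + 1 - i) * A 1 (2 * p)) := by
  have h1 := R.first_degree (S := 2 * p) (by omega) hA
  have h2 := R.next_degree (S := 2 * p + 1) (by omega) h1
    (G := fun i => A 1 (2 * p + 1) - ((i : ℂ) - 1) * A 1 (2 * p))
    (fun i _ => by push_cast; ring) (by push_cast; ring)
  -- Vanishing of the diagonal entry determines the constant of integration.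
  have h3 := h2 (p + 1) (p + 1) (by omega) (by omega) (by omega)
  rw [R.diag_eq_zero (by omega) (by omega)] at h3
  have h4 := (mul_eq_zero.1 h3.symm).resolve_left (pow_ne_zero _ (by norm_num))
  push_cast at h4
  intro i j hi hj hij
  rw [h2 i j hi hj (by omega)]
  linear_combination (-1) ^ (i + 1) * h4

/-- The consequence of the Jacobi identity in the lowest degree `2p+1` with a nonzero coefficient. -/
theorem sq_lowest {p : ℕ} (hp : 2 ≤ p) (hS : 2 * p + 2 < 2 * m) (h12 : A 1 2 = 0)
    (h0 : A 1 (2 * p - 1) = 0)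
    (hA : ∀ i j, 1 ≤ i → 1 ≤ j → i + j = 2 * p → A i j = 0) :
    p * A 1 (2 * p) ^ 2 = tableSign t 1 2 * f + tableSign t 2 (2 * p - 1) * f := by
  have h1 := R.first_degree (S := 2 * p) (by omega) hA
  have h2 := R.second_degree hS hA
  -- The product `A 2 (2p-1) * A 1 (2p+1)` is `-α` times `pα`, where `α = A 1 (2p)`; the other
  -- products vanish by `h12` and `h0`.
  have h3 := R.jac 1 2 (2 * p - 1) le_rfl (by omega) (by omega) (by omega)
  rw [h12, h0, tableSign_of_ne (by omega : 1 + (2 * p - 1) ≠ 2 * t + 1),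
    h1 2 (2 * p - 1) (by omega) (by omega) (by omega),
    h2 1 (2 + (2 * p - 1)) (by omega) (by omega) (by omega)] at h3
  push_cast at h3
  linear_combination -h3

/-- Vanishing up to degree `2p+1`, if no degree interferes. -/
theorem zero_below (h12 : A 1 2 = 0) {n : ℕ} (hn : n + 1 < 2 * m)
    (hf : ∀ p, 2 ≤ p → 2 * p + 1 ≤ n →
      tableSign t 1 2 * f + tableSign t 2 (2 * p - 1) * f = 0) :
    ∀ i j, 1 ≤ i → 1 ≤ j → i + j ≤ n → A i j = 0 := by
  induction n with
  | zero => intro i j hi hj hij; omega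
  | succ n ih =>
    have ih := ih (by omega) fun p hp hpn => hf p hp (by omega)
    intro i j hi hj hij
    rcases Nat.lt_or_ge (i + j) (n + 1) with hlt | hge
    · exact ih i j hi hj (by omega)
    obtain hn1 : i + j = n + 1 := by omega
    rcases Nat.even_or_odd' (n + 1) with ⟨p, hp | hp⟩
    · exact R.zero_of_even (p := p) (by omega) (by omega)
        (fun i j hi hj hij => ih i j hi hj (by omega)) i j hi hj (by omega)
    · have h1 := R.first_degree (S := 2 * p) (by omega)
        (fun i j hi hj hij => ih i j hi hj (by omega))
      rw [h1 i j hi hj (by omega)]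
      rcases Nat.lt_or_ge p 2 with hp2 | hp2
      · obtain rfl : p = 1 := by omega
        rw [show 2 * 1 = 2 from rfl, h12, mul_zero]
      · have := R.sq_lowest hp2 (by omega) h12 (ih _ _ (by omega) (by omega) (by omega))
          (fun i j hi hj hij => ih i j hi hj (by omega))
        rw [hf p hp2 (by omega)] at this
        have hp0 : (p : ℂ) ≠ 0 := by exact_mod_cast (by omega : p ≠ 0)
        have h2 := (mul_eq_zero.1 this).resolve_left hp0
        rw [pow_eq_zero_iff (by norm_num)] at h2
        rw [h2, mul_zero]

theorem zero_below_top (h12 : A 1 2 = 0) (hf : f = 0) :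
    ∀ i j, 1 ≤ i → 1 ≤ j → i + j + 1 < 2 * m → A i j = 0 := by
  intro i j hi hj hij
  exact R.zero_below h12 (n := i + j) hij (fun p _ _ => by rw [hf]; ring) i j hi hj le_rfl

/-- With `α = A 1 4`, degree six gives `f = 2α²`, and the Jacobi identity for `e_1, e_2, y` gives
`3fα = 0`. -/
theorem f_eq_zero_of_t_eq_one (hm : 4 ≤ m) (ht : t = 1) (h12 : A 1 2 = 0) : f = 0 := by
  have h4 := R.zero_below h12 (n := 4) (by omega) (fun p hp hp' => by omega)
  have h4' : ∀ i j, 1 ≤ i → 1 ≤ j → i + j = 2 * 2 → A i j = 0 :=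
    fun i j hi hj hij => h4 i j hi hj (by omega)
  have h5 := R.sq_lowest (p := 2) le_rfl (by omega) h12 (h4 _ _ (by omega) (by omega) (by omega)) h4'
  rw [tableSign_of_ne (by omega : 2 + (2 * 2 - 1) ≠ 2 * t + 1), tableSign, if_pos (by omega)] at h5
  have h6 := R.second_degree (p := 2) (by omega) h4'
  have h7 := R.jac_y 1 2 le_rfl (by omega) (by omega)
  rw [h12, h6 1 _ (by omega) (by omega) (by omega), h6 2 _ (by omega) (by omega) (by omega)] at h7
  norm_num at h5 h7
  have h8 : f * A 1 4 = 0 := by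
    have : f * (A 1 4 * 3) = 0 := by linear_combination h7
    linear_combination (1 / 3) * this
  have h9 : f ^ 2 = 0 := by linear_combination (-f) * h5 + 2 * A 1 4 * h8
  exact pow_eq_zero_iff (by norm_num) |>.1 h9

theorem zero_below_y (ht : 2 ≤ t) (htm : t < m) (h12 : A 1 2 = 0) :
    ∀ i j, 1 ≤ i → 1 ≤ j → i + j ≤ 2 * t → A i j = 0 :=
  R.zero_below h12 (by omega) fun p hp hp' => by
    rw [tableSign_of_ne (by omega), tableSign_of_ne (by omega)]; ring

/-- This is `sq_lowest` in the degree `2t+1` of `y`, the first degree where the term with `f` enters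
when `t ≥ 2`. -/
theorem f_eq (ht : 2 ≤ t) (htm : t + 2 ≤ m) (h12 : A 1 2 = 0) : f = -(t * A 1 (2 * t) ^ 2) := by
  have h0 := R.zero_below_y ht (by omega) h12
  have := R.sq_lowest ht (by omega) h12 (h0 _ _ (by omega) (by omega) (by omega))
    (fun i j hi hj hij => h0 i j hi hj (by omega))
  rw [tableSign_of_ne (by omega), tableSign, if_pos (by omega)] at this
  linear_combination this

theorem third_degree (ht : 2 ≤ t) (htm : t + 2 ≤ m) (h12 : A 1 2 = 0) :
    ∀ i j, 1 ≤ i → 1 ≤ j → i + j = 2 * t + 3 → A i j = (-1) ^ (i + 1) *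
      (A 1 (2 * t + 2) - A 1 (2 * t) * (((i : ℂ) - 1) * (2 * t + 2 - i) / 2)) := by
  have h0 := R.zero_below_y ht (by omega) h12
  have h1 := R.second_degree (p := t) (by omega) (fun i j hi hj hij => h0 i j hi hj (by omega))
  exact R.next_degree (S := 2 * t + 2) (by omega) h1
    -- The quadratic is the antiderivative, zero at `i = 1`, of the linear coefficients `t + 1 - i`
    -- of the previous degree.
    (G := fun i => A 1 (2 * t + 2) - A 1 (2 * t) * (((i : ℂ) - 1) * (2 * t + 2 - i) / 2))
    (fun i _ => by push_cast; ring) (by push_cast; ring)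

/-- The Jacobi identity for `e_1, e_2, e_{2t}`, in degree `2t+3`, after elimination of `f` by
`f_eq`. It is what makes `t = 2` special. -/
theorem gamma_mul (ht : 2 ≤ t) (htm : t + 2 ≤ m) (h12 : A 1 2 = 0) :
    ((t : ℂ) - 2) * (A 1 (2 * t) * A 1 (2 * t + 2)) = 0 := by
  have h0 := R.zero_below_y ht (by omega) h12
  have h1 := R.second_degree (p := t) (by omega) (fun i j hi hj hij => h0 i j hi hj (by omega))
  have h2 := R.third_degree ht htm h12
  have hf := R.f_eq ht htm h12
  have h3 := R.jac 1 2 (2 * t) le_rfl (by omega) (by omega) (by omega)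
  rw [h12, tableSign_of_ne (by omega : 2 + 2 * t ≠ 2 * t + 1),
    tableSign_of_ne (by omega : 1 + 2 ≠ 2 * t + 1), tableSign, if_pos (by omega),
    h1 2 (2 * t) (by omega) (by omega) (by omega),
    h2 2 (1 + 2 * t) (by omega) (by omega) (by omega), Nat.add_comm 2 (2 * t), hf] at h3
  push_cast at h3
  linear_combination -h3

/-- When `t + 3 ≤ m` the degree `2t+4` is also available. If `α = A 1 (2t)` were nonzero, then so
would be `f`; the diagonal entry of that degree and the Jacobi identity for `e_1, e_2, y` would then
determine `A 1 (2t+2)` as a nonzero multiple of `α`, which by `gamma_mul` is possible only for `t =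
2`. That case is excluded by a Jacobi identity in degree eight. -/
theorem alpha_eq_zero (ht : 2 ≤ t) (htm : t + 3 ≤ m) (h12 : A 1 2 = 0) : A 1 (2 * t) = 0 := by
  by_contra hα
  have ht0 : (t : ℂ) ≠ 0 := by exact_mod_cast (by omega : t ≠ 0)
  have ht1 : (t : ℂ) + 1 ≠ 0 := by exact_mod_cast (by omega : t + 1 ≠ 0)
  have ht2 : 2 * (t : ℂ) + 1 ≠ 0 := by exact_mod_cast (by omega : 2 * t + 1 ≠ 0)
  have h0 := R.zero_below_y ht (by omega) h12
  have h1 := R.second_degree (p := t) (by omega) (fun i j hi hj hij => h0 i j hi hj (by omega))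
  have h2 := R.third_degree ht (by omega) h12
  have hf := R.f_eq ht (by omega) h12
  have hf0 : f ≠ 0 := by
    rw [hf]
    exact neg_ne_zero.2 (mul_ne_zero ht0 (pow_ne_zero 2 hα))
  have h3 := R.next_degree (S := 2 * t + 3) (by omega) h2
    -- The cubic is one more discrete antiderivative, that of the coefficients in `third_degree`.
    (G := fun i => A 1 (2 * t + 3) - ((i : ℂ) - 1) * A 1 (2 * t + 2) +
      A 1 (2 * t) * (((i : ℂ) - 1) * (i - 2) * (3 * t + 3 - i) / 6))
    (fun i _ => by push_cast; ring) (by push_cast; ring)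
  have h4 := h3 (t + 2) (t + 2) (by omega) (by omega) (by omega)
  rw [R.diag_eq_zero (by omega) (by omega)] at h4
  have h5 := (mul_eq_zero.1 h4.symm).resolve_left (pow_ne_zero _ (by norm_num))
  push_cast at h5
  have h6 := R.jac_y 1 2 le_rfl (by omega) (by omega)
  rw [h12, zero_mul, zero_add] at h6
  have h7 := mul_left_cancel₀ hf0 h6
  rw [h3 2 _ (by omega) (by omega) (by omega), show 2 + (2 * t + 1) = 2 * t + 3 by omega] at h7
  push_cast at h7
  have h8 : A 1 (2 * t + 2) = A 1 (2 * t) * (t * (t + 1) / 3) := by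
    apply mul_left_cancel₀ ht2
    linear_combination h7 - 2 * h5
  have h9 := R.gamma_mul ht (by omega) h12
  rw [h8] at h9
  have h10 : (t : ℂ) = 2 := by
    have e1 : ((t : ℂ) - 2) * (A 1 (2 * t) ^ 2 * (t * (t + 1))) = 0 := by
      linear_combination 3 * h9
    have := (mul_eq_zero.1 e1).resolve_right
      (mul_ne_zero (pow_ne_zero 2 hα) (mul_ne_zero ht0 ht1))
    exact sub_eq_zero.1 this
  obtain rfl : t = 2 := by exact_mod_cast h10
  -- With `A 1 6 = 2α` and `A 1 7 = α` the left side vanishes, since `A 2 5 = 0`, while the right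
  -- side is `A 1 5 * A 2 6 = 2α²`.
  have h11 := R.jac 1 2 5 le_rfl (by omega) (by omega) (by omega)
  rw [h12, tableSign_of_ne (by omega), tableSign_of_ne (by omega), tableSign_of_ne (by omega),
    h2 2 5 (by omega) (by omega) (by omega), h1 1 5 (by omega) (by omega) (by omega),
    h3 2 (1 + 5) (by omega) (by omega) (by omega)] at h11
  norm_num at h7 h8 h11
  rw [h8] at h7 h11
  have h12 : A 1 7 = A 1 4 := by linear_combination (1 / 2) * h7
  rw [h12] at h11
  norm_num at h11
  apply hα
  rcases h11 with h11 | h11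
  · exact h11
  · linear_combination h11

end TableRel

/-! ### Changes of basis of a table. -/

section

variable {𝔤 : Type*} [LieRing 𝔤] [LieAlgebra ℂ 𝔤] {m t : ℕ} {A : ℕ → ℕ → ℂ} {f : ℂ}
  {x : 𝔤} {e : ℕ → 𝔤} {y : 𝔤}

namespace IsTable

section

variable (h : IsTable m t A f x e y)
include h

theorem congr {A' : ℕ → ℕ → ℂ} (hA : ∀ i j, 1 ≤ i → 1 ≤ j → i + j < 2 * m → A i j = A' i j) :
    IsTable m t A' f x e y where
  four_le := h.four_le
  one_le := h.one_le
  lt := h.lt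
  zero := h.zero
  xe := h.xe
  xy := h.xy
  ee i j hi hj := by
    rw [h.ee i j hi hj]
    by_cases hij : i + j < 2 * m
    · rw [hA i j hi hj hij]
    · rw [h.zero _ (by omega), smul_zero, smul_zero]
  ey := h.ey
  span := h.span
  dim := h.dim

/-- Since `x` is kept, the chain must be scaled uniformly; `y`, being quadratic in the chain, scales
by `q²`. -/
theorem scale {q : ℂ} (hq : q ≠ 0) :
    IsTable m t (fun i j => q * A i j) (q ^ 2 * f) x (fun j => q • e j) (q ^ 2 • y) where
  four_le := h.four_le
  one_le := h.one_le
  lt := h.lt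
  zero j hj := by rw [h.zero j hj, smul_zero]
  xe j hj := by rw [lie_smul, h.xe j hj]
  xy := by rw [lie_smul, h.xy, smul_zero]
  ee i j hi hj := by
    rw [lie_smul, smul_lie, h.ee i j hi hj]
    split_ifs <;> module
  ey j hj := by
    rw [lie_smul, smul_lie, h.ey j hj]
    module
  span := by
    rw [eq_top_iff, ← h.span, Submodule.span_le]
    rintro z ((rfl | rfl) | ⟨j, hj, rfl⟩)
    · exact Submodule.subset_span (by simp)
    · rw [SetLike.mem_coe, ← Submodule.smul_mem_iff _ (pow_ne_zero 2 hq)]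
      exact Submodule.subset_span (by simp)
    · rw [SetLike.mem_coe, ← Submodule.smul_mem_iff _ hq]
      exact Submodule.subset_span (Or.inr ⟨j, hj, rfl⟩)
  dim := h.dim

/-- When `y` sits in the top degree, the brackets of that degree are all multiples of one vector `c
e_{2m-1} + y`, which becomes the new `y`. -/
theorem shift (ht : t = m - 1) {c : ℂ}
    (hA : ∀ i j, 1 ≤ i → 1 ≤ j → i + j < 2 * m - 1 → A i j = 0)
    (hA' : ∀ i j, 1 ≤ i → 1 ≤ j → i + j = 2 * m - 1 → A i j = (-1) ^ (i + 1) * c) :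
    IsTable m t (fun _ _ => 0) 0 x e (c • e (2 * m - 1) + y) where
  four_le := h.four_le
  one_le := h.one_le
  lt := h.lt
  zero := h.zero
  xe := h.xe
  xy := by
    have hm := h.four_le
    rw [lie_add, lie_smul, h.xe _ (by omega), h.xy, h.zero _ (by omega), smul_zero, add_zero]
  ee i j hi hj := by
    have hm := h.four_le
    rw [h.ee i j hi hj, zero_smul, zero_add]
    rcases lt_trichotomy (i + j) (2 * m - 1) with hij | hij | hij
    · rw [hA i j hi hj hij, if_neg (by omega), if_neg (by omega), zero_smul, add_zero]
    · rw [hA' i j hi hj hij, if_pos (by omega), if_pos (by omega), hij]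
      module
    · rw [h.zero _ (by omega), if_neg (by omega), if_neg (by omega), smul_zero, add_zero]
  ey j hj := by
    have hm := h.four_le
    rw [lie_add, lie_smul, h.ey j hj, h.ee j _ hj (by omega), if_neg (by omega),
      h.zero (j + (2 * m - 1)) (by omega), h.zero (j + (2 * t + 1)) (by omega)]
    simp
  span := by
    have hm := h.four_le
    have he : ∀ j, 1 ≤ j → e j ∈ Submodule.span ℂ
        ({x, c • e (2 * m - 1) + y} ∪ e '' {j | 1 ≤ j}) :=
      fun j hj => Submodule.subset_span (Or.inr ⟨j, hj, rfl⟩)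
    rw [eq_top_iff, ← h.span, Submodule.span_le]
    rintro z ((rfl | rfl) | ⟨j, hj, rfl⟩)
    · exact Submodule.subset_span (by simp)
    · have h1 : c • e (2 * m - 1) + z ∈ Submodule.span ℂ
          ({x, c • e (2 * m - 1) + z} ∪ e '' {j | 1 ≤ j}) := Submodule.subset_span (by simp)
      have := sub_mem h1 (Submodule.smul_mem _ c (he (2 * m - 1) (by omega)))
      simpa using this
    · exact he j hj
  dim := h.dim

end

/-- The new generators are `x + u e_1` and `q e_1`. As `[e_1, e_4] = e_5 + y` and `[e_1, e_5 + y] =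
0`, the new chain is computed explicitly; closing up the table in degree six requires `q = 1 + 3u`,
and `γ` turns into `qγ / (1 + uγ)`. -/
theorem base_change {γ : ℂ} (h : IsTable 4 2 (exceptionalCoeff 4 γ) (-(((4 : ℕ) : ℂ) - 2)) x e y)
    (h0 : γ ≠ 0) (h3 : γ ≠ 3) :
    ∃ (x' : 𝔤) (e' : ℕ → 𝔤) (y' : 𝔤),
      IsTable 4 2 (exceptionalCoeff 4 1) (-(((4 : ℕ) : ℂ) - 2)) x' e' y' := by
  -- Solution of `qγ = 1 + uγ` with `q = 1 + 3u`, so that the new parameter is one.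
  obtain ⟨u, hu⟩ : ∃ u : ℂ, 2 * u * γ = 1 - γ := ⟨(1 - γ) / (2 * γ), by field_simp⟩
  obtain ⟨q, hq⟩ : ∃ q : ℂ, q = 1 + 3 * u := ⟨_, rfl⟩
  -- `q = 0` means `u = -1/3`, which corresponds to `γ = 3`.
  have hq0 : q ≠ 0 := by
    rintro rfl
    apply h3
    linear_combination 2 * γ * hq + 3 * hu
  have hqγ : q * γ = 1 + u * γ := by rw [hq]; linear_combination hu
  have hz : ∀ i j, 1 ≤ i → 1 ≤ j → 8 ≤ i + j → ⁅e i, e j⁆ = 0 := by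
    intro i j hi hj hij
    rw [h.ee i j hi hj, h.zero _ (by omega), if_neg (by omega), smul_zero, add_zero]
  have hzy : ∀ i, 3 ≤ i → ⁅e i, y⁆ = 0 := by
    intro i hi
    rw [h.ey i (by omega), h.zero _ (by omega), smul_zero]
  have x1 := h.xe 1 le_rfl
  have x2 := h.xe 2 (by omega)
  have x3 := h.xe 3 (by omega)
  have x4 := h.xe 4 (by omega)
  have x5 := h.xe 5 (by omega)
  have x6 := h.xe 6 (by omega)
  have x7 := h.xe 7 (by omega)
  have z8 := h.zero 8 le_rfl
  have b12 := h.ee 1 2 (by omega) (by omega)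
  have b13 := h.ee 1 3 (by omega) (by omega)
  have b14 := h.ee 1 4 (by omega) (by omega)
  have b15 := h.ee 1 5 (by omega) (by omega)
  have b16 := h.ee 1 6 (by omega) (by omega)
  have b23 := h.ee 2 3 (by omega) (by omega)
  have b24 := h.ee 2 4 (by omega) (by omega)
  have b25 := h.ee 2 5 (by omega) (by omega)
  have b34 := h.ee 3 4 (by omega) (by omega)
  have y1 := h.ey 1 (by omega)
  have y2 := h.ey 2 (by omega)
  norm_num [exceptionalCoeff] at x1 x2 x3 x4 x5 x6 x7 b12 b13 b14 b15 b16 b23 b24 b25 b34 y1 y2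
  have xy := h.xy
  let e' : ℕ → 𝔤 := fun j => if j ≤ 4 then q • e j else if j = 5 then q • (e 5 + u • (e 5 + y))
    else if j = 6 then q ^ 2 • e 6 else if j = 7 then (q ^ 3 * γ) • e 7 else 0
  have e1 : e' 1 = q • e 1 := by simp [e']
  have e2 : e' 2 = q • e 2 := by simp [e']
  have e3 : e' 3 = q • e 3 := by simp [e']
  have e4 : e' 4 = q • e 4 := by simp [e']
  have e5 : e' 5 = q • (e 5 + u • (e 5 + y)) := by simp [e']
  have e6 : e' 6 = q ^ 2 • e 6 := by simp [e']
  have e7 : e' 7 = (q ^ 3 * γ) • e 7 := by simp [e']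
  have e8 : ∀ j, 8 ≤ j → e' j = 0 := fun j hj => by
    simp only [e']
    rw [if_neg (by omega), if_neg (by omega), if_neg (by omega), if_neg (by omega)]
  -- This choice is forced by `[e' 1, e' 4] = e' 5 + y'`.
  obtain ⟨y', hy'⟩ : ∃ y', y' = q ^ 2 • (e 5 + y) - e' 5 := ⟨_, rfl⟩
  obtain ⟨x', hx'⟩ : ∃ x', x' = x + u • e 1 := ⟨_, rfl⟩
  have hlt : ∀ i j, 1 ≤ i → i < j → ⁅e' i, e' j⁆ = exceptionalCoeff 4 1 i j • e' (i + j) +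
      if i + j = 2 * 2 + 1 then (-1 : ℂ) ^ (i + 1) • y' else 0 := by
    intro i j hi hij
    by_cases hj : 8 ≤ i + j
    · rw [e8 _ hj, if_neg (by omega), smul_zero, add_zero]
      have hz5 : ∀ k, 3 ≤ k → ⁅e k, e' 5⁆ = 0 := fun k hk => by
        rw [e5, lie_smul, lie_add, lie_smul, lie_add, hz k 5 (by omega) (by omega) (by omega),
          hzy k hk]
        simp
      have hs : ∀ k, k ≠ 5 → ∃ c : ℂ, e' k = c • e k := fun k hk => by
        by_cases h8 : 8 ≤ k
        · exact ⟨0, by rw [e8 k h8, zero_smul]⟩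
        · interval_cases k
          · exact ⟨q, by simp [e']⟩
          · exact ⟨_, e1⟩
          · exact ⟨_, e2⟩
          · exact ⟨_, e3⟩
          · exact ⟨_, e4⟩
          · exact absurd rfl hk
          · exact ⟨_, e6⟩
          · exact ⟨_, e7⟩
      by_cases hi5 : i = 5
      · obtain ⟨c, hc⟩ := hs j (by omega)
        rw [hi5, hc, lie_smul, ← lie_skew, hz5 j (by omega), neg_zero, smul_zero]
      · obtain ⟨d, hd⟩ := hs i hi5
        by_cases hj5 : j = 5
        · rw [hj5, hd, smul_lie, hz5 i (by omega), smul_zero]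
        · obtain ⟨c, hc⟩ := hs j hj5
          rw [hc, hd, smul_lie, lie_smul, hz i j hi (by omega) hj, smul_zero, smul_zero]
    · have hj7 : j < 7 := by omega
      have hi4 : i < 4 := by omega
      interval_cases i <;> interval_cases j <;> first | omega | skip
      · rw [e1, e2, lie_smul, smul_lie, b12]; norm_num [exceptionalCoeff]
      · rw [e1, e3, lie_smul, smul_lie, b13]; norm_num [exceptionalCoeff]
      · rw [hy', e1, e4, lie_smul, smul_lie, b14]; norm_num [exceptionalCoeff]; module
      · rw [e1, e5, e6, lie_smul, smul_lie, lie_add, lie_smul, lie_add, b15, y1]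
        norm_num [exceptionalCoeff]; module
      · rw [e1, e6, e7, lie_smul, smul_lie, b16]; norm_num [exceptionalCoeff]; module
      · rw [hy', e2, e3, lie_smul, smul_lie, b23]; norm_num [exceptionalCoeff]; module
      · rw [e2, e4, e6, lie_smul, smul_lie, b24]; norm_num [exceptionalCoeff]; module
      · rw [e2, e5, e7, lie_smul, smul_lie, lie_add, lie_smul, lie_add, b25, y2]
        norm_num [exceptionalCoeff]
        match_scalars
        linear_combination -q ^ 2 * hqγ - q ^ 2 * hu
      · rw [e3, e4, e7, lie_smul, smul_lie, b34]
        norm_num [exceptionalCoeff]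
        match_scalars
        linear_combination 2 * q ^ 2 * hqγ + q ^ 2 * hu
  -- Antisymmetry of the target coefficients is inherited from the model `g1`, which is known to be
  -- a Lie algebra; it reduces the brackets to the case `i < j`.
  have hanti : ∀ i j, 1 ≤ i → 1 ≤ j → i + j < 8 →
      exceptionalCoeff 4 1 i j = -exceptionalCoeff 4 1 j i := by
    obtain ⟨x₁, e₁, y₁, h₁⟩ := isTable_g1
    exact fun i j hi hj hij => h₁.tableRel.anti i j hi hj hij
  refine ⟨x', e', y', le_rfl, by omega, by omega, e8, ?_, ?_, ?_, ?_, ?_, h.dim⟩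
  · intro j hj
    by_cases hj8 : 7 ≤ j
    · rw [e8 (j + 1) (by omega)]
      rcases hj8.eq_or_lt with rfl | h7
      · rw [hx', e7, lie_smul, add_lie, smul_lie, x7, z8, hz 1 7 (by omega) (by omega) (by omega)]
        simp
      · rw [e8 j h7, lie_zero]
    · rw [hx']
      interval_cases j
      · rw [e1, e2, lie_smul, add_lie, smul_lie, lie_self, x1]; module
      · rw [e2, e3, lie_smul, add_lie, smul_lie, b12, x2]; module
      · rw [e3, e4, lie_smul, add_lie, smul_lie, b13, x3]; module
      · rw [e4, e5, lie_smul, add_lie, smul_lie, b14, x4]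
      · rw [e5, e6]
        simp only [lie_smul, lie_add, add_lie, smul_lie, b15, x5, xy, y1]
        match_scalars
        rw [hq]; ring
      · rw [e6, e7, lie_smul, add_lie, smul_lie, b16, x6]
        match_scalars
        linear_combination -q ^ 2 * hqγ
  · rw [hy', hx', e5]
    simp only [lie_smul, lie_add, add_lie, smul_lie, lie_sub, b15, x5, xy, y1]
    match_scalars
    rw [hq]; ring
  · intro i j hi hj
    rcases lt_trichotomy i j with hij | rfl | hij
    · exact hlt i j hi hij
    · have h0 : exceptionalCoeff 4 1 i i • e' (i + i) = 0 := by
        by_cases h8 : 8 ≤ i + i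
        · rw [e8 _ h8, smul_zero]
        · rw [self_eq_neg.1 (hanti i i hi hi (by omega)), zero_smul]
      rw [lie_self, h0, if_neg (by omega), add_zero]
    · rw [← lie_skew, hlt j i hj hij, add_comm j i]
      by_cases h8 : 8 ≤ i + j
      · rw [e8 _ h8, if_neg (by omega), if_neg (by omega)]; simp
      · rw [hanti i j hi hj (by omega)]
        split_ifs with h5
        · have : (-1 : ℂ) ^ (j + 1) = -(-1) ^ (i + 1) := neg_one_pow_eq_neg (S := 3) (by omega)
          rw [this]; module
        · module
  · intro j hj
    rw [hy', lie_sub, lie_smul, lie_add]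
    by_cases h3 : 3 ≤ j
    · have h0 : ⁅e' j, e' 5⁆ = 0 := by
        rcases lt_trichotomy j 5 with h5 | rfl | h5
        · rw [hlt j 5 hj h5, e8 _ (by omega), if_neg (by omega), smul_zero, add_zero]
        · exact lie_self _
        · rw [← lie_skew, hlt 5 j (by omega) h5, e8 _ (by omega), if_neg (by omega), smul_zero,
            add_zero, neg_zero]
      have h1 : ⁅e' j, e 5 + y⁆ = 0 := by
        by_cases h5 : j = 5
        · rw [h5, e5]
          simp only [smul_lie, add_lie, lie_add, lie_self, hzy 5 (by omega),
            ← lie_skew y (e 5), neg_zero, smul_zero, add_zero]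
        · have hs : ∃ c : ℂ, e' j = c • e j := by
            by_cases h8 : 8 ≤ j
            · exact ⟨0, by rw [e8 j h8, zero_smul]⟩
            · interval_cases j
              · exact ⟨_, e3⟩
              · exact ⟨_, e4⟩
              · exact absurd rfl h5
              · exact ⟨_, e6⟩
              · exact ⟨_, e7⟩
          obtain ⟨c, hc⟩ := hs
          rw [hc, smul_lie, lie_add, hz j 5 hj (by omega) (by omega), hzy j h3, add_zero, smul_zero]
      rw [← lie_add, h1, h0, e8 _ (by omega)]
      simp
    · have : j < 3 := by omega
      rw [← lie_add]
      interval_cases j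
      · rw [hlt 1 5 (by omega) (by omega), e1, e6, smul_lie, lie_add, b15, y1]
        norm_num [exceptionalCoeff]
      · rw [hlt 2 5 (by omega) (by omega), e2, e7, smul_lie, lie_add, b25, y2]
        norm_num [exceptionalCoeff]
        module
  · have hγ3 : q ^ 3 * γ ≠ 0 := mul_ne_zero (pow_ne_zero 3 hq0) h0
    set S := Submodule.span ℂ ({x', y'} ∪ e' '' {j | 1 ≤ j})
    have hxS : x' ∈ S := Submodule.subset_span (by simp)
    have hyS : y' ∈ S := Submodule.subset_span (by simp)
    have heS : ∀ j, 1 ≤ j → e' j ∈ S := fun j hj => Submodule.subset_span (Or.inr ⟨j, hj, rfl⟩)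
    have hwS : e 5 + y ∈ S := by
      rw [← Submodule.smul_mem_iff _ (pow_ne_zero 2 hq0)]
      have := add_mem hyS (heS 5 (by omega))
      rwa [hy', sub_add_cancel] at this
    have hS : ∀ j, 1 ≤ j → e j ∈ S := by
      intro j hj
      by_cases h8 : 8 ≤ j
      · rw [h.zero j h8]; exact zero_mem _
      · have h' := heS j hj
        interval_cases j
        · rwa [e1, Submodule.smul_mem_iff _ hq0] at h'
        · rwa [e2, Submodule.smul_mem_iff _ hq0] at h'
        · rwa [e3, Submodule.smul_mem_iff _ hq0] at h'
        · rwa [e4, Submodule.smul_mem_iff _ hq0] at h'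
        · rw [e5, Submodule.smul_mem_iff _ hq0] at h'
          exact (Submodule.add_mem_iff_left _ (S.smul_mem u hwS)).1 h'
        · rwa [e6, Submodule.smul_mem_iff _ (pow_ne_zero 2 hq0)] at h'
        · rwa [e7, Submodule.smul_mem_iff _ hγ3] at h'
    rw [eq_top_iff, ← h.span, Submodule.span_le]
    rintro z ((rfl | rfl) | ⟨j, hj, rfl⟩)
    · rw [hx'] at hxS
      exact (Submodule.add_mem_iff_left _ (S.smul_mem u (hS 1 le_rfl))).1 hxS
    · exact (Submodule.add_mem_iff_right _ (hS 5 (by omega))).1 hwS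
    · exact hS j hj

end IsTable
end

/-! ### From tables to models. -/

section

variable {𝔤 : Type*} [LieRing 𝔤] [LieAlgebra ℂ 𝔤] {m t : ℕ} {A : ℕ → ℕ → ℂ} {f : ℂ}
  {x : 𝔤} {e : ℕ → 𝔤} {y : 𝔤}

namespace IsTable

variable (h : IsTable m t A f x e y)
include h

/-- All coefficients below the top degree vanish and the top ones alternate, so `shift` removes
them. -/
theorem exists_model_of_eq_pred (ht : t = m - 1) (h12 : A 1 2 = 0) :
    ∃ M : Model, M.m = m ∧ Nonempty (𝔤 ≃ₗ⁅ℂ⁆ M.law.Alg) := by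
  have hm := h.four_le
  have R := h.tableRel
  have h0 := R.zero_below_y (by omega) h.lt h12
  have h1 := R.first_degree (S := 2 * t) (by omega) fun i j hi hj hij => h0 i j hi hj hij.le
  have h' := h.shift ht (fun i j hi hj hij => h0 i j hi hj (by omega))
    (fun i j hi hj hij => h1 i j hi hj (by omega))
  obtain ⟨x₁, e₁, y₁, h₁⟩ := isTable_g4 m hm
  subst ht
  exact ⟨Model.g4 m hm, rfl, h'.nonempty_equiv h₁ fun _ _ _ _ _ => rfl⟩

theorem exists_model_of_eq_zero (ht : t + 2 ≤ m) (h12 : A 1 2 = 0) (hf : f = 0)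
    (hc : CentralizerProperty 𝔤) : ∃ M : Model, M.m = m ∧ Nonempty (𝔤 ≃ₗ⁅ℂ⁆ M.law.Alg) := by
  have hm := h.four_le
  have R := h.tableRel
  have h0 := R.zero_below_top h12 hf
  have h1 := R.first_degree (S := 2 * m - 2) (by omega)
    fun i j hi hj hij => h0 i j hi hj (by omega)
  -- The top coefficient controls `[e_{m-1}, e_m]`, which the centralizer property requires to be
  -- nonzero.
  have hq : A 1 (2 * m - 2) ≠ 0 := by
    intro hq
    refine h.not_centralizerProperty ?_ (by omega) (Or.inl hf) hc
    rw [h1 _ _ (by omega) (by omega) (by omega), hq, mul_zero]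
  have h' := h.scale (inv_ne_zero hq)
  rw [hf, mul_zero] at h'
  obtain ⟨x₁, e₁, y₁, h₁⟩ := isTable_g2 m t hm h.one_le ht
  refine ⟨Model.g2 m t hm h.one_le ht, rfl, h'.nonempty_equiv h₁ fun i j hi hj hij => ?_⟩
  unfold topCoeff
  split_ifs with hd
  · rw [h1 i j hi hj (by omega)]
    field_simp
  · rw [h0 i j hi hj (by omega), mul_zero]

/-- Scaling by the inverse of `A 1 (2t)` leaves only the ratio `γ = A 1 (2t+2) / A 1 (2t)`
undetermined. -/
theorem exists_model_of_ne_zero (ht : t + 2 ≤ m) (h12 : A 1 2 = 0) (hf : f ≠ 0)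
    (hc : CentralizerProperty 𝔤) : ∃ M : Model, M.m = m ∧ Nonempty (𝔤 ≃ₗ⁅ℂ⁆ M.law.Alg) := by
  have hm := h.four_le
  have R := h.tableRel
  have ht2 : 2 ≤ t := by
    have := h.one_le
    by_contra h'
    exact hf (R.f_eq_zero_of_t_eq_one hm (by omega) h12)
  have hα : A 1 (2 * t) ≠ 0 := fun hα => hf (by rw [R.f_eq ht2 ht h12, hα]; simp)
  have htm : t + 2 = m := by
    by_contra h'
    exact hα (R.alpha_eq_zero ht2 (by omega) h12)
  have htC : (t : ℂ) = (m : ℂ) - 2 := by rw [← htm]; push_cast; ring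
  obtain ⟨γ, hγ⟩ : ∃ γ, γ = (A 1 (2 * t))⁻¹ * A 1 (2 * t + 2) := ⟨_, rfl⟩
  have h' := h.scale (inv_ne_zero hα)
  have hf' : (A 1 (2 * t))⁻¹ ^ 2 * f = -((m : ℂ) - 2) := by
    rw [R.f_eq ht2 ht h12, htC]
    field_simp
  rw [hf'] at h'
  have hA : ∀ i j, 1 ≤ i → 1 ≤ j → i + j < 2 * m →
      (A 1 (2 * t))⁻¹ * A i j = exceptionalCoeff m γ i j := by
    intro i j hi hj hij
    have h0 := R.zero_below_y ht2 h.lt h12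
    have h1 := R.first_degree (S := 2 * t) (by omega) fun i j hi hj hij => h0 i j hi hj hij.le
    have h2 := R.second_degree (p := t) (by omega) fun i j hi hj hij => h0 i j hi hj hij.le
    have h3 := R.third_degree ht2 ht h12
    unfold exceptionalCoeff
    split_ifs with hd1 hd2 hd3
    · rw [h1 i j hi hj (by omega)]
      field_simp
    · rw [h2 i j hi hj (by omega), htC]
      field_simp
      ring
    · rw [h3 i j hi hj (by omega), htC, hγ]
      field_simp
      ring
    · rw [h0 i j hi hj (by omega), mul_zero]
  by_cases hγ0 : γ = 0
  · obtain ⟨x₁, e₁, y₁, h₁⟩ := isTable_g3 m hm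
    obtain rfl : t = m - 2 := by omega
    exact ⟨Model.g3 m hm, rfl, h'.nonempty_equiv h₁ fun i j hi hj hij => by
      rw [hA i j hi hj hij, hγ0]⟩
  · have hA2 : A 1 (2 * t + 2) ≠ 0 := fun h0 => hγ0 (by rw [hγ, h0, mul_zero])
    have ht4 : t = 2 := by
      have := (mul_eq_zero.1 (R.gamma_mul ht2 ht h12)).resolve_right (mul_ne_zero hα hA2)
      exact_mod_cast sub_eq_zero.1 this
    obtain rfl : m = 4 := by omega
    -- The normalized coefficient `A 3 4` is `γ - 3`, and `e_3, e_4` are the vectors `e_{m-1}, e_m`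
    -- of the centralizer property.
    have hγ3 : γ ≠ 3 := by
      intro h3
      refine h.not_centralizerProperty ?_ (by omega) (Or.inr (by omega)) hc
      have := hA 3 4 (by omega) (by omega) (by omega)
      rw [h3] at this
      norm_num [exceptionalCoeff] at this
      exact this.resolve_left hα
    have h'' := h'.congr hA
    rw [ht4] at h''
    obtain ⟨x₂, e₂, y₂, h₂⟩ := h''.base_change hγ0 hγ3
    obtain ⟨x₁, e₁, y₁, h₁⟩ := isTable_g1
    exact ⟨Model.g1, rfl, h₂.nonempty_equiv h₁ fun _ _ _ _ _ => rfl⟩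

/-- The classification of the algebras given by a table. -/
theorem exists_model (h12 : A 1 2 = 0) (hc : CentralizerProperty 𝔤) :
    ∃ M : Model, M.m = m ∧ Nonempty (𝔤 ≃ₗ⁅ℂ⁆ M.law.Alg) := by
  have := h.lt
  by_cases ht : t + 2 ≤ m
  · by_cases hf : f = 0
    · exact h.exists_model_of_eq_zero ht h12 hf hc
    · exact h.exists_model_of_ne_zero ht h12 hf hc
  · exact h.exists_model_of_eq_pred (by omega) h12

end IsTable
end

/-! ### The nilindex, and a homogeneous frame. -/

section

variable {𝔤 : Type*} [LieRing 𝔤] [LieAlgebra ℂ 𝔤]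

theorem C_nilindex (h0 : nilindex 𝔤 ≠ 0) : C 𝔤 (nilindex 𝔤) = ⊥ := by
  obtain ⟨n, hn⟩ := Nat.exists_eq_succ_of_ne_zero h0
  have := ((LieModule.nilpotencyLength_eq_succ_iff ℂ 𝔤 𝔤 n).1 hn).1
  rwa [← Nat.succ_eq_add_one, ← hn] at this

/-- For nilindex `2k`, two elements of `C^{k-1}` have classes of degree `k`, which commute by the
second condition. Their bracket therefore falls from `C^{2k-1}` into `C^{2k} = 0`, against the
centralizer property at `p = k-1`. -/
theorem odd_nilindex (h0 : nilindex 𝔤 ≠ 0)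
    (h1 : CentralizerProperty 𝔤) (h2 : ConditionTwo 𝔤) : Odd (nilindex 𝔤) := by
  by_contra hodd
  obtain ⟨k, hk⟩ := Nat.not_odd_iff_even.1 hodd
  refine h1.2 (k - 1) (by omega) fun u hu v hv => ?_
  have h3 : pieceBracket 𝔤 (k - 1) (k - 1) (Submodule.Quotient.mk ⟨u, hu⟩)
      (Submodule.Quotient.mk ⟨v, hv⟩) = 0 := by
    by_contra h3
    have := h2 (k - 1) (k - 1) (by omega) (by omega) _ _ h3
    omega
  have h4 := (Submodule.Quotient.mk_eq_zero ((C 𝔤 (k - 1 + (k - 1) + 1 + 1)).toSubmodule.submoduleOf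
    (C 𝔤 (k - 1 + (k - 1) + 1)).toSubmodule)).1 h3
  replace h4 : ⁅u, v⁆ ∈ C 𝔤 (k - 1 + (k - 1) + 1 + 1) := h4
  rw [show k - 1 + (k - 1) + 1 + 1 = nilindex 𝔤 by omega, C_nilindex h0] at h4
  simpa using h4

namespace NatGrading

variable {V : ℕ → Submodule ℂ 𝔤} {π : ℕ → 𝔤 →ₗ[ℂ] 𝔤} (G : NatGrading V π)
include G

theorem linearIndependent {N : ℕ} {v : Fin N → 𝔤} (hv : ∀ i, v i ∈ V i.1) (h0 : ∀ i, v i ≠ 0) :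
    LinearIndependent ℂ v := by
  rw [Fintype.linearIndependent_iff]
  intro c hc i
  have := congrArg (π i.1) hc
  rw [map_zero, map_sum, Finset.sum_eq_single i, map_smul, G.proj_same _ _ (hv i)] at this
  · exact (smul_eq_zero.1 this).resolve_right (h0 i)
  · intro j _ hj
    rw [map_smul, G.proj_ne j.1 i.1 (fun h => hj (Fin.ext h.symm)) _ (hv j), smul_zero]
  · simp

/-- As degree one generates, a gap in the grading is never followed by a nonzero component. -/
theorem ne_bot {i : ℕ} (hi : C 𝔤 i ≠ ⊥) : V i ≠ ⊥ := by
  intro h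
  have h1 : ∀ j, V (i + j) = ⊥ := by
    intro j
    induction j with
    | zero => exact h
    | succ j ih =>
      rw [eq_bot_iff]
      refine (G.gen (i + j)).trans (Submodule.span_le.2 ?_)
      rintro _ ⟨u, -, v, hv, rfl⟩
      rw [ih, Submodule.mem_bot] at hv
      rw [hv, lie_zero]
      exact zero_mem _
  apply hi
  rw [← LieSubmodule.toSubmodule_inj, G.C_eq_iSup]
  simp [h1]

/-- Otherwise the components of degrees `1, …, d` are all nonzero, and by dimension each is a line.
A one-dimensional degree one component commutes with itself, so degree two would vanish. -/
theorem C_eq_bot_of_finrank [FiniteDimensional ℂ 𝔤] {d : ℕ} (hd : Module.finrank ℂ 𝔤 = d)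
    (h2 : 2 ≤ d) : C 𝔤 (d - 1) = ⊥ := by
  by_contra hC
  have h3 : ∀ i : Fin d, ∃ v ∈ V i.1, v ≠ 0 := fun i =>
    (Submodule.ne_bot_iff _).1 (G.ne_bot fun h => hC (by
      rw [eq_bot_iff, ← h]; exact C_antitone (by omega)))
  choose v hv h0 using h3
  have hspan : Submodule.span ℂ (Set.range v) = ⊤ :=
    (G.linearIndependent hv h0).span_eq_top_of_card_eq_finrank' (by rw [Fintype.card_fin, hd])
  have h4 : V 0 ≤ Submodule.span ℂ {v ⟨0, by omega⟩} := by
    refine (G.le_span hv hspan 0).trans (Submodule.span_mono ?_)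
    rintro _ ⟨i, hi, rfl⟩
    rw [Set.mem_singleton_iff]
    exact congrArg v (Fin.ext hi)
  have h5 : v ⟨1, by omega⟩ ∈ (⊥ : Submodule ℂ 𝔤) := by
    refine (G.gen 0).trans (Submodule.span_le.2 ?_) (hv ⟨1, by omega⟩)
    rintro _ ⟨a, ha, b, hb, rfl⟩
    exact lie_eq_zero_of_mem_span (by simp) (h4 ha) (h4 hb)
  exact h0 _ h5

/-- Passing to the components of degree one of `X` and `z` does not change the leading part of
`ad(X)^k z`. -/
theorem ad_pow_sub_mem (X z : 𝔤) (k : ℕ) :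
    ((LieAlgebra.ad ℂ 𝔤 (π 0 X)) ^ k) (π 0 z) - ((LieAlgebra.ad ℂ 𝔤 X) ^ k) z ∈ C 𝔤 (k + 1) := by
  induction k with
  | zero =>
    have := neg_mem (G.sub_proj_mem (mem_C_zero z))
    simpa using this
  | succ k ih =>
    rw [pow_succ', pow_succ', Module.End.mul_apply, Module.End.mul_apply, LieAlgebra.ad_apply,
      LieAlgebra.ad_apply]
    have h1 := neg_mem (lie_mem_C 𝔤 (G.sub_proj_mem (mem_C_zero X)) (ad_pow_mem_C (π 0 X) (π 0 z) k))
    have h2 := lie_mem_C_succ X ih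
    rw [show 0 + 1 + k + 1 = k + 1 + 1 by omega] at h1
    have h3 := add_mem h1 h2
    convert h3 using 1
    simp only [sub_lie, lie_sub]
    abel

end NatGrading

/-- Homogeneous vectors `x`, `e 1, e 2, …` and `y` spanning `𝔤`, where `e (j+1) = [x, e j]` and `y`
is not a combination of the other vectors. -/
structure IsFrame (V : ℕ → Submodule ℂ 𝔤) (m k : ℕ) (x : 𝔤) (e : ℕ → 𝔤) (y : 𝔤) : Prop where
  zero : ∀ j, 2 * m ≤ j → e j = 0
  ne_zero : e (2 * m - 1) ≠ 0
  x_mem : x ∈ V 0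
  e_mem : ∀ j, e (j + 1) ∈ V j
  y_mem : y ∈ V k
  xe : ∀ j, 1 ≤ j → ⁅x, e j⁆ = e (j + 1)
  span : Submodule.span ℂ ({x, y} ∪ e '' {j | 1 ≤ j}) = ⊤
  not_mem : y ∉ Submodule.span ℂ ({x} ∪ e '' {j | 1 ≤ j})

/-- Replacing `X` and `z` by their parts of degree one does not change `ad(X)^{2m-2} z`, because the
error lies in `C^{2m-1} = 0`. The resulting chain together with `x` has `2m` independent vectors,
one short of the dimension, and the missing one can be taken homogeneous. -/
theorem NatGrading.exists_isFrame [FiniteDimensional ℂ 𝔤] {V : ℕ → Submodule ℂ 𝔤}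
    {π : ℕ → 𝔤 →ₗ[ℂ] 𝔤} (G : NatGrading V π) {m : ℕ} (hm : 2 ≤ m)
    (hd : Module.finrank ℂ 𝔤 = 2 * m + 1) (hC : C 𝔤 (2 * m - 1) = ⊥) {X z : 𝔤}
    (hXz : ((LieAlgebra.ad ℂ 𝔤 X) ^ (2 * m - 2)) z ≠ 0) :
    ∃ (k : ℕ) (x : 𝔤) (e : ℕ → 𝔤) (y : 𝔤), IsFrame V m k x e y := by
  obtain ⟨x, hx⟩ : ∃ x, x = π 0 X := ⟨_, rfl⟩
  obtain ⟨e, he⟩ : ∃ e : ℕ → 𝔤, e = fun j => ((LieAlgebra.ad ℂ 𝔤 x) ^ (j - 1)) (π 0 z) := ⟨_, rfl⟩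
  have hx0 : x ∈ V 0 := hx ▸ G.proj_mem 0 X
  have he1 : e 1 ∈ V 0 := by rw [he]; simpa using G.proj_mem 0 z
  have hxe : ∀ j, 1 ≤ j → ⁅x, e j⁆ = e (j + 1) := by
    intro j hj
    obtain ⟨i, rfl⟩ : ∃ i, j = i + 1 := ⟨j - 1, by omega⟩
    rw [he]
    simp only [Nat.add_sub_cancel]
    rw [pow_succ', Module.End.mul_apply, LieAlgebra.ad_apply]
  have hV : ∀ j, e (j + 1) ∈ V j := by
    intro j
    induction j with
    | zero => exact he1
    | succ j ih =>
      rw [← hxe _ (by omega)]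
      have := G.lie_mem 0 j x hx0 _ ih
      rwa [Nat.zero_add] at this
  have hzero : ∀ j, 2 * m ≤ j → e j = 0 := by
    intro j hj
    have h1 := hV (j - 1)
    rw [G.lie_ne_mem hC (by omega), Submodule.mem_bot, Nat.sub_add_cancel (by omega)] at h1
    exact h1
  have hne : e (2 * m - 1) ≠ 0 := by
    have h1 := G.ad_pow_sub_mem X z (2 * m - 2)
    rw [show 2 * m - 2 + 1 = 2 * m - 1 by omega, hC, LieSubmodule.mem_bot, sub_eq_zero] at h1
    rw [he, hx]
    simp only [show 2 * m - 1 - 1 = 2 * m - 2 by omega]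
    rwa [h1]
  have hne' : ∀ j, 1 ≤ j → j < 2 * m → e j ≠ 0 := by
    intro j h1 h2 h0
    have : ∀ i, e (j + i) = 0 := by
      intro i
      induction i with
      | zero => exact h0
      | succ i ih => rw [← Nat.add_assoc, ← hxe _ (by omega), ih, lie_zero]
    refine hne ?_
    have := this (2 * m - 1 - j)
    rwa [Nat.add_sub_cancel' (by omega)] at this
  obtain ⟨v, hv⟩ : ∃ v : Fin (2 * m - 1) → 𝔤, v = fun i => e (i.1 + 1) := ⟨_, rfl⟩
  have hvli : LinearIndependent ℂ v := by
    rw [hv]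
    exact G.linearIndependent (fun i => hV i.1) fun i => hne' _ (by omega) (by omega)
  -- If `x` were in the span of the chain, its degree would make it a multiple of `e 1`, and then `e
  -- 2 = [x, e 1]` would vanish.
  have hxv : x ∉ Submodule.span ℂ (Set.range v) := by
    intro hxs
    have h1 : ∀ w ∈ Submodule.span ℂ (Set.range v), π 0 w ∈ Submodule.span ℂ {e 1} := by
      intro w hw
      refine (Submodule.span_le (p := (Submodule.span ℂ {e 1}).comap (π 0))).2 ?_ hw
      rintro _ ⟨i, rfl⟩
      rw [SetLike.mem_coe, Submodule.mem_comap, hv]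
      by_cases hi : i.1 = 0
      · simp only [hi]
        rw [G.proj_same 0 _ he1]
        exact Submodule.mem_span_singleton_self _
      · rw [G.proj_ne i.1 0 (Ne.symm hi) _ (hV i.1)]
        exact zero_mem _
    have h2 := h1 x hxs
    rw [G.proj_same 0 x hx0] at h2
    refine hne' 2 (by omega) (by omega) ?_
    rw [← hxe 1 le_rfl]
    exact lie_eq_zero_of_mem_span (S := {e 1}) (by simp) h2 (Submodule.mem_span_singleton_self _)
  have hli2 : LinearIndependent ℂ (Fin.cons x v : Fin (2 * m - 1 + 1) → 𝔤) :=
    linearIndependent_finCons.2 ⟨hvli, hxv⟩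
  have hS : Submodule.span ℂ ({x} ∪ e '' {j | 1 ≤ j}) =
      Submodule.span ℂ (Set.range (Fin.cons x v : Fin (2 * m - 1 + 1) → 𝔤)) := by
    rw [Fin.range_cons]
    apply le_antisymm
    · rw [Submodule.span_le]
      rintro w (rfl | ⟨j, hj, rfl⟩)
      · exact Submodule.subset_span (by simp)
      · by_cases hj2 : j < 2 * m
        · refine Submodule.subset_span (Or.inr ⟨⟨j - 1, ?_⟩, ?_⟩)
          · have : 1 ≤ j := hj
            omega
          · rw [hv]; simp only; rw [Nat.sub_add_cancel hj]
        · rw [SetLike.mem_coe, hzero j (by omega)]; exact zero_mem _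
    · refine Submodule.span_mono ?_
      rintro w (rfl | ⟨i, rfl⟩)
      · exact Or.inl rfl
      · rw [hv]
        exact Or.inr ⟨i.1 + 1, by simp, rfl⟩
  have hnt : Submodule.span ℂ ({x} ∪ e '' {j | 1 ≤ j}) ≠ ⊤ := by
    intro ht
    rw [hS] at ht
    have h1 := finrank_span_eq_card hli2
    rw [ht, finrank_top, hd, Fintype.card_fin] at h1
    omega
  obtain ⟨k, hk⟩ : ∃ k, ¬ V k ≤ Submodule.span ℂ ({x} ∪ e '' {j | 1 ≤ j}) := by
    by_contra! hcon
    exact hnt (eq_top_iff.2 (G.iSup_eq_top ▸ iSup_le hcon))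
  obtain ⟨y, hyV, hy⟩ := SetLike.not_le_iff_exists.1 hk
  refine ⟨k, x, e, y, hzero, hne, hx0, hV, hyV, hxe, ?_, hy⟩
  have hli3 : LinearIndependent ℂ (Fin.cons y (Fin.cons x v : Fin (2 * m - 1 + 1) → 𝔤) :
      Fin (2 * m - 1 + 1 + 1) → 𝔤) := linearIndependent_finCons.2 ⟨hli2, by rwa [← hS]⟩
  have htop := hli3.span_eq_top_of_card_eq_finrank' (by rw [Fintype.card_fin, hd]; omega)
  rw [Fin.range_cons, Submodule.span_insert, ← hS, ← Submodule.span_insert] at htop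
  rw [← htop]
  congr 1
  ext w
  simp only [Set.mem_union, Set.mem_insert_iff, Set.mem_singleton_iff]
  tauto

end

/-! ### From a frame to a table. -/

section

variable {𝔤 : Type*} [LieRing 𝔤] [LieAlgebra ℂ 𝔤] {V : ℕ → Submodule ℂ 𝔤} {π : ℕ → 𝔤 →ₗ[ℂ] 𝔤}
  {m k : ℕ} {x : 𝔤} {e : ℕ → 𝔤} {y : 𝔤}

namespace IsFrame

section

variable (h : IsFrame V m k x e y)
include h

omit h in
theorem e_mem_span {j : ℕ} (hj : 1 ≤ j) : e j ∈ Submodule.span ℂ ({x} ∪ e '' {j | 1 ≤ j}) :=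
  Submodule.subset_span (Or.inr ⟨j, hj, rfl⟩)

omit h in
theorem x_mem_span : x ∈ Submodule.span ℂ ({x} ∪ e '' {j | 1 ≤ j}) :=
  Submodule.subset_span (Or.inl rfl)

theorem smul_y_eq_zero {c : ℂ} (hc : c • y ∈ Submodule.span ℂ ({x} ∪ e '' {j | 1 ≤ j})) : c = 0 := by
  by_contra h0
  exact h.not_mem ((Submodule.smul_mem_iff _ h0).1 hc)

theorem piece_le (G : NatGrading V π) (i : ℕ) : V i ≤ Submodule.span ℂ
    {z | z = e (i + 1) ∨ (i = 0 ∧ z = x) ∨ (i = k ∧ z = y)} := by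
  let b : ℕ ⊕ Bool → 𝔤 := Sum.elim (fun j => e (j + 1)) fun c => if c then x else y
  let deg : ℕ ⊕ Bool → ℕ := Sum.elim id fun c => if c then 0 else k
  have hb : ∀ i, b i ∈ V (deg i) := by
    rintro (j | (_ | _))
    · exact h.e_mem j
    · exact h.y_mem
    · exact h.x_mem
  have htop : Submodule.span ℂ (Set.range b) = ⊤ := by
    rw [eq_top_iff, ← h.span]
    refine Submodule.span_mono ?_
    rintro z ((rfl | rfl) | ⟨j, hj, rfl⟩)
    · exact ⟨Sum.inr true, rfl⟩
    · exact ⟨Sum.inr false, rfl⟩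
    · exact ⟨Sum.inl (j - 1), congrArg e (Nat.sub_add_cancel hj)⟩
  refine (G.le_span hb htop i).trans (Submodule.span_mono ?_)
  rintro z ⟨(j | (_ | _)), hj, rfl⟩
  · exact Or.inl (congrArg (fun l => e (l + 1)) hj)
  · exact Or.inr (Or.inr ⟨hj.symm, rfl⟩)
  · exact Or.inr (Or.inl ⟨hj.symm, rfl⟩)

theorem exists_eq (G : NatGrading V π) {i : ℕ} (hi : i ≠ 0) {z : 𝔤} (hz : z ∈ V i) :
    ∃ a b : ℂ, z = a • e (i + 1) + b • y ∧ (i ≠ k → b = 0) := by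
  by_cases hik : i = k
  · have h1 : z ∈ Submodule.span ℂ {e (i + 1), y} := by
      refine (h.piece_le G i).trans (Submodule.span_mono ?_) hz
      rintro w (rfl | ⟨h0, -⟩ | ⟨-, rfl⟩)
      · simp
      · exact absurd h0 hi
      · simp
    obtain ⟨a, b, rfl⟩ := Submodule.mem_span_pair.1 h1
    exact ⟨a, b, rfl, fun h0 => absurd hik h0⟩
  · have h1 : z ∈ Submodule.span ℂ {e (i + 1)} := by
      refine (h.piece_le G i).trans (Submodule.span_mono ?_) hz
      rintro w (rfl | ⟨h0, -⟩ | ⟨h0, -⟩)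
      · simp
      · exact absurd h0 hi
      · exact absurd h0 hik
    obtain ⟨a, rfl⟩ := Submodule.mem_span_singleton.1 h1
    exact ⟨a, 0, by simp, fun _ => rfl⟩

/-- Replacing `y` by a homogeneous vector congruent to it. -/
theorem add_y {w : 𝔤} (hw : w ∈ Submodule.span ℂ ({x} ∪ e '' {j | 1 ≤ j})) (hwV : w ∈ V k) :
    IsFrame V m k x e (y + w) where
  zero := h.zero
  ne_zero := h.ne_zero
  x_mem := h.x_mem
  e_mem := h.e_mem
  y_mem := add_mem h.y_mem hwV
  xe := h.xe
  span := by
    have hle : Submodule.span ℂ ({x} ∪ e '' {j | 1 ≤ j}) ≤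
        Submodule.span ℂ ({x, y + w} ∪ e '' {j | 1 ≤ j}) := by
      refine Submodule.span_mono ?_
      rintro z (rfl | hz)
      · simp
      · exact Or.inr hz
    rw [eq_top_iff, ← h.span, Submodule.span_le]
    rintro z ((rfl | rfl) | hz)
    · exact Submodule.subset_span (by simp)
    · have h1 : z + w ∈ Submodule.span ℂ ({x, z + w} ∪ e '' {j | 1 ≤ j}) :=
        Submodule.subset_span (by simp)
      exact (Submodule.add_mem_iff_left _ (hle hw)).1 h1
    · exact Submodule.subset_span (Or.inr hz)
  not_mem hy := h.not_mem ((Submodule.add_mem_iff_left _ hw).1 hy)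

/-- By degree `[x, y]` is a multiple of `e_{k+2} = [x, e_{k+1}]`, so subtracting a multiple of
`e_{k+1}` from `y` kills it. -/
theorem exists_xy_eq_zero (G : NatGrading V π) : ∃ y', IsFrame V m k x e y' ∧ ⁅x, y'⁆ = 0 := by
  have h1 := G.lie_mem 0 k x h.x_mem y h.y_mem
  obtain ⟨a, b, hab, hb⟩ := h.exists_eq G (by omega) h1
  rw [hb (by omega), zero_smul, add_zero, Nat.zero_add] at hab
  refine ⟨y + (-a) • e (k + 1), h.add_y (Submodule.smul_mem _ _ (e_mem_span (by omega)))
    (Submodule.smul_mem _ _ (h.e_mem k)), ?_⟩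
  rw [lie_add, lie_smul, hab, h.xe _ (by omega), neg_smul, add_neg_cancel]

theorem lie_e_y_eq_zero (hxy : ⁅x, y⁆ = 0) (h1 : ⁅e 1, y⁆ = 0) : ∀ j, 1 ≤ j → ⁅e j, y⁆ = 0 := by
  intro j hj
  induction j, hj using Nat.le_induction with
  | base => exact h1
  | succ j hj ih => rw [← h.xe j hj, lie_lie, ih, hxy, lie_zero, lie_zero, sub_zero]

/-- If `y` has degree one, the algebra has a one-dimensional direct summand. -/
theorem not_isNonsplit (G : NatGrading V π) (hk : k = 0) (hxy : ⁅x, y⁆ = 0) : ¬ IsNonsplit 𝔤 := by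
  subst hk
  obtain ⟨a, b, hab, hb⟩ := h.exists_eq G (by omega) (G.lie_mem 0 0 _ (h.e_mem 0) _ h.y_mem)
  rw [hb (by omega), zero_smul, add_zero] at hab
  norm_num at hab
  -- With `[e_1, y] = a e_2`, the vector `y + a x` commutes with both `x` and `e_1`, hence with the
  -- whole chain. It spans a central line complementary to the span of `x` and the chain, which
  -- contains all brackets.
  have h' := h.add_y (w := a • x) (Submodule.smul_mem _ _ x_mem_span) (Submodule.smul_mem _ _ h.x_mem)
  obtain ⟨w, hw⟩ : ∃ w, w = y + a • x := ⟨_, rfl⟩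
  rw [← hw] at h'
  have hxw : ⁅x, w⁆ = 0 := by rw [hw, lie_add, hxy, lie_smul, lie_self, smul_zero, add_zero]
  have hew := h'.lie_e_y_eq_zero hxw (by
    rw [hw, lie_add, hab, lie_smul, ← lie_skew, h.xe 1 le_rfl, smul_neg, add_neg_cancel])
  have hcen : ∀ u : 𝔤, ⁅u, w⁆ = 0 := by
    intro u
    have hu : u ∈ Submodule.span ℂ ({x, w} ∪ e '' {j | 1 ≤ j}) := by rw [h'.span]; trivial
    induction hu using Submodule.span_induction with
    | mem u hu =>
      rcases hu with (rfl | rfl) | ⟨j, hj, rfl⟩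
      · exact hxw
      · exact lie_self _
      · exact hew j hj
    | zero => exact zero_lie _
    | add u v _ _ hu hv => rw [add_lie, hu, hv, add_zero]
    | smul c u _ hu => rw [smul_lie, hu, smul_zero]
  have hC1 : ∀ u v : 𝔤, ⁅u, v⁆ ∈ Submodule.span ℂ ({x} ∪ e '' {j | 1 ≤ j}) := by
    intro u v
    have h1 : ⁅u, v⁆ ∈ (C 𝔤 1).toSubmodule := lie_mem_C_one u v
    rw [G.C_eq_iSup] at h1
    refine (iSup_le fun i => ?_ : ⨆ i, V (1 + i) ≤ _) h1
    refine (h.piece_le G _).trans (Submodule.span_le.2 ?_)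
    rintro z (rfl | ⟨h0, -⟩ | ⟨h0, -⟩)
    · exact e_mem_span (by omega)
    · omega
    · omega
  let I : LieIdeal ℂ 𝔤 :=
    { toSubmodule := Submodule.span ℂ {w}
      lie_mem := by
        intro u v hv
        obtain ⟨c, rfl⟩ := Submodule.mem_span_singleton.1 hv
        rw [lie_smul, hcen, smul_zero]
        exact zero_mem (Submodule.span ℂ {w}) }
  let J : LieIdeal ℂ 𝔤 :=
    { toSubmodule := Submodule.span ℂ ({x} ∪ e '' {j | 1 ≤ j})
      lie_mem := fun {u v} _ => hC1 u v }
  refine fun hns => hns ⟨I, J, ?_, ?_, ?_⟩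
  · intro hI
    have h1 : w ∈ I := Submodule.mem_span_singleton_self w
    rw [hI, LieSubmodule.mem_bot] at h1
    exact h'.not_mem (h1 ▸ zero_mem _)
  · intro hJ
    have h1 : e (2 * m - 1) ∈ J := by
      rcases Nat.eq_zero_or_pos (2 * m - 1) with h0 | h0
      · exact absurd (h.zero (2 * m - 1) (by omega)) h.ne_zero
      · exact e_mem_span h0
    rw [hJ, LieSubmodule.mem_bot] at h1
    exact h.ne_zero h1
  · rw [isCompl_iff]
    constructor
    · rw [disjoint_iff, eq_bot_iff]
      rintro z ⟨hzI, hzJ⟩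
      obtain ⟨c, rfl⟩ := Submodule.mem_span_singleton.1 hzI
      rw [h'.smul_y_eq_zero hzJ, zero_smul]
      exact zero_mem _
    · rw [codisjoint_iff, ← LieSubmodule.toSubmodule_inj, LieSubmodule.sup_toSubmodule,
        LieSubmodule.top_toSubmodule, ← h'.span]
      refine le_antisymm (h'.span ▸ le_top) (Submodule.span_le.2 ?_)
      rintro z ((rfl | rfl) | ⟨j, hj, rfl⟩)
      · exact Submodule.mem_sup_right (T := J.toSubmodule) x_mem_span
      · exact Submodule.mem_sup_left (S := I.toSubmodule) (Submodule.mem_span_singleton_self z)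
      · exact Submodule.mem_sup_right (T := J.toSubmodule) (e_mem_span hj)

/-- The vector `e 1` can be chosen such that `[e 1, e 2]` is a multiple of `y`. -/
theorem exists_lie_e_one (G : NatGrading V π) (hm : 2 ≤ m) :
    ∃ e', IsFrame V m k x e' y ∧ ∃ b : ℂ, ⁅e' 1, e' 2⁆ = b • y ∧ (k ≠ 2 → b = 0) := by
  obtain ⟨a, b, hab, hb⟩ := h.exists_eq G (by omega) (G.lie_mem 0 1 _ (h.e_mem 0) _ (h.e_mem 1))
  norm_num at hab
  -- Only `e 1` changes. Subtracting a multiple of `x` leaves `[x, e 1] = e 2` intact and removes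
  -- the component of `[e 1, e 2]` along `e 3`.
  obtain ⟨e', he'⟩ : ∃ e' : ℕ → 𝔤, e' = fun j => if j = 1 then e 1 - a • x else e j := ⟨_, rfl⟩
  have h1 : e' 1 = e 1 - a • x := by rw [he']; simp
  have h2 : ∀ j, j ≠ 1 → e' j = e j := fun j hj => by rw [he']; simp [hj]
  have hle : ∀ j, 1 ≤ j → e' j ∈ Submodule.span ℂ ({x} ∪ e '' {j | 1 ≤ j}) := by
    intro j hj
    by_cases hj1 : j = 1
    · rw [hj1, h1]
      exact sub_mem (e_mem_span le_rfl) (Submodule.smul_mem _ _ x_mem_span)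
    · rw [h2 j hj1]; exact e_mem_span hj
  refine ⟨e', ⟨?_, ?_, h.x_mem, ?_, h.y_mem, ?_, ?_, ?_⟩, b, ?_, fun h0 => hb (Ne.symm h0)⟩
  · intro j hj; rw [h2 j (by omega)]; exact h.zero j hj
  · rw [h2 _ (by omega)]; exact h.ne_zero
  · intro j
    rcases Nat.eq_zero_or_pos j with rfl | hj
    · rw [h1]; exact sub_mem (h.e_mem 0) (Submodule.smul_mem _ _ h.x_mem)
    · rw [h2 _ (by omega)]; exact h.e_mem j
  · intro j hj
    rw [h2 (j + 1) (by omega)]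
    by_cases hj1 : j = 1
    · rw [hj1, h1, lie_sub, lie_smul, lie_self, smul_zero, sub_zero, h.xe 1 le_rfl]
    · rw [h2 j hj1, h.xe j hj]
  · have hx : x ∈ Submodule.span ℂ ({x, y} ∪ e' '' {j | 1 ≤ j}) := Submodule.subset_span (by simp)
    have he : ∀ j, 1 ≤ j → e' j ∈ Submodule.span ℂ ({x, y} ∪ e' '' {j | 1 ≤ j}) :=
      fun j hj => Submodule.subset_span (Or.inr ⟨j, hj, rfl⟩)
    rw [eq_top_iff, ← h.span, Submodule.span_le]
    rintro z ((rfl | rfl) | ⟨j, hj, rfl⟩)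
    · exact hx
    · exact Submodule.subset_span (by simp)
    · by_cases hj1 : j = 1
      · have := add_mem (he 1 le_rfl) (Submodule.smul_mem _ a hx)
        rw [h1, sub_add_cancel] at this
        rwa [hj1]
      · rw [← h2 j hj1]; exact he j hj
  · intro hy
    refine h.not_mem (Submodule.span_le.2 ?_ hy)
    rintro z (rfl | ⟨j, hj, rfl⟩)
    · exact x_mem_span
    · exact hle j hj
  · rw [h1, h2 2 (by omega), sub_lie, smul_lie, hab, h.xe 2 (by omega)]
    abel

/-- The bracket of `e 1` with the vector of degree `k` has a component along `y`. -/
theorem lie_e_one_not_mem (G : NatGrading V π) (hk : 1 ≤ k) :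
    ⁅e 1, e k⁆ ∉ Submodule.span ℂ ({x} ∪ e '' {j | 1 ≤ j}) := by
  intro hmem
  obtain ⟨l, rfl⟩ : ∃ l, k = l + 1 := ⟨k - 1, by omega⟩
  -- Since `y` has degree `k + 1`, it is a sum of brackets of degree one with degree `k`. Among the
  -- brackets of spanning vectors, `[e 1, e k]` is the only one not obviously in the span of `x` and
  -- the chain.
  refine h.not_mem ((G.gen l).trans (Submodule.span_le.2 ?_) h.y_mem)
  rintro _ ⟨u, hu, v, hv, rfl⟩
  have hu' := h.piece_le G 0 hu
  have hv' := h.piece_le G l hv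
  rw [SetLike.mem_coe]
  clear hu hv
  induction hu' using Submodule.span_induction with
  | mem u hu' =>
    induction hv' using Submodule.span_induction with
    | mem v hv' =>
      rcases hu' with rfl | ⟨-, rfl⟩ | ⟨h0, -⟩
      · rcases hv' with rfl | ⟨-, rfl⟩ | ⟨h0, -⟩
        · exact hmem
        · rw [← lie_skew, h.xe _ (by omega)]
          exact neg_mem (e_mem_span (by omega))
        · omega
      · rcases hv' with rfl | ⟨-, rfl⟩ | ⟨h0, -⟩
        · rw [h.xe _ (by omega)]
          exact e_mem_span (by omega)
        · rw [lie_self]; exact zero_mem _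
        · omega
      · omega
    | zero => rw [lie_zero]; exact zero_mem _
    | add v w _ _ h1 h2 => rw [lie_add]; exact add_mem h1 h2
    | smul c v _ h1 => rw [lie_smul]; exact Submodule.smul_mem _ _ h1
  | zero => rw [zero_lie]; exact zero_mem _
  | add v w _ _ h1 h2 => rw [add_lie]; exact add_mem h1 h2
  | smul c v _ h1 => rw [smul_lie]; exact Submodule.smul_mem _ _ h1

/-- Modulo the chain, the brackets `[e_i, e_j]` of degree `k+1` are multiples of `y` with
coefficients `B i j`. These alternate because `ad x` kills `y`, are not all zero because `y` is
generated, and are antisymmetric, which forces `k` to be even. Rescaling `y` by `B 1 k` gives the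
table. -/
theorem exists_isTable (G : NatGrading V π) (hm : 4 ≤ m) (hd : Module.finrank ℂ 𝔤 = 2 * m + 1)
    (hC : C 𝔤 (2 * m - 1) = ⊥) (hk : 1 ≤ k) (hxy : ⁅x, y⁆ = 0) {b : ℂ} (h12 : ⁅e 1, e 2⁆ = b • y)
    (hb : k ≠ 2 → b = 0) :
    ∃ (t : ℕ) (A : ℕ → ℕ → ℂ) (f : ℂ) (y' : 𝔤), IsTable m t A f x e y' ∧ A 1 2 = 0 := by
  -- The pair `(1, 2)` is treated apart, so that the chosen `A 1 2` is zero.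
  have hAB : ∀ i j, ∃ a b : ℂ, 1 ≤ i → 1 ≤ j → (⁅e i, e j⁆ = a • e (i + j) + b • y ∧
      (i + j ≠ k + 1 → b = 0) ∧ (i = 1 → j = 2 → a = 0)) := by
    intro i j
    by_cases hij : 1 ≤ i ∧ 1 ≤ j
    · by_cases h2 : i = 1 ∧ j = 2
      · obtain ⟨rfl, rfl⟩ := h2
        exact ⟨0, b, fun _ _ => ⟨by rw [h12]; simp, fun h0 => hb (by omega), fun _ _ => rfl⟩⟩
      · obtain ⟨p, rfl⟩ : ∃ p, i = p + 1 := ⟨i - 1, by omega⟩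
        obtain ⟨q, rfl⟩ : ∃ q, j = q + 1 := ⟨j - 1, by omega⟩
        obtain ⟨a, b, hab, hb⟩ := h.exists_eq G (by omega) (G.lie_mem p q _ (h.e_mem p) _ (h.e_mem q))
        rw [show p + q + 1 + 1 = p + 1 + (q + 1) by omega] at hab
        exact ⟨a, b, fun _ _ => ⟨hab, fun h0 => hb (by omega), fun h1 h3 => absurd ⟨h1, h3⟩ h2⟩⟩
    · exact ⟨0, 0, fun h1 h2 => absurd ⟨h1, h2⟩ hij⟩
  choose A B hAB using hAB
  have hee : ∀ i j, 1 ≤ i → 1 ≤ j → ⁅e i, e j⁆ = A i j • e (i + j) + B i j • y :=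
    fun i j hi hj => (hAB i j hi hj).1
  have hB0 : ∀ i j, 1 ≤ i → 1 ≤ j → i + j ≠ k + 1 → B i j = 0 :=
    fun i j hi hj => (hAB i j hi hj).2.1
  have hβ : B 1 k ≠ 0 := by
    intro h0
    refine h.lie_e_one_not_mem G hk ?_
    rw [hee 1 k le_rfl hk, h0, zero_smul, add_zero]
    exact Submodule.smul_mem _ _ (e_mem_span (by omega))
  have hBder : ∀ i j, 1 ≤ i → 1 ≤ j → i + j = k → B (i + 1) j = -B i (j + 1) := by
    intro i j hi hj hij
    have h1 := leibniz_lie x (e i) (e j)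
    rw [hee i j hi hj, hB0 i j hi hj (by omega), zero_smul, add_zero, lie_smul, h.xe _ (by omega),
      h.xe i hi, h.xe j hj, hee _ _ (by omega) hj, hee _ _ hi (by omega),
      show i + 1 + j = i + j + 1 by omega, ← Nat.add_assoc i j 1] at h1
    have h2 : (B (i + 1) j + B i (j + 1)) • y =
        (A i j - A (i + 1) j - A i (j + 1)) • e (i + j + 1) := by
      rw [sub_smul, sub_smul, h1]; module
    refine eq_neg_of_add_eq_zero_left (h.smul_y_eq_zero ?_)
    rw [h2]
    exact Submodule.smul_mem _ _ (e_mem_span (by omega))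
  have hB : ∀ i j, 1 ≤ i → 1 ≤ j → i + j = k + 1 → B i j = (-1) ^ (i + 1) * B 1 k := by
    intro i j hi
    induction i, hi using Nat.le_induction generalizing j with
    | base =>
      intro hj hij
      obtain rfl : j = k := by omega
      norm_num
    | succ i hi ih =>
      intro hj hij
      rw [hBder i j hi hj (by omega), ih (j + 1) (by omega) (by omega), pow_succ]
      ring
  have hk2 : Even k := by
    have h1 := lie_skew (e 1) (e k)
    rw [hee 1 k le_rfl hk, hee k 1 hk le_rfl, Nat.add_comm 1 k] at h1
    have h2 : (B k 1 + B 1 k) • y = (-A k 1 - A 1 k) • e (k + 1) := by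
      have : -(A k 1 • e (k + 1) + B k 1 • y) - (A 1 k • e (k + 1) + B 1 k • y) = 0 := by
        rw [h1, sub_self]
      rw [← sub_eq_zero, ← neg_eq_zero, ← this]
      module
    have h3 : B k 1 + B 1 k = 0 := h.smul_y_eq_zero (by
      rw [h2]; exact Submodule.smul_mem _ _ (e_mem_span (by omega)))
    rw [hB k 1 hk le_rfl rfl] at h3
    by_contra hodd
    rw [Nat.not_even_iff_odd] at hodd
    rw [hodd.add_one.neg_one_pow] at h3
    exact hβ (by linear_combination (1 / 2) * h3)
  obtain ⟨t, ht⟩ := hk2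
  have hlt : k < 2 * m - 1 := by
    by_contra h0
    have h1 := h.y_mem
    rw [G.lie_ne_mem hC (by omega), Submodule.mem_bot] at h1
    exact h.not_mem (h1 ▸ zero_mem _)
  obtain ⟨f, g, hf, hg⟩ := h.exists_eq G (by omega) (G.lie_mem 0 k _ (h.e_mem 0) _ h.y_mem)
  rw [hg (by omega), zero_smul, add_zero] at hf
  have hey : ∀ j, 1 ≤ j → ⁅e j, y⁆ = f • e (j + (2 * t + 1)) := by
    intro j hj
    induction j, hj using Nat.le_induction with
    | base =>
      rw [show 1 + (2 * t + 1) = 0 + k + 1 + 1 by omega]; exact hf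
    | succ j hj ih =>
      rw [← h.xe j hj, lie_lie, ih, hxy, lie_zero, sub_zero, lie_smul, h.xe _ (by omega)]
      congr 2
      omega
  refine ⟨t, A, B 1 k * f, B 1 k • y, ⟨hm, by omega, by omega, h.zero, h.xe, ?_, ?_, ?_, ?_, hd⟩,
    (hAB 1 2 le_rfl (by omega)).2.2 rfl rfl⟩
  · rw [lie_smul, hxy, smul_zero]
  · intro i j hi hj
    rw [hee i j hi hj]
    split_ifs with hij
    · rw [hB i j hi hj (by omega), smul_smul]
    · rw [hB0 i j hi hj (by omega), zero_smul]
  · intro j hj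
    rw [lie_smul, hey j hj, smul_smul]
  · rw [eq_top_iff, ← h.span, Submodule.span_le]
    rintro z ((rfl | rfl) | hz)
    · exact Submodule.subset_span (by simp)
    · rw [SetLike.mem_coe, ← Submodule.smul_mem_iff _ hβ]
      exact Submodule.subset_span (by simp)
    · exact Submodule.subset_span (Or.inr hz)

end

end IsFrame

/-- The dimension is the sum of the block sizes, and the long block provides a vector on which
`ad(X)^{2m-2}` does not vanish. -/
theorem exists_isTable [FiniteDimensional ℂ 𝔤] (hm : 4 ≤ m)
    (hns : IsNonsplit 𝔤) (hch : HasCharSeq 𝔤 [2 * m - 1, 1, 1]) (hP : IsP2 𝔤) :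
    ∃ (t : ℕ) (A : ℕ → ℕ → ℂ) (f : ℂ) (x : 𝔤) (e : ℕ → 𝔤) (y : 𝔤),
      IsTable m t A f x e y ∧ A 1 2 = 0 := by
  obtain ⟨-, hng, hcp, hc2⟩ := hP
  obtain ⟨V, π, G⟩ := hng.exists_natGrading
  obtain ⟨⟨X, -, hX⟩, -⟩ := hch
  have hd : Module.finrank ℂ 𝔤 = 2 * m + 1 := by
    rw [hX.finrank_eq]
    simp only [List.sum_cons, List.sum_nil]
    omega
  obtain ⟨z, hz⟩ := hX.exists_pow_ne_zero
  rw [show 2 * m - 1 - 1 = 2 * m - 2 by omega] at hz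
  have hC2 : C 𝔤 (2 * m) = ⊥ := by
    have := G.C_eq_bot_of_finrank hd (by omega)
    rwa [Nat.add_sub_cancel] at this
  -- The remaining possibility, nilindex `2m`, is even and so incompatible with (P2).
  have hC : C 𝔤 (2 * m - 1) = ⊥ := by
    by_contra hne
    have h1 : nilindex 𝔤 = 2 * m := by
      obtain ⟨n, hn⟩ : ∃ n, 2 * m = n + 1 := ⟨2 * m - 1, by omega⟩
      rw [hn, LieModule.nilpotencyLength_eq_succ_iff ℂ, ← hn]
      exact ⟨hC2, by rwa [show n = 2 * m - 1 by omega]⟩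
    have h2 := odd_nilindex (by omega) hcp hc2
    rw [h1] at h2
    exact (Nat.not_odd_iff_even.2 (even_two_mul m)) h2
  obtain ⟨k, x, e, y, h⟩ := G.exists_isFrame (by omega) hd hC hz
  obtain ⟨y, h, hxy⟩ := h.exists_xy_eq_zero G
  have hk : 1 ≤ k := by
    by_contra h0
    exact h.not_isNonsplit G (by omega) hxy hns
  obtain ⟨e, h, b, h12, hb⟩ := h.exists_lie_e_one G (by omega)
  obtain ⟨t, A, f, y, h⟩ := h.exists_isTable G hm hd hC hk hxy h12 hb
  exact ⟨t, A, f, x, e, y, h⟩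

end

/-! ### Invariants separating the models. -/

section

variable {𝔤 : Type*} [LieRing 𝔤] [LieAlgebra ℂ 𝔤] {m t : ℕ} {A : ℕ → ℕ → ℂ} {f : ℂ}
  {x : 𝔤} {e : ℕ → 𝔤} {y : 𝔤}

namespace IsTable

variable (h : IsTable m t A f x e y)
include h

theorem e_y_mem_C {a b : ℂ} (hab : a • e (2 * t + 1) + b • y ∈ C 𝔤 (2 * t + 1)) : a = 0 ∧ b = 0 := by
  have := h.lt
  have h1 := h.e_mem_piece (2 * t + 1) (by omega)
  rw [Nat.add_sub_cancel] at h1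
  have h2 : a • e (2 * t + 1) + b • y ∈ h.piece (2 * t) :=
    add_mem (Submodule.smul_mem _ _ h1) (Submodule.smul_mem _ _ h.y_mem_piece)
  have h3 := h.grading.eq_zero_of_mem (by omega) h2 hab
  exact h.e_y_eq_zero (by omega) (by omega) h3

/-- The degree of `y` is an invariant. -/
theorem t_unique {t' : ℕ} {A' : ℕ → ℕ → ℂ} {f' : ℂ} {x' : 𝔤} {e' : ℕ → 𝔤} {y' : 𝔤}
    (h' : IsTable m t' A' f' x' e' y') : t = t' := by
  by_contra ht
  have h1 := h'.one_le
  -- Besides degree one, the only two-dimensional component is that of `y`. If the degrees of `y`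
  -- and `y'` differed, `e'_{2t'+1}` and `y'` would both be multiples of `e_{2t'+1}` modulo
  -- `C^{2t'+1}`, hence dependent there.
  obtain ⟨a, b, hab, hb⟩ := h.exists_sub_mem_C (k := 2 * t') (by omega)
    (h'.e_mem_C (j := 2 * t' + 1) le_rfl)
  obtain ⟨c, d, hcd, hd⟩ := h.exists_sub_mem_C (k := 2 * t') (by omega) (h'.y_mem_C le_rfl)
  rw [hb (by omega), zero_smul, add_zero] at hab
  rw [hd (by omega), zero_smul, add_zero] at hcd
  have h2 := h'.e_y_mem_C (a := c) (b := -a) (by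
    have := sub_mem ((C 𝔤 (2 * t' + 1)).smul_mem c hab) ((C 𝔤 (2 * t' + 1)).smul_mem a hcd)
    have h3 : c • e' (2 * t' + 1) + -a • y' = c • (e' (2 * t' + 1) - a • e (2 * t' + 1)) -
      a • (y' - c • e (2 * t' + 1)) := by module
    rwa [h3])
  have h3 : a = 0 := neg_eq_zero.1 h2.2
  rw [h3, zero_smul, sub_zero] at hab
  have h4 := h'.e_y_mem_C (a := 1) (b := 0) (by simpa using hab)
  exact one_ne_zero h4.1

theorem lie_y_eq_zero (hf : f = 0) (u : 𝔤) : ⁅u, y⁆ = 0 := by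
  have hu : u ∈ Submodule.span ℂ ({x, y} ∪ e '' {j | 1 ≤ j}) := by rw [h.span]; trivial
  induction hu using Submodule.span_induction with
  | mem u hu =>
    rcases hu with (rfl | rfl) | ⟨j, hj, rfl⟩
    · exact h.xy
    · exact lie_self _
    · rw [h.ey j hj, hf, zero_smul]
  | zero => exact zero_lie _
  | add u v _ _ hu hv => rw [add_lie, hu, hv, add_zero]
  | smul c u _ hu => rw [smul_lie, hu, smul_zero]

/-- The leading part `a e_{2t+1} + b y` of a central element is killed by `x`, which gives `a = 0`,
and then by `e_1`, which gives `b f = 0`. -/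
theorem mem_C_of_central (ht : t + 2 ≤ m) (hf : f ≠ 0) {z : 𝔤} (hz : z ∈ C 𝔤 (2 * t))
    (hc : ∀ u : 𝔤, ⁅u, z⁆ = 0) : z ∈ C 𝔤 (2 * t + 1) := by
  have h1 := h.one_le
  obtain ⟨a, b, hab, -⟩ := h.exists_sub_mem_C (k := 2 * t) (by omega) hz
  have ha : a = 0 := by
    have h2 := neg_mem (lie_mem_C_succ x hab)
    rw [lie_sub, hc, zero_sub, neg_neg, lie_add, lie_smul, lie_smul, h.xy, smul_zero, add_zero,
      h.xe _ (by omega)] at h2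
    exact h.smul_e_mem_C (by omega) (by omega) h2
  have hb : b = 0 := by
    have h2 := neg_mem (lie_mem_C_succ (e 1) hab)
    rw [lie_sub, hc, zero_sub, neg_neg, ha, zero_smul, zero_add, lie_smul, h.ey 1 le_rfl,
      smul_smul, Nat.add_comm 1 (2 * t + 1)] at h2
    exact (mul_eq_zero.1 (h.smul_e_mem_C (by omega) (by omega) h2)).resolve_right hf
  simpa [ha, hb] using hab

/-- Vanishing of `f` is intrinsic: when `f = 0` the vector `y` is central and lies in `C^{2t}` but
not in `C^{2t+1}`, while `f' ≠ 0` excludes such an element. -/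
theorem f_ne_zero_of {A' : ℕ → ℕ → ℂ} {f' : ℂ} {x' : 𝔤} {e' : ℕ → 𝔤} {y' : 𝔤}
    (h' : IsTable m t A' f' x' e' y') (ht : t + 2 ≤ m) (hf : f = 0) : f' = 0 := by
  by_contra hf'
  have h1 := h'.mem_C_of_central ht hf' (h.y_mem_C le_rfl) (h.lie_y_eq_zero hf)
  have h2 := h.e_y_mem_C (a := 0) (b := 1) (by simpa using h1)
  exact one_ne_zero h2.2

end IsTable

/-- A property distinguishing `𝔤¹_(4,2)` from `𝔤³_(4,2)`. -/
def HasSquareZeroElement (𝔤 : Type*) [LieRing 𝔤] [LieAlgebra ℂ 𝔤] : Prop :=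
  ∃ u : 𝔤, u ∉ C 𝔤 1 ∧ (∀ v ∈ C 𝔤 5, ⁅u, v⁆ = 0) ∧ ∀ v ∈ C 𝔤 3, ⁅u, ⁅u, v⁆⁆ ∈ C 𝔤 6

namespace IsTable

variable {γ : ℂ}

/-- The element is `e_1`: for `γ = 0` it annihilates `e_6`, and its square annihilates `e_4` because
`[e_1, e_4] = e_5 + y` and `[e_1, e_5 + y] = 0`. -/
theorem hasSquareZeroElement
    (h : IsTable 4 2 (exceptionalCoeff 4 0) (-(((4 : ℕ) : ℂ) - 2)) x e y) :
    HasSquareZeroElement 𝔤 := by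
  have b14 := h.ee 1 4 (by omega) (by omega)
  have b15 := h.ee 1 5 (by omega) (by omega)
  have b16 := h.ee 1 6 (by omega) (by omega)
  have y1 := h.ey 1 (by omega)
  norm_num [exceptionalCoeff] at b14 b15 b16 y1
  refine ⟨e 1, fun h1 => ?_, fun v hv => ?_, fun v hv => ?_⟩
  · exact h.e_not_mem_C le_rfl (by omega) h1
  · obtain ⟨a, b, hab, hb⟩ := h.exists_sub_mem_C (by omega) hv
    rw [hb (by omega), zero_smul, add_zero] at hab
    have h1 := h.eq_zero_of_mem_C (k := 7) (by omega) (lie_mem_C_succ (e 1) hab)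
    rw [lie_sub, lie_smul, b16, smul_zero, sub_zero] at h1
    exact h1
  · obtain ⟨a, b, hab, hb⟩ := h.exists_sub_mem_C (by omega) hv
    rw [hb (by omega), zero_smul, add_zero] at hab
    have h1 := lie_mem_C_succ (e 1) (lie_mem_C_succ (e 1) hab)
    rw [lie_sub, lie_sub, lie_smul, b14, lie_smul, lie_add, b15, y1, add_neg_cancel, smul_zero,
      sub_zero] at h1
    exact h1

/-- For `u = p x + q e_1` modulo `C^1`, annihilating `e_6` means `p + q = 0` when `γ = 1`, and the
square on `e_4` gives `p (p + 3q) = 0`. Together they force `p = q = 0`. -/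
theorem not_hasSquareZeroElement
    (h : IsTable 4 2 (exceptionalCoeff 4 1) (-(((4 : ℕ) : ℂ) - 2)) x e y) :
    ¬ HasSquareZeroElement 𝔤 := by
  have b14 := h.ee 1 4 (by omega) (by omega)
  have b15 := h.ee 1 5 (by omega) (by omega)
  have b16 := h.ee 1 6 (by omega) (by omega)
  have y1 := h.ey 1 (by omega)
  norm_num [exceptionalCoeff] at b14 b15 b16 y1
  rintro ⟨u, hu, h5, h3⟩
  obtain ⟨p, q, hpq⟩ := h.exists_sub_mem_C_one u
  have h6 : p + q = 0 := by
    have h1 := lie_mem_C 𝔤 hpq (h.e_mem_C (k := 5) (j := 6) le_rfl)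
    rw [sub_lie, h5 _ (h.e_mem_C le_rfl), zero_sub, add_lie, smul_lie, smul_lie, h.xe 6 (by omega),
      b16, ← add_smul] at h1
    have h2 := h.eq_zero_of_mem_C (by omega) h1
    exact h.smul_e_eq_zero (by omega) (by omega) (neg_eq_zero.1 h2)
  have h7 : p * (p + 3 * q) = 0 := by
    have he : e 4 ∈ C 𝔤 3 := h.e_mem_C le_rfl
    have h1 := lie_mem_C 𝔤 hpq (lie_mem_C_succ (p • x + q • e 1) he)
    have h2 := lie_mem_C_succ u (lie_mem_C 𝔤 hpq he)
    have h4 : ⁅p • x + q • e 1, ⁅p • x + q • e 1, e 4⁆⁆ ∈ C 𝔤 6 := by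
      rw [sub_lie] at h1
      rw [sub_lie, lie_sub] at h2
      have := sub_mem (sub_mem (h3 _ he) h2) h1
      rwa [show ∀ a b d : 𝔤, a - (a - b) - (b - d) = d from
        fun a b d => by abel] at this
    have h8 : ⁅p • x + q • e 1, ⁅p • x + q • e 1, e 4⁆⁆ = (p * (p + 3 * q)) • e 6 := by
      simp only [add_lie, smul_lie, lie_add, lie_smul, h.xe 4 (by omega), b14, h.xe 5 (by omega),
        b15, h.xy, y1]
      module
    rw [h8] at h4
    exact h.smul_e_mem_C (by omega) (by omega) h4
  have h8 : p = 0 := by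
    have : p ^ 2 = 0 := by linear_combination (3 / 2) * p * h6 - (1 / 2) * h7
    exact pow_eq_zero_iff (by norm_num) |>.1 this
  have h9 : q = 0 := by rw [h8, zero_add] at h6; exact h6
  rw [h8, h9] at hpq
  exact hu (by simpa using hpq)

end IsTable

end

/-! ### Parameters of the models, and their pairwise non-isomorphism. -/

/-- The degree of the last basis vector of a model is `2t+1`. -/
def Model.t : Model → ℕ
  | g1 => 2
  | g2 _ t _ _ _ => t
  | g3 m _ => m - 2
  | g4 m _ => m - 1

/-- The structure constants of the table of a model. -/
def Model.coeff : Model → ℕ → ℕ → ℂ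
  | g1 => exceptionalCoeff 4 1
  | g2 m _ _ _ _ => topCoeff m
  | g3 m _ => exceptionalCoeff m 0
  | g4 _ _ => fun _ _ => 0

/-- The coefficient in the brackets with the last basis vector of a model. -/
def Model.lastCoeff : Model → ℂ
  | g1 => -(((4 : ℕ) : ℂ) - 2)
  | g2 _ _ _ _ _ => 0
  | g3 m _ => -((m : ℂ) - 2)
  | g4 _ _ => 0

theorem Model.isTable : ∀ M : Model, ∃ (x : M.law.Alg) (e : ℕ → M.law.Alg) (y : M.law.Alg),
    IsTable M.m M.t M.coeff M.lastCoeff x e y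
  | g1 => isTable_g1
  | g2 m t hm ht ht' => isTable_g2 m t hm ht ht'
  | g3 m hm => isTable_g3 m hm
  | g4 m hm => isTable_g4 m hm

theorem lastCoeff_ne_zero {m : ℕ} (hm : 4 ≤ m) : -((m : ℂ) - 2) ≠ 0 := by
  rw [neg_ne_zero, sub_ne_zero]
  exact_mod_cast (by omega : m ≠ 2)

theorem Model.coeff_ne_zero (M : Model) : M.coeff (M.m - 1) M.m ≠ 0 ∨ M.t = M.m - 1 := by
  have key : ∀ m : ℕ, 4 ≤ m → exceptionalCoeff m 0 (m - 1) m ≠ 0 := by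
    intro m hm
    obtain ⟨n, rfl⟩ : ∃ n, m = n + 4 := ⟨m - 4, by omega⟩
    unfold exceptionalCoeff
    rw [if_neg (by omega), if_neg (by omega), if_pos (by omega), show n + 4 - 1 = n + 3 by omega]
    refine mul_ne_zero (pow_ne_zero _ (by norm_num)) ?_
    intro h0
    push_cast at h0
    -- Up to sign the coefficient is `(m-2)(m-1)/2`, with `m = n + 4`.
    have h1 : ((n : ℂ) + 2) * (n + 3) = 0 := by linear_combination -2 * h0
    norm_cast at h1
  rcases M with _ | ⟨m, t, hm, ht, ht'⟩ | ⟨m, hm⟩ | ⟨m, hm⟩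
  · left
    change exceptionalCoeff 4 1 3 4 ≠ 0
    norm_num [exceptionalCoeff]
  · left
    change topCoeff m (m - 1) m ≠ 0
    unfold topCoeff
    rw [if_pos (by omega)]
    exact pow_ne_zero _ (by norm_num)
  · exact Or.inl (key m hm)
  · exact Or.inr rfl

theorem Model.lastCoeff_eq_zero (M : Model) : M.lastCoeff = 0 ∨ M.t = M.m - 2 := by
  rcases M with _ | ⟨m, t, hm, ht, ht'⟩ | ⟨m, hm⟩ | ⟨m, hm⟩
  · exact Or.inr rfl
  · exact Or.inl rfl
  · exact Or.inr rfl
  · exact Or.inl rfl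

/-- Both tables are placed on the same algebra. Dimension gives `m` and `t_unique` gives `t`; for
equal `t` the vanishing of `f` separates `g2` from `g1` and `g3`, and the square-zero property
separates `g1` from `g3`. -/
theorem Model.eq_of_equiv {M N : Model} (φ : M.law.Alg ≃ₗ⁅ℂ⁆ N.law.Alg) : M = N := by
  obtain ⟨x, e, y, h⟩ := M.isTable
  obtain ⟨x', e', y', h'⟩ := N.isTable
  obtain ⟨x₁, e₁, y₁, h⟩ : ∃ (x₁ : N.law.Alg) (e₁ : ℕ → N.law.Alg) (y₁ : N.law.Alg),
    IsTable M.m M.t M.coeff M.lastCoeff x₁ e₁ y₁ := ⟨_, _, _, h.map φ⟩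
  have hm : M.m = N.m := by
    have h1 := h.dim
    rw [h'.dim] at h1
    omega
  rw [hm] at h
  have ht : M.t = N.t := h.t_unique h'
  rw [ht] at h
  rcases M with _ | ⟨m, t, hm₁, ht₁, ht₁'⟩ | ⟨m, hm₁⟩ | ⟨m, hm₁⟩ <;>
    rcases N with _ | ⟨m', t', hm₂, ht₂, ht₂'⟩ | ⟨m', hm₂⟩ | ⟨m', hm₂⟩ <;>
    simp only [Model.m, Model.t] at hm ht
  · rfl
  · exact absurd (h'.f_ne_zero_of h (by simp only [Model.m, Model.t]; omega) rfl)
      (lastCoeff_ne_zero le_rfl)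
  · subst hm
    exact absurd (IsTable.hasSquareZeroElement h') (IsTable.not_hasSquareZeroElement h)
  · omega
  · exact absurd (h.f_ne_zero_of h' (by simp only [Model.m, Model.t]; omega) rfl)
      (lastCoeff_ne_zero le_rfl)
  · subst hm; subst ht; rfl
  · exact absurd (h.f_ne_zero_of h' (by simp only [Model.m, Model.t]; omega) rfl)
      (lastCoeff_ne_zero hm₂)
  · omega
  · subst hm
    exact absurd (IsTable.hasSquareZeroElement h) (IsTable.not_hasSquareZeroElement h')
  · exact absurd (h'.f_ne_zero_of h (by simp only [Model.m, Model.t]; omega) rfl)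
      (lastCoeff_ne_zero hm₁)
  · subst hm; rfl
  · omega
  · omega
  · omega
  · omega
  · subst hm; rfl

theorem Model.isP2_of_equiv {𝔤 : Type*} [LieRing 𝔤] [LieAlgebra ℂ 𝔤] {M : Model} (φ : 𝔤 ≃ₗ⁅ℂ⁆ M.law.Alg) : IsP2 𝔤 := by
  obtain ⟨x, e, y, h⟩ := M.isTable
  exact (h.map φ.symm).isP2 M.coeff_ne_zero M.lastCoeff_eq_zero

/-! ### Central extensions -/

theorem coordForm_restrict {n N : ℕ} (hN : N = n + 1) {i : ℕ} (hi : i ≤ n) (z : Fin N → ℂ) :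
    coordForm N i z = coordForm n i fun j => z ⟨j.1, by omega⟩ := by
  unfold coordForm
  by_cases h : 1 ≤ i
  · rw [dif_pos ⟨h, by omega⟩, dif_pos ⟨h, hi⟩]; rfl
  · rw [dif_neg (by omega), dif_neg (by omega)]; rfl

theorem wedge_restrict {n N : ℕ} (hN : N = n + 1) {i j : ℕ} (hi : i ≤ n) (hj : j ≤ n)
    (u v : Fin N → ℂ) :
    wedge N i j u v = wedge n i j (fun j => u ⟨j.1, by omega⟩) fun j => v ⟨j.1, by omega⟩ := by
  simp only [wedge_apply, coordForm_restrict hN hi, coordForm_restrict hN hj]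

/-- If no structural equation involves the last coordinate, the last basis vector is central, and
forgetting that coordinate is a homomorphism onto the algebra of the remaining equations. -/
theorem isCentralExtension_of_forms {n N : ℕ} (hN : N = n + 1) {L : LieLaw N} {L' : LieLaw n}
    {d : ℕ → (Fin N → ℂ) →ₗ[ℂ] (Fin N → ℂ) →ₗ[ℂ] ℂ}
    {d' : ℕ → (Fin n → ℂ) →ₗ[ℂ] (Fin n → ℂ) →ₗ[ℂ] ℂ}
    (hL : L.μ = lawOf d) (hL' : L'.μ = lawOf d')
    (hd : ∀ k, 1 ≤ k → k ≤ n → ∀ u v, d k u v =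
      d' k (fun j => u ⟨j.1, by omega⟩) fun j => v ⟨j.1, by omega⟩)
    {F : (Fin n → ℂ) →ₗ[ℂ] (Fin n → ℂ) →ₗ[ℂ] ℂ}
    (hF : ∀ u v, d (n + 1) u v = F (fun j => u ⟨j.1, by omega⟩) fun j => v ⟨j.1, by omega⟩) :
    IsCentralExtension L.Alg L'.Alg := by
  subst hN
  let p : L.Alg →ₗ⁅ℂ⁆ L'.Alg :=
    { toFun := fun z => (fun j => z j.castSucc : Fin n → ℂ)
      map_add' := fun _ _ => rfl
      map_smul' := fun _ _ => rfl
      map_lie' := by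
        intro u v
        refine LieLaw.ext_crd fun k => ?_
        change L.μ u v k.castSucc = L'.μ (fun j => u j.castSucc) (fun j => v j.castSucc) k
        rw [hL, hL']
        exact hd (k.1 + 1) (by omega) (by omega) u v }
  let i : ℂ →ₗ[ℂ] L.Alg := LinearMap.toSpanSingleton ℂ L.Alg (L.X (n + 1))
  have hi : ∀ (c : ℂ) (k : Fin (n + 1)), L.crd k (i c) = if k.1 = n then c else 0 := by
    intro c k
    rw [LinearMap.toSpanSingleton_apply, map_smul, L.crd_X, smul_eq_mul, mul_ite, mul_one, mul_zero]
    simp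
  have hpi : ∀ c, p (i c) = 0 := by
    intro c
    refine LieLaw.ext_crd fun k => ?_
    exact (hi c k.castSucc).trans (if_neg (by simp; omega))
  refine ⟨i, p, ?_, ?_, ?_, ?_⟩
  · intro c c' hcc
    have := congrArg (L.crd (Fin.last n)) hcc
    simpa [hi] using this
  · intro z
    constructor
    · intro hz
      refine ⟨L.crd (Fin.last n) z, LieLaw.ext_crd fun k => ?_⟩
      rw [hi]
      split_ifs with hk
      · congr 2; exact Fin.ext hk.symm
      · have := congrArg (L'.crd ⟨k.1, by omega⟩) hz
        rw [map_zero] at this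
        exact this.symm
    · rintro ⟨c, rfl⟩
      exact hpi c
  · intro w
    refine ⟨(Fin.snoc w 0 : Fin (n + 1) → ℂ), LieLaw.ext_crd fun k => ?_⟩
    exact Fin.snoc_castSucc (α := fun _ => ℂ) 0 w k
  · intro c
    rw [LieModule.mem_maxTrivSubmodule]
    intro u
    have key : ∀ a b : Fin (n + 1) → ℂ, (fun j : Fin n => b ⟨j.1, by omega⟩) = 0 → L.μ a b = 0 := by
      intro a b hb
      funext k
      rw [hL]
      change d (k.1 + 1) a b = 0
      by_cases hk : k.1 = n
      · rw [hk, hF, hb, map_zero]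
      · rw [hd _ (by omega) (by omega), hb, map_zero]
    exact key u (i c) (hpi c)

theorem isCentralExtension_g2 (m t : ℕ) (hm : 4 ≤ m) (ht' : t + 2 ≤ m) :
    IsCentralExtension (lawg2 m t hm ht').Alg (lawQ m (Nat.le_of_succ_le hm)).Alg := by
  refine isCentralExtension_of_forms rfl (d := dg2 m t) (d' := dQ m)
    (F := ∑ j ∈ Finset.Icc 2 (t + 1), (-1 : ℂ) ^ j • wedge (2 * m) j (2 * t + 3 - j)) rfl rfl ?_ ?_
  · intro k h1 h2 u v
    unfold dg2 dQ
    split_ifs with h3 h4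
    · exact wedge_restrict rfl (by omega) (by omega) u v
    · simp only [LinearMap.add_apply, LinearMap.sum_apply, LinearMap.smul_apply]
      rw [wedge_restrict rfl (by omega) (by omega) u v]
      congr 1
      refine Finset.sum_congr rfl fun j hj => ?_
      rw [Finset.mem_Icc] at hj
      rw [wedge_restrict rfl (by omega) (by omega) u v]
    · omega
    · rfl
  · intro u v
    unfold dg2
    rw [if_neg (by omega), if_neg (by omega), if_pos rfl]
    simp only [LinearMap.sum_apply, LinearMap.smul_apply]
    refine Finset.sum_congr rfl fun j hj => ?_
    rw [Finset.mem_Icc] at hj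
    rw [wedge_restrict rfl (by omega) (by omega) u v]

theorem isCentralExtension_g4 (m : ℕ) (hm : 4 ≤ m) :
    IsCentralExtension (lawg4 m hm).Alg (lawL (2 * m - 1)).Alg := by
  have hN : 2 * m + 1 = (2 * m - 1 + 1) + 1 := by omega
  refine isCentralExtension_of_forms hN (d := dg4 m) (d' := dL (2 * m - 1))
    (F := ∑ j ∈ Finset.Icc 2 m, (-1 : ℂ) ^ j • wedge (2 * m - 1 + 1) j (2 * m + 1 - j)) rfl rfl
    ?_ ?_
  · intro k h1 h2 u v
    unfold dg4 dL
    by_cases h3 : 3 ≤ k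
    · rw [if_pos (by omega), if_pos (by omega)]
      exact wedge_restrict hN (by omega) (by omega) u v
    · rw [if_neg (by omega), if_neg (by omega), if_neg (by omega)]
      rfl
  · intro u v
    unfold dg4
    rw [if_neg (by omega), if_pos (by omega)]
    simp only [LinearMap.sum_apply, LinearMap.smul_apply]
    refine Finset.sum_congr rfl fun j hj => ?_
    rw [Finset.mem_Icc] at hj
    rw [wedge_restrict hN (by omega) (by omega) u v]

end NatGraded

end

theorem theorem4 :
    -- the classification
    (∀ (m : ℕ), 4 ≤ m → ∀ (𝔤 : Type*) [LieRing 𝔤] [LieAlgebra ℂ 𝔤] [FiniteDimensional ℂ 𝔤],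
      LieRing.IsNilpotent 𝔤 → IsNonsplit 𝔤 → IsNaturallyGraded 𝔤 →
      HasCharSeq 𝔤 [2 * m - 1, 1, 1] →
      (IsP2 𝔤 ↔ ∃ M : Model, M.m = m ∧ Nonempty (𝔤 ≃ₗ⁅ℂ⁆ M.law.Alg))) ∧
    -- the models satisfy the assumptions of the classification
    (∀ M : Model, LieRing.IsNilpotent M.law.Alg ∧ IsNonsplit M.law.Alg ∧
      IsNaturallyGraded M.law.Alg ∧ HasCharSeq M.law.Alg [2 * M.m - 1, 1, 1]) ∧
    -- the models are pairwise non-isomorphic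
    (∀ M N : Model, Nonempty (M.law.Alg ≃ₗ⁅ℂ⁆ N.law.Alg) → M = N) ∧
    -- apart from the models g1 and g3, they are central extensions of `Q_{2m-1}` or `L_{2m-1}`
    (∀ (m t : ℕ) (hm : 4 ≤ m) (ht : 1 ≤ t) (ht' : t + 2 ≤ m),
      IsCentralExtension (Model.g2 m t hm ht ht').law.Alg
        (lawQ m (Nat.le_of_succ_le hm)).Alg) ∧
    (∀ (m : ℕ) (hm : 4 ≤ m),
      IsCentralExtension (Model.g4 m hm).law.Alg (lawL (2 * m - 1)).Alg) := by
  refine ⟨?_, ?_, ?_, ?_, ?_⟩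
  · intro m hm 𝔤 _ _ _ _ hns _ hch
    constructor
    · intro hP
      obtain ⟨t, A, f, x, e, y, h, h12⟩ := exists_isTable hm hns hch hP
      exact h.exists_model h12 hP.2.2.1
    · rintro ⟨M, -, ⟨φ⟩⟩
      exact M.isP2_of_equiv φ
  · intro M
    obtain ⟨x, e, y, h⟩ := M.isTable
    exact ⟨h.isNilpotent, h.isNonsplit, h.isNaturallyGraded, h.hasCharSeq⟩
  · rintro M N ⟨φ⟩
    exact M.eq_of_equiv φ
  · intro m t hm _ ht'
    exact isCentralExtension_g2 m t hm ht'
  · exact isCentralExtension_g4
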